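/- **Tree Cutting Problem.** Let $k\ge 0$ be fixed. An instance consists of a tree $T$ with vertex set $\{0,\dots,n-1\}$ ($n\ge 1$), a root $r\in V(T)$ and non-negative integers $t_1,\dots,t_k$. The task is to find connected subgraphs $T_1,\dots,T_k$ of $T$, each containing $r$ (the one-vertex subgraph $\{r\}$ is allowed), such that $E(T_1)\cup\dots\cup E(T_k)=E(T)$ and $|E(T_j)|=t_j$ for all $j$ (exact version), respectively $|E(T_j)|\le t_j$ for all $j$ (bounded version), or to report that no such subgraphs exist. **Theorem.** For every fixed $k$, each of the two versions of the Tree Cutting Problem is solved by a polynomial algorithm that runs in $O_k(n^{2k+1})$ steps. More precisely, for each version there are a constant $C$ and a program for the word RAM, both depending only on $k$ (and on the version), such that on every instance the program halts after at most $C\,n^{2k+1}$ steps with a correct answer: it either outputs $T_1,\dots,T_k$, by stating for each edge $e$ of $T$ and each $j$ whether $e\in E(T_j)$, or reports correctly that there is no solution. The input is the list $n, r, t_1,\dots,t_k$ followed by the two ends of each edge of $T$, the edges being listed in any order. One step is one elementary instruction: setting a constant, one of the operations $+$, truncated $-$, $\times$, integer division, one read or write of a memory cell by indirect addressing, or one test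 for zero in a branch or loop. All numbers that occur in the computation fit into words of $C\ell$ bits, where $\ell$ is the number of binary digits of $n+t_1+\dots+t_k$. -/

import Mathlib

namespace TreeCutting

/-! ### The machine model: structured programs for a word RAM -/

/-- The arithmetic instructions: addition, truncated subtraction, multiplication and
integer division (with `a / 0 = 0`). -/
inductive Op where
  | add
  | sub
  | mul
  | div

/-- The value computed by an arithmetic instruction. -/
def Op.eval : Op → ℕ → ℕ → ℕ
  | .add, a, b => a + b
  | .sub, a, b => a - b
  | .mul, a, b => a * b
  | .div, a, b => a / b

/-- Programs. The arguments of the instructions are names of registers, except for the constant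
in `const`. A program is a finite object, so it uses finitely many registers; unbounded
data live in the memory, which is accessed by indirect addressing. -/
inductive Prog where
  /-- do nothing -/
  | skip
  /-- `reg d := c` -/
  | const (d c : ℕ)
  /-- `reg d := reg a ∘ reg b` -/
  | op (o : Op) (d a b : ℕ)
  /-- `reg d := mem[reg a]` -/
  | load (d a : ℕ)
  /-- `mem[reg a] := reg b` -/
  | store (a b : ℕ)
  /-- first `p`, then `q` -/
  | seq (p q : Prog)
  /-- if `reg a ≠ 0` then `p` else `q` -/
  | ite (a : ℕ) (p q : Prog)
  /-- while `reg a ≠ 0` do `p` -/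
  | loop (a : ℕ) (p : Prog)

/-- A state of the machine: the contents of the registers and of the memory. -/
structure State where
  reg : ℕ → ℕ
  mem : ℕ → ℕ

/-- Write a value into a register. -/
def State.setReg (σ : State) (d v : ℕ) : State :=
  { reg := Function.update σ.reg d v, mem := σ.mem }

/-- Write a value into a memory cell. -/
def State.setMem (σ : State) (a v : ℕ) : State :=
  { reg := σ.reg, mem := Function.update σ.mem a v }

/-- The initial state on an input list: the input stands at the addresses `0, 1, 2, …` of the
memory; all other cells and all registers are `0`. -/
def State.init (input : List ℕ) : State :=
  { reg := fun _ => 0, mem := fun a => input.getD a 0 }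

/-- `Exec w p σ T σ'`: started in state `σ`, on a machine with words of `w` bits, the program `p`
halts after exactly `T` steps in state `σ'`. Every instruction and every evaluation
of the condition of a branch or of a loop is one step. A computed number that does not fit into a
word is an error: the run is then not an execution. -/
inductive Exec (w : ℕ) : Prog → State → ℕ → State → Prop where
  | skip (σ : State) : Exec w .skip σ 1 σ
  | const (σ : State) (d c : ℕ) (h : c < 2 ^ w) : Exec w (.const d c) σ 1 (σ.setReg d c)
  | op (σ : State) (o : Op) (d a b : ℕ) (h : o.eval (σ.reg a) (σ.reg b) < 2 ^ w) :
      Exec w (.op o d a b) σ 1 (σ.setReg d (o.eval (σ.reg a) (σ.reg b)))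
  | load (σ : State) (d a : ℕ) : Exec w (.load d a) σ 1 (σ.setReg d (σ.mem (σ.reg a)))
  | store (σ : State) (a b : ℕ) : Exec w (.store a b) σ 1 (σ.setMem (σ.reg a) (σ.reg b))
  | seq (p q : Prog) (σ σ' σ'' : State) (T T' : ℕ) (hp : Exec w p σ T σ')
      (hq : Exec w q σ' T' σ'') : Exec w (.seq p q) σ (T + T') σ''
  | ite_true (a : ℕ) (p q : Prog) (σ σ' : State) (T : ℕ) (h : σ.reg a ≠ 0)
      (hp : Exec w p σ T σ') : Exec w (.ite a p q) σ (T + 1) σ'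
  | ite_false (a : ℕ) (p q : Prog) (σ σ' : State) (T : ℕ) (h : σ.reg a = 0)
      (hq : Exec w q σ T σ') : Exec w (.ite a p q) σ (T + 1) σ'
  | loop_done (a : ℕ) (p : Prog) (σ : State) (h : σ.reg a = 0) : Exec w (.loop a p) σ 1 σ
  | loop_step (a : ℕ) (p : Prog) (σ σ' σ'' : State) (T T' : ℕ) (h : σ.reg a ≠ 0)
      (hp : Exec w p σ T σ') (hl : Exec w (.loop a p) σ' T' σ'') :
      Exec w (.loop a p) σ (T + 1 + T') σ''

/-- The machine is deterministic. -/
theorem Exec.deterministic {w : ℕ} {p : Prog} {σ σ₁ σ₂ : State} {T₁ T₂ : ℕ}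
    (h₁ : Exec w p σ T₁ σ₁) (h₂ : Exec w p σ T₂ σ₂) : T₁ = T₂ ∧ σ₁ = σ₂ := by
  induction h₁ generalizing T₂ σ₂ with
  | skip => cases h₂; exact ⟨rfl, rfl⟩
  | const => cases h₂; exact ⟨rfl, rfl⟩
  | op => cases h₂; exact ⟨rfl, rfl⟩
  | load => cases h₂; exact ⟨rfl, rfl⟩
  | store => cases h₂; exact ⟨rfl, rfl⟩
  | seq p q σ σ' σ'' T T' hp hq ihp ihq =>
    cases h₂ with
    | seq _ _ _ _ _ _ _ hp' hq' =>
      obtain ⟨rfl, rfl⟩ := ihp hp'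
      obtain ⟨rfl, rfl⟩ := ihq hq'
      exact ⟨rfl, rfl⟩
  | ite_true a p q σ σ' T h hp ih =>
    cases h₂ with
    | ite_true _ _ _ _ _ _ _ hp' => obtain ⟨rfl, rfl⟩ := ih hp'; exact ⟨rfl, rfl⟩
    | ite_false _ _ _ _ _ _ h' _ => exact absurd h' h
  | ite_false a p q σ σ' T h hp ih =>
    cases h₂ with
    | ite_true _ _ _ _ _ _ h' _ => exact absurd h h'
    | ite_false _ _ _ _ _ _ _ hp' => obtain ⟨rfl, rfl⟩ := ih hp'; exact ⟨rfl, rfl⟩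
  | loop_done a p σ h =>
    cases h₂ with
    | loop_done => exact ⟨rfl, rfl⟩
    | loop_step _ _ _ _ _ _ _ h' => exact absurd h h'
  | loop_step a p σ σ' σ'' T T' h hp hl ihp ihl =>
    cases h₂ with
    | loop_done _ _ _ h' => exact absurd h' h
    | loop_step _ _ _ _ _ _ _ _ hp' hl' =>
      obtain ⟨rfl, rfl⟩ := ihp hp'
      obtain ⟨rfl, rfl⟩ := ihl hl'
      exact ⟨rfl, rfl⟩

/-! ### The tree cutting problem -/

/-- An instance of the tree cutting problem with `k` parts: a tree on the vertices
`0, …, n - 1` with a root and prescribed sizes, together with a presentation of the tree for the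
machine, namely a list that contains each edge exactly once, the edges being in any order and
the two ends of each edge in any order. -/
structure Inst (k : ℕ) where
  n : ℕ
  tree : SimpleGraph (Fin n)
  isTree : tree.IsTree
  root : Fin n
  size : Fin k → ℕ
  edges : List (Fin n × Fin n)
  nodup : (edges.map fun e => s(e.1, e.2)).Nodup
  mem_edges : ∀ e : Sym2 (Fin n), e ∈ edges.map (fun e => s(e.1, e.2)) ↔ e ∈ tree.edgeSet

/-- A cutting: connected subgraphs `H 0, …, H (k - 1)` that contain the root and together cover
all edges, where the number of edges of `H j` stands in the relation `R` to the prescribed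
size of index `j`. Here `R` is `=` or `≤`. -/
def Inst.IsCutting {k : ℕ} (R : ℕ → ℕ → Prop) (I : Inst k)
    (H : Fin k → I.tree.Subgraph) : Prop :=
  (∀ j, (H j).Connected ∧ I.root ∈ (H j).verts ∧ R (H j).edgeSet.ncard (I.size j)) ∧
    ⋃ j, (H j).edgeSet = I.tree.edgeSet

/-- The input list of the machine: the number of vertices, the root, the `k` prescribed sizes, and
then the two ends of each edge in the list of edges. -/
def Inst.encode {k : ℕ} (I : Inst k) : List ℕ :=
  I.n :: (I.root : ℕ) :: (List.ofFn I.size ++ I.edges.flatMap fun e => [(e.1 : ℕ), (e.2 : ℕ)])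

/-- The memory contents `M` is a correct answer: either `M 0 = 0` and there is no
cutting, or `M 0 = 1` and the `0`/`1` entries `M (1 + k * i + j)` say, for some cutting `H`, whether
the `i`-th edge in the list of edges belongs to `H j`. -/
def Inst.IsAnswer {k : ℕ} (R : ℕ → ℕ → Prop) (I : Inst k) (M : ℕ → ℕ) : Prop :=
  (M 0 = 0 ∧ ¬ ∃ H, I.IsCutting R H) ∨
    (M 0 = 1 ∧ ∃ H, I.IsCutting R H ∧ ∀ (i : Fin I.edges.length) (j : Fin k),
      (s((I.edges.get i).1, (I.edges.get i).2) ∈ (H j).edgeSet → M (1 + k * i + j) = 1) ∧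
      (s((I.edges.get i).1, (I.edges.get i).2) ∉ (H j).edgeSet → M (1 + k * i + j) = 0))

/-- The program `p` solves the tree cutting problem with `k` parts (for the size
relation `R`) on every instance in at most `C * n ^ (2 * k + 1)` steps, with words of
`C * ℓ` bits, where `ℓ` is the number of binary digits of `n` plus the sum of the sizes. -/
def Solves (k : ℕ) (R : ℕ → ℕ → Prop) (p : Prog) (C : ℕ) : Prop :=
  ∀ I : Inst k, ∃ (T : ℕ) (σ : State),
    Exec (C * Nat.size (I.n + ∑ j, I.size j)) p (State.init I.encode) T σ ∧
      T ≤ C * I.n ^ (2 * k + 1) ∧ I.IsAnswer R σ.mem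

end TreeCutting

namespace TreeCutting

/-! Number the vertices so that the root has position 1 and every parent stands before its children.
A connected subgraph that contains the root has a vertex set closed under taking parents, and its
edges correspond to its non-root vertices through `v ↦ s(p v, v)` (`IsParent.edgeSet_subgraph`). A
cutting is therefore a choice of a `k`-bit mask for each vertex, saying which parts contain it: the
root has the full mask, every other mask is nonzero (the edges are covered) and contained in the
mask of the parent (the parts are connected). The size of part `j` is the number of non-root
vertices with bit `j`.

All sizes are at most `n - 1`, so a vector of sizes is one number below `n ^ k`, written in base
`n`, and the code of a family is the sum of the codes of its masks. No control of carries is needed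
on the way: the final counts are smaller than `n`, so equality of the final code with the target
forces equality digit by digit (`Numbering.ncard_part`). A subtree that is not everything can be
enlarged by one vertex (`IsParent.exists_isClosed_ncard`), so the bounded problem is the exact one
with sizes `min t_j (n - 1)`; the exact problem has no solution if some `t_j ≥ n`.

A state of a vertex consists of its mask and the code of what hangs below it, which gives `2 ^ k * n
^ k` states. The vertices `n, n - 1, …, 2` are attached to their parents one after the other. One
attachment tries every state of the child for every state of the parent, in `O(n ^ (2 * k))` steps,
and there are `n - 1` attachments. `Labels.feasible_root` shows that a family of subtrees survives
this recurrence, and `Traced.step` recovers a family by running it backwards through the stored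
stages.

The machine part is a verified compiler: `Runs` is a Hoare triple with a time bound, and an
expression of size `m` over values at most `B` has value at most `B ^ m`, so words that hold `B ^
40` suffice for a polynomial `B`. For `k = 0` only linear time is allowed, and a direct program is
used. -/

/-! ### A small imperative language on top of the word RAM -/

/-- A store: natural number variables and arrays of natural numbers. Array `0` stands for the
first cells of the memory of the machine. -/
structure Store where
  var : ℕ → ℕ
  arr : ℕ → ℕ → ℕ

/-- Assignment to a variable. -/
def Store.set (s : Store) (x v : ℕ) : Store :=
  { var := fun y => if y = x then v else s.var y, arr := s.arr }

/-- Assignment to an array entry. -/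
def Store.put (s : Store) (a i v : ℕ) : Store :=
  { var := s.var, arr := fun b j => if b = a ∧ j = i then v else s.arr b j }

@[simp] theorem Store.set_var (s : Store) (x v y : ℕ) :
    (s.set x v).var y = if y = x then v else s.var y := rfl

@[simp] theorem Store.set_arr (s : Store) (x v : ℕ) : (s.set x v).arr = s.arr := rfl

@[simp] theorem Store.put_var (s : Store) (a i v : ℕ) : (s.put a i v).var = s.var := rfl

@[simp] theorem Store.put_arr (s : Store) (a i v b j : ℕ) :
    (s.put a i v).arr b j = if b = a ∧ j = i then v else s.arr b j := rfl

/-- All values in the store are at most `B`. -/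
def Store.Bounded (B : ℕ) (s : Store) : Prop :=
  (∀ x, s.var x ≤ B) ∧ ∀ a i, s.arr a i ≤ B

theorem Store.Bounded.set {B : ℕ} {s : Store} (h : s.Bounded B) (x : ℕ) {v : ℕ} (hv : v ≤ B) :
    (s.set x v).Bounded B := by
  refine ⟨fun y => ?_, h.2⟩
  rw [Store.set_var]
  split_ifs
  exacts [hv, h.1 y]

theorem Store.Bounded.put {B : ℕ} {s : Store} (h : s.Bounded B) (a i : ℕ) {v : ℕ} (hv : v ≤ B) :
    (s.put a i v).Bounded B := by
  refine ⟨h.1, fun b j => ?_⟩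
  rw [Store.put_arr]
  split_ifs
  exacts [hv, h.2 b j]

/-- Arithmetic expressions. -/
inductive Expr where
  | lit (c : ℕ)
  | var (x : ℕ)
  | bin (o : Op) (e f : Expr)
  | rd (a : ℕ) (e : Expr)

instance : Add Expr := ⟨Expr.bin .add⟩
instance : Sub Expr := ⟨Expr.bin .sub⟩
instance : Mul Expr := ⟨Expr.bin .mul⟩
instance : Div Expr := ⟨Expr.bin .div⟩

/-- The value of an expression. -/
def Expr.eval (s : Store) : Expr → ℕ
  | lit c => c
  | var x => s.var x
  | bin o e f => o.eval (e.eval s) (f.eval s)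
  | rd a e => s.arr a (e.eval s)

/-- The size of an expression. -/
def Expr.size : Expr → ℕ
  | lit _ => 1
  | var _ => 1
  | bin _ e f => e.size + f.size
  | rd _ e => e.size + 3

/-- The constants of the expression are at most `B`, and its array accesses are legal. -/
def Expr.Safe (B D : ℕ) (s : Store) : Expr → Prop
  | lit c => c ≤ B
  | var _ => True
  | bin _ e f => e.Safe B D s ∧ f.Safe B D s
  | rd a e => e.Safe B D s ∧ a < 8 ∧ (a = 0 → e.eval s < D)

section simps

variable (s : Store) (B D : ℕ) (e f : Expr)

@[simp] theorem Expr.eval_lit (c : ℕ) : (Expr.lit c).eval s = c := rfl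
@[simp] theorem Expr.eval_var (x : ℕ) : (Expr.var x).eval s = s.var x := rfl
@[simp] theorem Expr.eval_rd (a : ℕ) : (Expr.rd a e).eval s = s.arr a (e.eval s) := rfl
@[simp] theorem Expr.eval_add : (e + f).eval s = e.eval s + f.eval s := rfl
@[simp] theorem Expr.eval_sub : (e - f).eval s = e.eval s - f.eval s := rfl
@[simp] theorem Expr.eval_mul : (e * f).eval s = e.eval s * f.eval s := rfl
@[simp] theorem Expr.eval_div : (e / f).eval s = e.eval s / f.eval s := rfl
@[simp] theorem Expr.size_lit (c : ℕ) : (Expr.lit c).size = 1 := rfl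
@[simp] theorem Expr.size_var (x : ℕ) : (Expr.var x).size = 1 := rfl
@[simp] theorem Expr.size_rd (a : ℕ) : (Expr.rd a e).size = e.size + 3 := rfl
@[simp] theorem Expr.size_add : (e + f).size = e.size + f.size := rfl
@[simp] theorem Expr.size_sub : (e - f).size = e.size + f.size := rfl
@[simp] theorem Expr.size_mul : (e * f).size = e.size + f.size := rfl
@[simp] theorem Expr.size_div : (e / f).size = e.size + f.size := rfl
@[simp] theorem Expr.safe_lit (c : ℕ) : (Expr.lit c).Safe B D s ↔ c ≤ B := Iff.rfl
@[simp] theorem Expr.safe_var (x : ℕ) : (Expr.var x).Safe B D s := trivial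
@[simp] theorem Expr.safe_rd (a : ℕ) : (Expr.rd a e).Safe B D s ↔
    e.Safe B D s ∧ a < 8 ∧ (a = 0 → e.eval s < D) := Iff.rfl
@[simp] theorem Expr.safe_add : (e + f).Safe B D s ↔ e.Safe B D s ∧ f.Safe B D s := Iff.rfl
@[simp] theorem Expr.safe_sub : (e - f).Safe B D s ↔ e.Safe B D s ∧ f.Safe B D s := Iff.rfl
@[simp] theorem Expr.safe_mul : (e * f).Safe B D s ↔ e.Safe B D s ∧ f.Safe B D s := Iff.rfl
@[simp] theorem Expr.safe_div : (e / f).Safe B D s ↔ e.Safe B D s ∧ f.Safe B D s := Iff.rfl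

end simps

theorem Expr.size_pos (e : Expr) : 1 ≤ e.size := by
  induction e <;> simp only [Expr.size] <;> omega

/-! ### Memory layout and compilation of expressions -/

/-- The layout of the memory and the bounds on the numbers: words of `w` bits, `D` cells of raw
memory, and values that are at most `B`. -/
structure Layout where
  w : ℕ
  D : ℕ
  B : ℕ
  hD : D ≤ B
  hB : 8 ≤ B
  hw : B ^ 40 < 2 ^ w

/-- The machine state `σ` represents the store `s`. Register `0` holds `D`, the register
`2 * x + 2` holds variable `x`, and the registers `2 * d + 1` are used for intermediate results. -/
structure Rep (D : ℕ) (s : Store) (σ : State) : Prop where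
  base : σ.reg 0 = D
  var : ∀ x, σ.reg (2 * x + 2) = s.var x
  raw : ∀ i < D, σ.mem i = s.arr 0 i
  arr : ∀ a i, 1 ≤ a → a < 8 → σ.mem (D + 8 * i + a) = s.arr a i

/-- Code that replaces the index in the register `2 * d + 1` by its address in array `a`. -/
def addrCode : ℕ → ℕ → Prog
  | 0, _ => .skip
  | a + 1, d => .seq (.const (2 * (d + 1) + 1) 8)
      (.seq (.op .mul (2 * d + 1) (2 * d + 1) (2 * (d + 1) + 1))
      (.seq (.const (2 * (d + 1) + 1) (a + 1))
      (.seq (.op .add (2 * d + 1) (2 * d + 1) (2 * (d + 1) + 1))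
      (.op .add (2 * d + 1) 0 (2 * d + 1)))))

/-- Code for the evaluation of an expression; the result is in the register `2 * d + 1`. -/
def Expr.compile : Expr → ℕ → Prog
  | lit c, d => .const (2 * d + 1) c
  | var x, d => .seq (.const (2 * d + 1) 0) (.op .add (2 * d + 1) (2 * d + 1) (2 * x + 2))
  | bin o e f, d => .seq (e.compile d)
      (.seq (f.compile (d + 1)) (.op o (2 * d + 1) (2 * d + 1) (2 * (d + 1) + 1)))
  | rd a e, d => .seq (e.compile d) (.seq (addrCode a d) (.load (2 * d + 1) (2 * d + 1)))

/-- The address of an array entry. -/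
def addr (D a i : ℕ) : ℕ := if a = 0 then i else D + 8 * i + a

theorem Rep.mem_addr {D : ℕ} {s : Store} {σ : State} (h : Rep D s σ) {a i : ℕ} (ha : a < 8)
    (hi : a = 0 → i < D) : σ.mem (addr D a i) = s.arr a i := by
  unfold addr
  split_ifs with h0
  · subst h0; exact h.raw i (hi rfl)
  · exact h.arr a i (by omega) ha

/-- Array `0` occupies the cells below `D`. The other seven arrays are interleaved above `D`, where
the offset modulo 8 names the array. -/
theorem addr_inj {D a i b j : ℕ} (ha : a < 8) (hi : a = 0 → i < D) (hb : b < 8)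
    (hj : b = 0 → j < D) : addr D a i = addr D b j ↔ a = b ∧ i = j := by
  unfold addr
  split_ifs <;> omega

/-- Both powers are at least 2, and for such numbers the sum is at most the product. Thus
multiplication is the worst of the four operations, and exponents simply add. -/
theorem add_le_pow_add {B a b x y : ℕ} (hB : 2 ≤ B) (ha : 1 ≤ a) (hb : 1 ≤ b)
    (hx : x ≤ B ^ a) (hy : y ≤ B ^ b) : x + y ≤ B ^ (a + b) := by
  have h1 : 2 ≤ B ^ a := hB.trans (Nat.le_self_pow (by omega) B)
  have h2 : 2 ≤ B ^ b := hB.trans (Nat.le_self_pow (by omega) B)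
  rw [pow_add]
  nlinarith

theorem Op.eval_le {B a b x y : ℕ} (o : Op) (hB : 2 ≤ B) (ha : 1 ≤ a) (hb : 1 ≤ b)
    (hx : x ≤ B ^ a) (hy : y ≤ B ^ b) : o.eval x y ≤ B ^ (a + b) := by
  have h := add_le_pow_add hB ha hb hx hy
  cases o
  · exact h
  · exact (Nat.sub_le _ _).trans ((Nat.le_add_right _ _).trans h)
  · rw [pow_add]; exact Nat.mul_le_mul hx hy
  · exact (Nat.div_le_self _ _).trans ((Nat.le_add_right _ _).trans h)

/-- The size serves as an exponent: operations add exponents by `Op.eval_le`, while a value read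
from the store is at most `B` whatever its index is. -/
theorem Expr.eval_le {B D : ℕ} {s : Store} (hB : 2 ≤ B) (hs : s.Bounded B) (e : Expr)
    (he : e.Safe B D s) : e.eval s ≤ B ^ e.size := by
  induction e with
  | lit c => simpa [Expr.size] using he
  | var x => simpa [Expr.size] using hs.1 x
  | bin o e f ihe ihf => exact o.eval_le hB e.size_pos f.size_pos (ihe he.1) (ihf he.2)
  | rd a e _ =>
    refine (hs.2 a _).trans (Nat.le_self_pow ?_ B)
    simp [Expr.size]

/-- The states `σ` and `σ'` differ at most in the registers `2 * d' + 1` with `d ≤ d'`. -/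
def SameBelow (d : ℕ) (σ σ' : State) : Prop :=
  σ'.mem = σ.mem ∧ ∀ r, (∀ d', d ≤ d' → r ≠ 2 * d' + 1) → σ'.reg r = σ.reg r

theorem SameBelow.rep {D d : ℕ} {s : Store} {σ σ' : State} (h : SameBelow d σ σ')
    (hr : Rep D s σ) : Rep D s σ' where
  base := by rw [h.2 0 (by omega), hr.base]
  var x := by rw [h.2 _ (by omega), hr.var]
  raw i hi := by rw [h.1, hr.raw i hi]
  arr a i h1 h8 := by rw [h.1, hr.arr a i h1 h8]

theorem SameBelow.trans {d d' : ℕ} {σ σ' σ'' : State} (h : SameBelow d σ σ')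
    (h' : SameBelow d' σ' σ'') (hd : d ≤ d') : SameBelow d σ σ'' :=
  ⟨h'.1.trans h.1, fun r hr => (h'.2 r fun e he => hr e (hd.trans he)).trans (h.2 r hr)⟩

theorem SameBelow.setReg {d e : ℕ} {σ σ' : State} (h : SameBelow d σ σ') (hde : d ≤ e) (v : ℕ) :
    SameBelow d σ (σ'.setReg (2 * e + 1) v) :=
  ⟨h.1, fun r hr => by
    rw [← h.2 r hr]
    exact Function.update_of_ne (hr e hde) _ _⟩

theorem SameBelow.refl (d : ℕ) (σ : State) : SameBelow d σ σ := ⟨rfl, fun _ _ => rfl⟩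

@[simp] theorem State.setReg_reg_self (σ : State) (d v : ℕ) : (σ.setReg d v).reg d = v :=
  Function.update_self _ _ _

theorem State.setReg_reg_ne (σ : State) {d r : ℕ} (v : ℕ) (h : r ≠ d) :
    (σ.setReg d v).reg r = σ.reg r :=
  Function.update_of_ne h _ _

@[simp] theorem State.setReg_mem (σ : State) (d v : ℕ) : (σ.setReg d v).mem = σ.mem := rfl

theorem Layout.lt_word (Γ : Layout) {x a : ℕ} (hx : x ≤ Γ.B ^ a) (ha : a ≤ 40) : x < 2 ^ Γ.w :=
  (hx.trans (Nat.pow_le_pow_right (by have := Γ.hB; omega) ha)).trans_lt Γ.hw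

/-- Multiplying by 8, adding the number of the array and adding `D` each raise the exponent of the
bound by one. This is the 3 in the size of a read. -/
theorem exec_addrCode (Γ : Layout) {s : Store} {a i m d : ℕ} (hm : 1 ≤ m) (hi : i ≤ Γ.B ^ m)
    (hm' : m + 3 ≤ 40) (ha : a < 8) (σ : State) (hσ : Rep Γ.D s σ) (hreg : σ.reg (2 * d + 1) = i) :
    ∃ t σ', t ≤ 5 ∧ Exec Γ.w (addrCode a d) σ t σ' ∧ SameBelow d σ σ' ∧
      σ'.reg (2 * d + 1) = addr Γ.D a i := by
  cases a with
  | zero =>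
    exact ⟨1, σ, by norm_num, .skip σ, SameBelow.refl d σ, by simp [addr, hreg]⟩
  | succ a =>
    have hB := Γ.hB
    have b1 : i * 8 ≤ Γ.B ^ (m + 1) := by
      rw [pow_succ]
      exact Nat.mul_le_mul hi hB
    have b2 : i * 8 + (a + 1) ≤ Γ.B ^ (m + 1 + 1) :=
      add_le_pow_add (by omega) (by omega) le_rfl b1 (by rw [pow_one]; omega)
    have b3 : Γ.D + (i * 8 + (a + 1)) ≤ Γ.B ^ (1 + (m + 1 + 1)) :=
      add_le_pow_add (by omega) le_rfl (by omega) (by rw [pow_one]; exact Γ.hD) b2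
    have hlit : ∀ c ≤ 8, c < 2 ^ Γ.w := fun c hc =>
      Γ.lt_word (a := 1) (by rw [pow_one]; omega) (by norm_num)
    have hne : 2 * d + 1 ≠ 2 * (d + 1) + 1 := by omega
    have h0 : (0 : ℕ) ≠ 2 * d + 1 := by omega
    have h0' : (0 : ℕ) ≠ 2 * (d + 1) + 1 := by omega
    refine ⟨1 + (1 + (1 + (1 + 1))), _, le_rfl,
      .seq _ _ _ _ _ _ _ (.const _ _ _ (hlit 8 le_rfl)) (.seq _ _ _ _ _ _ _ (.op _ _ _ _ _ ?_)
      (.seq _ _ _ _ _ _ _ (.const _ _ _ (hlit (a + 1) (by omega)))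
      (.seq _ _ _ _ _ _ _ (.op _ _ _ _ _ ?_) (.op _ _ _ _ _ ?_)))),
      (((((SameBelow.refl d σ).setReg (e := d + 1) (by omega) _).setReg (e := d) le_rfl
        _).setReg (e := d + 1) (by omega) _).setReg (e := d) le_rfl
        _).setReg (e := d) le_rfl _, ?_⟩
    all_goals simp only [Op.eval, State.setReg_reg_self, State.setReg_reg_ne _ _ hne,
      State.setReg_reg_ne _ _ h0, State.setReg_reg_ne _ _ h0', hσ.base, hreg]
    · exact Γ.lt_word b1 (by omega)
    · exact Γ.lt_word b2 (by omega)
    · exact Γ.lt_word b3 (by omega)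
    · simp only [addr, Nat.succ_ne_zero, if_false]
      ring

/-- The odd registers form a stack. The second operand is computed from level `d + 1` upwards, so
the value of the first operand in register `2 * d + 1` survives. -/
theorem Expr.exec_compile (Γ : Layout) {s : Store} (hs : s.Bounded Γ.B) (e : Expr)
    (he : e.Safe Γ.B Γ.D s) (hsize : e.size ≤ 40) (d : ℕ) (σ : State) (hσ : Rep Γ.D s σ) :
    ∃ t σ', t + 1 ≤ 4 * e.size ∧ Exec Γ.w (e.compile d) σ t σ' ∧ SameBelow d σ σ' ∧
      σ'.reg (2 * d + 1) = e.eval s := by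
  have hB := Γ.hB
  induction e generalizing d σ with
  | lit c =>
    refine ⟨1, _, by simp [Expr.size], Exec.const σ _ c ?_,
      (SameBelow.refl d σ).setReg le_rfl _, by simp⟩
    exact Γ.lt_word (a := 1) (by simpa using he) (by norm_num)
  | var x =>
    refine ⟨1 + 1, _, by simp [Expr.size], Exec.seq _ _ _ _ _ _ _ (Exec.const σ _ 0 (by positivity))
      (Exec.op _ _ _ _ _ ?_), ((SameBelow.refl d σ).setReg le_rfl _).setReg le_rfl _, ?_⟩
    · simp only [Op.eval, State.setReg_reg_self, zero_add]
      rw [State.setReg_reg_ne _ _ (by omega), hσ.var]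
      exact Γ.lt_word (a := 1) (by simpa using hs.1 x) (by norm_num)
    · simp only [Op.eval, State.setReg_reg_self, zero_add]
      rw [State.setReg_reg_ne _ _ (by omega), hσ.var]
      rfl
  | bin o e f ihe ihf =>
    have hle := Expr.eval_le (by omega) hs (.bin o e f) he
    simp only [Expr.size] at hsize hle ⊢
    obtain ⟨t₁, σ₁, ht₁, hx₁, hs₁, hv₁⟩ := ihe he.1 (by omega) d σ hσ
    obtain ⟨t₂, σ₂, ht₂, hx₂, hs₂, hv₂⟩ := ihf he.2 (by omega) (d + 1) σ₁ (hs₁.rep hσ)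
    have hv₁' : σ₂.reg (2 * d + 1) = e.eval s := by rw [hs₂.2 _ (by omega), hv₁]
    have h3 := e.size_pos
    have h4 := f.size_pos
    refine ⟨t₁ + (t₂ + 1), _, ?_, Exec.seq _ _ _ _ _ _ _ hx₁ (Exec.seq _ _ _ _ _ _ _ hx₂
      (Exec.op _ _ _ _ _ ?_)), (hs₁.trans hs₂ (by omega)).setReg le_rfl _, ?_⟩
    · omega
    · rw [hv₁', hv₂]
      exact Γ.lt_word hle hsize
    · rw [State.setReg_reg_self, hv₁', hv₂]
      rfl
  | rd a e ihe =>
    obtain ⟨h1, h2, h3⟩ := he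
    have hle := e.eval_le (by omega) hs h1
    simp only [Expr.size] at hsize ⊢
    obtain ⟨t₁, σ₁, ht₁, hx₁, hs₁, hv₁⟩ := ihe h1 (by omega) d σ hσ
    have hr₁ := hs₁.rep hσ
    obtain ⟨t₂, σ₂, ht₂, hx₂, hs₂, hv₂⟩ := exec_addrCode Γ e.size_pos hle hsize h2 σ₁ hr₁ hv₁
    refine ⟨t₁ + (t₂ + 1), _, by omega, .seq _ _ _ _ _ _ _ hx₁ (.seq _ _ _ _ _ _ _ hx₂
      (.load _ _ _)), (hs₁.trans hs₂ le_rfl).setReg le_rfl _, ?_⟩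
    rw [State.setReg_reg_self, hv₂, (hs₂.rep hr₁).mem_addr h2 h3]
    rfl

/-! ### Statements and their time bounds -/

/-- Started in a state that represents `s`, the program `p` halts after at most `T`
steps in a state that represents some store with property `Q`. -/
def Runs (Γ : Layout) (p : Prog) (s : Store) (T : ℕ) (Q : Store → Prop) : Prop :=
  s.Bounded Γ.B → ∀ σ, Rep Γ.D s σ → ∃ t σ' s', t ≤ T ∧ Exec Γ.w p σ t σ' ∧ Rep Γ.D s' σ' ∧
    s'.Bounded Γ.B ∧ Q s'

/-- Assignment to a variable. -/
def assign (x : ℕ) (e : Expr) : Prog :=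
  .seq (e.compile 0) (.seq (.const 3 0) (.op .add (2 * x + 2) 1 3))

/-- Assignment to an array entry. -/
def write (a : ℕ) (i e : Expr) : Prog :=
  .seq (i.compile 0) (.seq (addrCode a 0) (.seq (e.compile 1) (.store 1 3)))

/-- Branching. -/
def cond (e : Expr) (p q : Prog) : Prog := .seq (e.compile 0) (.ite 1 p q)

/-- The loop `for x < b do p`. -/
def forTo (x : ℕ) (b : Expr) (p : Prog) : Prog :=
  .seq (assign x (.lit 0)) (.seq ((b - .var x).compile 0)
    (.loop 1 (.seq p (.seq (assign x (.var x + .lit 1)) ((b - .var x).compile 0)))))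

/-- First `p`, then `q`. -/
infixr:60 ";;" => Prog.seq

/-- A bound for the time of a simple statement. -/
def tick : ℕ := 200

/-! ### Rules for programs with time bounds -/

theorem Runs.mono {Γ : Layout} {p : Prog} {s : Store} {T T' : ℕ} {Q Q' : Store → Prop}
    (h : Runs Γ p s T Q) (hT : T ≤ T') (hQ : ∀ s', Q s' → Q' s') : Runs Γ p s T' Q' := by
  intro hs σ hσ
  obtain ⟨t, σ', s', h1, h2, h3, h4, h5⟩ := h hs σ hσ
  exact ⟨t, σ', s', h1.trans hT, h2, h3, h4, hQ s' h5⟩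

theorem Runs.seq {Γ : Layout} {p q : Prog} {s : Store} {T T' : ℕ} {Q : Store → Prop}
    (h : Runs Γ p s T fun s' => Runs Γ q s' T' Q) : Runs Γ (p ;; q) s (T + T') Q := by
  intro hs σ hσ
  obtain ⟨t, σ', s', h1, h2, h3, h4, h5⟩ := h hs σ hσ
  obtain ⟨t', σ'', s'', g1, g2, g3, g4, g5⟩ := h5 h4 σ' h3
  exact ⟨t + t', σ'', s'', by omega, .seq _ _ _ _ _ _ _ h2 g2, g3, g4, g5⟩

theorem Runs.then {Γ : Layout} {p q : Prog} {s : Store} {T T' : ℕ} {P Q : Store → Prop}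
    (h : Runs Γ p s T P) (h' : ∀ s', P s' → Runs Γ q s' T' Q) : Runs Γ (p ;; q) s (T + T') Q :=
  Runs.seq (h.mono (Nat.le_refl T) h')

theorem Runs.skip {Γ : Layout} {s : Store} {Q : Store → Prop} (h : Q s) :
    Runs Γ .skip s tick Q :=
  fun hs σ hσ => ⟨1, σ, s, by norm_num [tick], .skip σ, hσ, hs, h⟩

theorem Rep.set {D : ℕ} {s : Store} {σ : State} (h : Rep D s σ) (x v : ℕ) :
    Rep D (s.set x v) (σ.setReg (2 * x + 2) v) where
  base := by rw [State.setReg_reg_ne _ _ (by omega), h.base]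
  var y := by
    rw [Store.set_var]
    split_ifs with hy
    · rw [hy, State.setReg_reg_self]
    · rw [State.setReg_reg_ne _ _ (by omega), h.var]
  raw := h.raw
  arr := h.arr

theorem Rep.put {D : ℕ} {s : Store} {σ : State} (h : Rep D s σ) {a i : ℕ} (ha : a < 8)
    (hi : a = 0 → i < D) (v : ℕ) : Rep D (s.put a i v) (σ.setMem (addr D a i) v) := by
  have key : ∀ b j, b < 8 → (b = 0 → j < D) →
      (σ.setMem (addr D a i) v).mem (addr D b j) = (s.put a i v).arr b j := by
    intro b j hb hj
    have h1 := addr_inj hb hj ha hi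
    rw [Store.put_arr]
    split_ifs with h2
    · rw [h1.2 h2]
      exact Function.update_self _ _ _
    · rw [← h.mem_addr hb hj]
      exact Function.update_of_ne (fun h3 => h2 (h1.1 h3)) _ _
  refine ⟨h.base, h.var, fun j hj => key 0 j (by norm_num) fun _ => hj, fun b j h1 h8 => ?_⟩
  have hb : addr D b j = D + 8 * j + b := if_neg (by omega)
  have := key b j h8 (by omega)
  rwa [hb] at this

theorem Runs.assign {Γ : Layout} {x : ℕ} {e : Expr} {s : Store} {Q : Store → Prop}
    (hsize : e.size ≤ 40) (he : e.Safe Γ.B Γ.D s) (hB : s.Bounded Γ.B → e.eval s ≤ Γ.B)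
    (hQ : Q (s.set x (e.eval s))) : Runs Γ (assign x e) s tick Q := by
  intro hs σ hσ
  obtain ⟨t, σ', ht, hx, hsame, hv⟩ := e.exec_compile Γ hs he hsize 0 σ hσ
  have hr := hsame.rep hσ
  refine ⟨t + (1 + 1), _, s.set x (e.eval s), by unfold tick; omega, .seq _ _ _ _ _ _ _ hx
    (.seq _ _ _ _ _ _ _ (.const _ _ _ (by positivity)) (.op _ _ _ _ _ ?_)), ?_,
    hs.set x (hB hs), hQ⟩
  · simp only [Op.eval, State.setReg_reg_self, State.setReg_reg_ne _ _ (show 1 ≠ 3 by norm_num)]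
    rw [show σ'.reg 1 = _ from hv, add_zero]
    exact Γ.lt_word (a := 1) (by simpa using hB hs) (by norm_num)
  · simp only [Op.eval, State.setReg_reg_self, State.setReg_reg_ne _ _ (show 1 ≠ 3 by norm_num)]
    rw [show σ'.reg 1 = _ from hv, add_zero]
    exact (((SameBelow.refl 0 σ').setReg (e := 1) (by norm_num) 0).rep hr).set x _

theorem Runs.write {Γ : Layout} {a : ℕ} {i e : Expr} {s : Store} {Q : Store → Prop}
    (hsize : i.size + e.size ≤ 37) (hi : i.Safe Γ.B Γ.D s) (he : e.Safe Γ.B Γ.D s) (ha : a < 8)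
    (hD : a = 0 → i.eval s < Γ.D) (hB : s.Bounded Γ.B → e.eval s ≤ Γ.B)
    (hQ : Q (s.put a (i.eval s) (e.eval s))) : Runs Γ (write a i e) s tick Q := by
  intro hs σ hσ
  have h8 := Γ.hB
  obtain ⟨t, σ₁, ht, hx, hsame, hv⟩ := i.exec_compile Γ hs hi (by omega) 0 σ hσ
  have hr := hsame.rep hσ
  obtain ⟨t₂, σ₂, ht₂, hx₂, hs₂, hv₂⟩ := exec_addrCode Γ i.size_pos
    (i.eval_le (by omega) hs hi) (by have := e.size_pos; omega) ha σ₁ hr hv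
  have hr₂ := hs₂.rep hr
  obtain ⟨t₃, σ₃, ht₃, hx₃, hs₃, hv₃⟩ := e.exec_compile Γ hs he (by omega) 1 σ₂ hr₂
  have hr₃ := hs₃.rep hr₂
  have h1 : σ₃.reg 1 = addr Γ.D a (i.eval s) := by rw [hs₃.2 1 (by omega)]; exact hv₂
  have h3 : σ₃.reg 3 = e.eval s := hv₃
  refine ⟨t + (t₂ + (t₃ + 1)), _, _, by unfold tick; omega, .seq _ _ _ _ _ _ _ hx
    (.seq _ _ _ _ _ _ _ hx₂ (.seq _ _ _ _ _ _ _ hx₃ (.store _ _ _))), ?_,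
    hs.put a (i.eval s) (hB hs), hQ⟩
  rw [h1, h3]
  exact hr₃.put ha hD _

/-- The value of the condition is never stored in a variable, so it only has to fit into a word and
may exceed `Γ.B`. This allows long products as conjunctions. -/
theorem Runs.cond {Γ : Layout} {e : Expr} {p q : Prog} {s : Store} {T T' : ℕ} {Q : Store → Prop}
    (hsize : e.size ≤ 40) (he : e.Safe Γ.B Γ.D s) (hp : e.eval s ≠ 0 → Runs Γ p s T Q)
    (hq : e.eval s = 0 → Runs Γ q s T' Q) : Runs Γ (cond e p q) s (tick + (T + T')) Q := by
  intro hs σ hσ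
  obtain ⟨t, σ₁, ht, hx, hsame, hv⟩ := e.exec_compile Γ hs he hsize 0 σ hσ
  have hr := hsame.rep hσ
  by_cases h : e.eval s = 0
  · obtain ⟨t', σ', s', h1, h2, h3⟩ := hq h hs σ₁ hr
    exact ⟨t + (t' + 1), σ', s', by unfold tick; omega, .seq _ _ _ _ _ _ _ hx
      (.ite_false _ _ _ _ _ _ (hv.trans h) h2), h3⟩
  · obtain ⟨t', σ', s', h1, h2, h3⟩ := hp h hs σ₁ hr
    exact ⟨t + (t' + 1), σ', s', by unfold tick; omega, .seq _ _ _ _ _ _ _ hx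
      (.ite_true _ _ _ _ _ _ (by rw [show σ₁.reg 1 = _ from hv]; exact h) h2), h3⟩

/-- The rule for loops: `I i` is the invariant before round `i`. -/
theorem Runs.forTo {Γ : Layout} {x : ℕ} {b : Expr} {p : Prog} {s : Store} {T : ℕ}
    {Q : Store → Prop} (N : ℕ) (I : ℕ → Store → Prop) (hsize : b.size ≤ 39) (hN : N ≤ Γ.B)
    (h0 : I 0 (s.set x 0))
    (hb : ∀ i s', I i s' → b.Safe Γ.B Γ.D s' ∧ b.eval s' = N)
    (hbody : ∀ i < N, ∀ s', I i s' → s'.var x = i →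
      Runs Γ p s' T fun s'' => s''.var x = i ∧ I (i + 1) (s''.set x (i + 1)))
    (hQ : ∀ s', I N s' → s'.var x = N → Q s') :
    Runs Γ (forTo x b p) s (N * (T + (tick + tick)) + (tick + tick)) Q := by
  have hB := Γ.hB
  -- The bound 159 is `4 * 40 - 1`; the gap up to `tick` pays for testing the loop register.
  have htest : ∀ i s' σ, I i s' → s'.Bounded Γ.B → Rep Γ.D s' σ → s'.var x = i →
      ∃ t σ', t ≤ 159 ∧ Exec Γ.w ((b - .var x).compile 0) σ t σ' ∧ Rep Γ.D s' σ' ∧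
        σ'.reg 1 = N - i := by
    intro i s' σ hI hs hσ hx
    obtain ⟨h1, h2⟩ := hb i s' hI
    obtain ⟨t, σ₁, ht, hx₁, hsame, hv⟩ := (b - .var x).exec_compile Γ hs (by simpa using h1)
      (by simpa using by omega) 0 σ hσ
    simp only [Expr.size_sub, Expr.size_var] at ht
    exact ⟨t, σ₁, by omega, hx₁, hsame.rep hσ, hv.trans (by simp [h2, hx])⟩
  have hloop : ∀ m i s' σ, i + m = N → I i s' → s'.Bounded Γ.B → Rep Γ.D s' σ → s'.var x = i →
      σ.reg 1 = N - i → ∃ t σ' s'', t ≤ m * (T + (tick + tick)) + 1 ∧ Exec Γ.w (.loop 1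
        (.seq p (.seq (TreeCutting.assign x (.var x + .lit 1)) ((b - .var x).compile 0)))) σ t σ' ∧
        Rep Γ.D s'' σ' ∧ s''.Bounded Γ.B ∧ Q s'' := by
    intro m
    induction m with
    | zero =>
      intro i s' σ hm hI hs hσ hx hreg
      obtain rfl : i = N := hm
      exact ⟨1, σ, s', by omega, .loop_done _ _ _ (by omega), hσ, hs, hQ s' hI hx⟩
    | succ m ih =>
      intro i s' σ hm hI hs hσ hx hreg
      obtain ⟨t₁, σ₁, s₁, ht₁, hx₁, hσ₁, hs₁, hi₁, hI₁⟩ := hbody i (by omega) s' hI hx hs σ hσ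
      obtain ⟨t₂, σ₂, s₂, ht₂, hx₂, hσ₂, hs₂, rfl⟩ := Runs.assign (Γ := Γ) (x := x)
        (e := .var x + .lit 1) (s := s₁) (Q := fun s₂ => s₁.set x (i + 1) = s₂) (by simp)
        (by simp; omega) (fun _ => by simp [hi₁]; omega) (by simp [hi₁]) hs₁ σ₁ hσ₁
      obtain ⟨t₃, σ₃, ht₃, hx₃, hσ₃, hv₃⟩ := htest (i + 1) _ σ₂ hI₁ hs₂ hσ₂ (by simp)
      obtain ⟨t₄, σ₄, s₄, ht₄, hx₄, h⟩ := ih (i + 1) _ σ₃ (by omega) hI₁ hs₂ hσ₃ (by simp) hv₃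
      refine ⟨t₁ + (t₂ + t₃) + 1 + t₄, σ₄, s₄, ?_, .loop_step _ _ _ _ _ _ _ (by omega)
        (.seq _ _ _ _ _ _ _ hx₁ (.seq _ _ _ _ _ _ _ hx₂ hx₃)) hx₄, h⟩
      unfold tick at *
      rw [add_mul]
      omega
  intro hs σ hσ
  obtain ⟨t₂, σ₂, s₂, ht₂, hx₂, hσ₂, hs₂, rfl⟩ := Runs.assign (Γ := Γ) (x := x)
    (e := .lit 0) (s := s) (Q := fun s₂ => s.set x 0 = s₂) (by simp)
    (by simp) (fun _ => by simp) (by simp) hs σ hσ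
  obtain ⟨t₃, σ₃, ht₃, hx₃, hσ₃, hv₃⟩ := htest 0 _ σ₂ h0 hs₂ hσ₂ (by simp)
  obtain ⟨t₄, σ₄, s₄, ht₄, hx₄, h⟩ := hloop N 0 _ σ₃ (by omega) h0 hs₂ hσ₃ (by simp) hv₃
  exact ⟨t₂ + (t₃ + t₄), σ₄, s₄, by unfold tick at *; omega,
    .seq _ _ _ _ _ _ _ hx₂ (.seq _ _ _ _ _ _ _ hx₃ hx₄), h⟩

/-! ### Masks -/

/-- The binary digits of a number. -/
def bit (m j : ℕ) : ℕ := m / 2 ^ j % 2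

/-- The machine has no remainder, so a digit is obtained from two divisions and one subtraction. -/
theorem bit_eq_sub (m j : ℕ) : m / 2 ^ j - 2 * (m / (2 ^ j * 2)) = bit m j := by
  rw [← Nat.div_div_eq_div_mul, bit]
  omega

theorem bit_le_one (m j : ℕ) : bit m j ≤ 1 := by
  unfold bit
  omega

/-- The first `k` binary digits of `m`, read in base `n`. -/
def code (n k m : ℕ) : ℕ := ∑ j ∈ Finset.range k, bit m j * n ^ j

theorem code_succ (n k m : ℕ) : code n (k + 1) m = code n k m + bit m k * n ^ k :=
  Finset.sum_range_succ _ _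

theorem code_le {n : ℕ} (hn : 1 ≤ n) {j k : ℕ} (hj : j ≤ k) (m : ℕ) : code n j m ≤ k * n ^ k := by
  calc code n j m ≤ ∑ _i ∈ Finset.range j, n ^ k := by
        refine Finset.sum_le_sum fun i hi => ?_
        have h1 := bit_le_one m i
        have h2 : n ^ i ≤ n ^ k := Nat.pow_le_pow_right hn (by have := Finset.mem_range.1 hi; omega)
        exact (Nat.mul_le_mul h1 h2).trans (by rw [one_mul])
    _ ≤ k * n ^ k := by
        rw [Finset.sum_const, Finset.card_range, smul_eq_mul]
        exact Nat.mul_le_mul_right _ hj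

/-- Membership in mask `m'` implies membership in mask `m`, for the first `k` indices. -/
def Sub (k m' m : ℕ) : Prop := ∀ j < k, bit m' j ≤ bit m j

theorem sub_succ (k m' m : ℕ) : Sub (k + 1) m' m ↔ Sub k m' m ∧ bit m' k ≤ bit m k := by
  unfold Sub
  constructor
  · exact fun h => ⟨fun j hj => h j (by omega), h k (by omega)⟩
  · rintro ⟨h1, h2⟩ j hj
    rcases Nat.lt_succ_iff_lt_or_eq.1 hj with h | rfl
    exacts [h1 j h, h2]

/-- The number of states of a vertex: a state is `m + 2 ^ k * x`, where `m` says which parts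
contain the vertex, and `x` is the code of the sizes of the parts below the vertex. -/
def numStates (n k : ℕ) : ℕ := 2 ^ k * n ^ k

/-- The numbers that occur in the algorithm are bounded by `Γ.B`. -/
structure Fits (Γ : Layout) (n k : ℕ) : Prop where
  n_pos : 1 ≤ n
  states : (n + 1) * numStates n k ≤ Γ.B
  code : k * n ^ k ≤ Γ.B
  k_le : 3 + k ≤ Γ.B
  D : (k + 3) * (n + 1) ≤ Γ.D

theorem Fits.n_le {Γ : Layout} {n k : ℕ} (h : Fits Γ n k) : n + 1 ≤ Γ.B := by
  have h1 := h.D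
  have h2 := Γ.hD
  nlinarith

theorem Fits.two_pow_le {Γ : Layout} {n k : ℕ} (h : Fits Γ n k) : 2 ^ k ≤ Γ.B := by
  have h1 := h.states
  have h2 : 1 ≤ n ^ k := Nat.one_le_pow _ _ h.n_pos
  have h3 : 2 ^ k ≤ numStates n k := Nat.le_mul_of_pos_right _ h2
  nlinarith [h.n_pos]

theorem Fits.pow_le {Γ : Layout} {n k : ℕ} (h : Fits Γ n k) : n ^ k ≤ Γ.B := by
  have h1 := h.states
  have h2 : 1 ≤ 2 ^ k := Nat.one_le_two_pow
  have h3 : n ^ k ≤ numStates n k := Nat.le_mul_of_pos_left _ h2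
  nlinarith [h.n_pos]

theorem Fits.numStates_le {Γ : Layout} {n k : ℕ} (h : Fits Γ n k) : numStates n k ≤ Γ.B := by
  have h1 := h.states
  nlinarith [h.n_pos]

/-! ### The subroutines -/

/-- The expression for the digit of variable `x` at the place whose weight is in variable `d`. -/
def bitExpr (x d : ℕ) : Expr := .var x / .var d - .lit 2 * (.var x / (.var d * .lit 2))

/-- Compare the masks in the variables `30` and `23`, and compute the code of the first one. -/
def maskInfo (k : ℕ) : Prog :=
  assign 31 (.lit 1) ;; assign 32 (.lit 0) ;; assign 34 (.lit 1) ;; assign 35 (.lit 1) ;;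
  forTo 33 (.lit k) (
    assign 31 (.var 31 * (.lit 1 - (bitExpr 30 35 - bitExpr 23 35))) ;;
    assign 32 (.var 32 + bitExpr 30 35 * .var 34) ;;
    assign 34 (.var 34 * .var 0) ;;
    assign 35 (.var 35 * .lit 2))

/-- The time bound for `maskInfo`. -/
def maskTime (k : ℕ) : ℕ := k * 1200 + 1200

open Classical in
theorem runs_maskInfo {Γ : Layout} {n k : ℕ} (hΓ : Fits Γ n k) (s : Store) (hn : s.var 0 = n) :
    Runs Γ (maskInfo k) s (maskTime k) fun s' => (∀ x < 31, s'.var x = s.var x) ∧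
      s'.arr = s.arr ∧ s'.var 31 = (if Sub k (s.var 30) (s.var 23) then 1 else 0) ∧
      s'.var 32 = code n k (s.var 30) := by
  have hB := Γ.hB
  have := hΓ.k_le
  unfold maskInfo
  refine Runs.mono (T := tick + (tick + (tick + (tick +
    (k * ((tick + (tick + (tick + tick))) + (tick + tick)) + (tick + tick)))))) ?_
    (by unfold maskTime tick; omega) fun _ h => h
  refine Runs.seq (Runs.assign (by simp) (by simp; omega) (fun _ => by simp; omega) ?_)
  refine Runs.seq (Runs.assign (by simp) (by simp) (fun _ => by simp) ?_)
  refine Runs.seq (Runs.assign (by simp) (by simp; omega) (fun _ => by simp; omega) ?_)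
  refine Runs.seq (Runs.assign (by simp) (by simp; omega) (fun _ => by simp; omega) ?_)
  refine Runs.forTo k (fun j s' => (∀ x < 31, s'.var x = s.var x) ∧ s'.arr = s.arr ∧
    s'.var 31 = (if Sub j (s.var 30) (s.var 23) then 1 else 0) ∧
    s'.var 32 = code n j (s.var 30) ∧ s'.var 34 = n ^ j ∧ s'.var 35 = 2 ^ j) (by simp) (by omega)
    ?_ ?_ ?_ ?_
  · refine ⟨fun x hx => ?_, rfl, ?_, ?_, ?_, ?_⟩
    · simp; split_ifs <;> omega
    · simp [Sub]
    · simp [code]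
    · simp
    · simp
  · rintro i s' -
    simp; omega
  · rintro j hj s' ⟨h1, h2, h3, h4, h5, h6⟩ hjv
    have h0 := h1 0 (by norm_num)
    have h30 := h1 30 (by norm_num)
    have h23 := h1 23 (by norm_num)
    have hok : s'.var 31 ≤ 1 := by
      rw [h3]
      split_ifs <;> norm_num
    have hb := bit_le_one (s.var 30) j
    have hc := (code_succ n j (s.var 30)).symm.le.trans (code_le hΓ.n_pos hj _) |>.trans hΓ.code
    have hp := (Nat.pow_le_pow_right hΓ.n_pos hj).trans hΓ.pow_le
    have hd := (Nat.pow_le_pow_right (n := 2) (by norm_num) hj).trans hΓ.two_pow_le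
    refine Runs.seq (Runs.assign (by simp [bitExpr]) (by simp [bitExpr]; omega) ?_ ?_)
    · intro _
      simp only [bitExpr, Expr.eval_mul, Expr.eval_sub, Expr.eval_var, Expr.eval_lit]
      exact (Nat.mul_le_mul hok (Nat.sub_le _ _)).trans (by omega)
    refine Runs.seq (Runs.assign (by simp [bitExpr]) (by simp [bitExpr]; omega) ?_ ?_)
    · intro _
      simp [bitExpr, bit_eq_sub, h4, h5, h6, h30]
      exact hc
    refine Runs.seq (Runs.assign (by simp) (by simp) ?_ ?_)
    · intro _
      simpa [h5, h0, hn, pow_succ] using hp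
    refine Runs.assign (by simp) (by simp; omega) ?_ ?_
    · intro _
      simpa [h6, pow_succ] using hd
    refine ⟨by simpa using hjv, fun x hx => ?_, ?_, ?_, ?_, ?_, ?_⟩
    · rw [← h1 x hx]
      simp
      split_ifs <;> omega
    · simpa using h2
    · simp [bitExpr, bit_eq_sub, h3, h6, h30, h23, sub_succ]
      by_cases g : Sub j (s.var 30) (s.var 23) <;> simp [g]
      split_ifs <;> omega
    · simp [bitExpr, bit_eq_sub, h4, h5, h6, h30, code_succ]
    · simp [h5, h0, hn, pow_succ]
    · simp [h6, pow_succ]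
  · rintro s' ⟨h1, h2, h3, h4, h5, h6⟩ -
    exact ⟨h1, h2, h3, h4⟩

/-- The condition that a child with state `t` can be attached to a vertex with state `s`. -/
def Splits (n k s t : ℕ) : Prop :=
  Sub k t s ∧ code n k t + t / 2 ^ k ≤ s / 2 ^ k ∧ t % 2 ^ k ≠ 0

/-- The state that remains if a child with state `t` is detached from a vertex with state `s`. -/
def rest (n k s t : ℕ) : ℕ := s - 2 ^ k * (code n k t + t / 2 ^ k)

/-- The index of an entry of the table. -/
def cell (n S c u s : ℕ) : ℕ := (c * (n + 1) + u) * S + s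

/-- The expression for the index of an entry of the table. -/
def cellExpr (c u s : ℕ) : Expr :=
  (.var c * (.var 0 + .lit 1) + .var u) * .var 1 + .var s

/-- The state `t` is a possible state of the child in row `i` for the vertex in row `p` with
state `s`, according to stage `c` of the table `A`. -/
def Attaches (n k : ℕ) (A : ℕ → ℕ) (c p i s t : ℕ) : Prop :=
  Splits n k s t ∧ A (cell n (numStates n k) c p (rest n k s t)) ≠ 0 ∧
    A (cell n (numStates n k) c i t) ≠ 0

/-- Search a state of the child in row `22` for the vertex in row `21` with the state `23`, in
stage `20` of the table. Variable `24` tells whether there is one; it is then in variable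
`25`, and the rest is in `26`. -/
def search (k : ℕ) : Prog :=
  assign 24 (.lit 0) ;; forTo 30 (.var 1) (
    maskInfo k ;;
    assign 36 (.var 23 - .lit (2 ^ k) * (.var 32 + .var 30 / .lit (2 ^ k))) ;;
    cond (.var 31 * (.lit 1 - (.var 32 + .var 30 / .lit (2 ^ k) - .var 23 / .lit (2 ^ k))) *
        (.var 30 - .lit (2 ^ k) * (.var 30 / .lit (2 ^ k))) *
        .rd 5 (cellExpr 20 21 36) * .rd 5 (cellExpr 20 22 30))
      (assign 24 (.lit 1) ;; assign 25 (.var 30) ;; assign 26 (.var 36)) .skip)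

/-- The time bound for `search`. -/
def searchTime (n k : ℕ) : ℕ := numStates n k * (k * 1200 + 3000) + 600

/-- The loop does not stop at the first success; a later success overwrites an earlier one, and
either serves as a witness. -/
theorem runs_search {Γ : Layout} {n k : ℕ} (hΓ : Fits Γ n k) (s : Store) (hn : s.var 0 = n)
    (hS : s.var 1 = numStates n k) :
    Runs Γ (search k) s (searchTime n k) fun s' => (∀ x < 24, s'.var x = s.var x) ∧
      s'.arr = s.arr ∧
      ((s'.var 24 = 0 ∧ ∀ t < numStates n k,
        ¬ Attaches n k (s.arr 5) (s.var 20) (s.var 21) (s.var 22) (s.var 23) t) ∨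
      (s'.var 24 = 1 ∧
        Attaches n k (s.arr 5) (s.var 20) (s.var 21) (s.var 22) (s.var 23) (s'.var 25) ∧
        s'.var 25 < numStates n k ∧ s'.var 26 = rest n k (s.var 23) (s'.var 25))) := by
  have hB := Γ.hB
  have hq := hΓ.two_pow_le
  unfold search
  refine Runs.mono (T := tick + (numStates n k * ((maskTime k + (tick + (tick +
    (tick + (tick + tick) + tick)))) + (tick + tick)) + (tick + tick))) ?_ ?_
    fun _ h => h
  rotate_left
  · have := Nat.mul_le_mul_left (numStates n k) (show maskTime k + (tick + (tick +
      (tick + (tick + tick) + tick))) + (tick + tick) ≤ k * 1200 + 3000 by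
      unfold maskTime tick; omega)
    unfold searchTime tick at *
    omega
  refine Runs.seq (Runs.assign (by simp) (by simp) (fun _ => by simp) ?_)
  refine Runs.forTo (numStates n k) (fun i s' => (∀ x < 24, s'.var x = s.var x) ∧
      s'.arr = s.arr ∧
      ((s'.var 24 = 0 ∧ ∀ t < i,
        ¬ Attaches n k (s.arr 5) (s.var 20) (s.var 21) (s.var 22) (s.var 23) t) ∨
      (s'.var 24 = 1 ∧
        Attaches n k (s.arr 5) (s.var 20) (s.var 21) (s.var 22) (s.var 23) (s'.var 25) ∧
        s'.var 25 < i ∧ s'.var 26 = rest n k (s.var 23) (s'.var 25)))) (by simp)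
    hΓ.numStates_le ?_ ?_ ?_ ?_
  · refine ⟨fun x hx => ?_, rfl, Or.inl ⟨by simp, by simp⟩⟩
    simp; split_ifs <;> omega
  · rintro i s' ⟨h1, h2, h3⟩
    exact ⟨by simp, by simpa [hS] using h1 1 (by norm_num)⟩
  · rintro t ht s' ⟨h1, h2, h3⟩ hv
    refine Runs.then (runs_maskInfo hΓ s' (by rw [h1 0 (by norm_num), hn])) ?_
    rintro s₁ ⟨g1, g2, g3, g4⟩
    have v0 : s₁.var 0 = n := by rw [g1 0 (by norm_num), h1 0 (by norm_num), hn]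
    have v1 : s₁.var 1 = numStates n k := by rw [g1 1 (by norm_num), h1 1 (by norm_num), hS]
    have v20 : s₁.var 20 = s.var 20 := by rw [g1 20 (by norm_num), h1 20 (by norm_num)]
    have v21 : s₁.var 21 = s.var 21 := by rw [g1 21 (by norm_num), h1 21 (by norm_num)]
    have v22 : s₁.var 22 = s.var 22 := by rw [g1 22 (by norm_num), h1 22 (by norm_num)]
    have v23 : s₁.var 23 = s.var 23 := by rw [g1 23 (by norm_num), h1 23 (by norm_num)]
    have v30 : s₁.var 30 = t := by rw [g1 30 (by norm_num), hv]
    have v24 := g1 24 (by norm_num)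
    have v25 := g1 25 (by norm_num)
    have v26 := g1 26 (by norm_num)
    have ha := g2.trans h2
    rw [hv, h1 23 (by norm_num)] at g3
    rw [hv] at g4
    refine Runs.seq (Runs.assign (by simp) (by simp; omega) (fun hs => ?_) ?_)
    · simp only [Expr.eval_sub, Expr.eval_var]
      exact (Nat.sub_le _ _).trans (hs.1 23)
    -- The product is a conjunction of five tests. With truncated subtraction, `1 - (a - b)` is
    -- nonzero exactly when `a ≤ b`.
    have key : Expr.eval (s₁.set 36 (rest n k (s.var 23) t))
        (.var 31 * (.lit 1 - (.var 32 + .var 30 / .lit (2 ^ k) - .var 23 / .lit (2 ^ k))) *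
        (.var 30 - .lit (2 ^ k) * (.var 30 / .lit (2 ^ k))) *
        .rd 5 (cellExpr 20 21 36) * .rd 5 (cellExpr 20 22 30)) ≠ 0 ↔
        Attaches n k (s.arr 5) (s.var 20) (s.var 21) (s.var 22) (s.var 23) t := by
      simp [cellExpr, v0, v1, v20, v21, v22, v23, v30, g3, g4, Attaches, Splits, ha, cell,
        and_assoc, Nat.mod_eq_sub_mul_div, Nat.sub_eq_zero_iff_le]
    have hrest : Expr.eval s₁ (.var 23 - .lit (2 ^ k) * (.var 32 + .var 30 / .lit (2 ^ k))) =
      rest n k (s.var 23) t := by simp [rest, v23, v30, g4]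
    rw [hrest]
    refine Runs.cond (by simp [cellExpr]) (by simp [cellExpr]; omega) (fun h => ?_) (fun h => ?_)
    · have h := key.1 h
      refine Runs.seq (Runs.assign (by simp) (by simp; omega) (fun _ => by simp; omega) ?_)
      refine Runs.seq (Runs.assign (by simp) (by simp) (fun hs => hs.1 _) ?_)
      refine Runs.assign (by simp) (by simp) (fun hs => hs.1 _) ?_
      refine ⟨by simpa using v30, fun x hx => ?_, by simpa using ha, Or.inr ?_⟩
      · rw [← h1 x hx, ← g1 x (by omega)]
        simp; split_ifs <;> omega
      · simpa [v30] using h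
    · have h : ¬ _ := fun h' => key.2 h' h
      refine Runs.skip ?_
      refine ⟨by simpa using v30, fun x hx => ?_, by simpa using ha, ?_⟩
      · rw [← h1 x hx, ← g1 x (by omega)]
        simp; split_ifs <;> omega
      · rcases h3 with ⟨h3, h4⟩ | ⟨h3, h4, h5, h6⟩
        · refine Or.inl ⟨by simpa [v24] using h3, fun u hu => ?_⟩
          rcases Nat.lt_succ_iff_lt_or_eq.1 hu with hu | rfl
          exacts [h4 u hu, h]
        · refine Or.inr ?_
          simp [v24, v25, v26]
          exact ⟨h3, h4, by omega, h6⟩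
  · rintro s' h -
    exact h

/-! ### The recurrence -/

theorem bit_eq_testBit (m j : ℕ) : bit m j = (m.testBit j).toNat := by
  rw [Nat.testBit_eq_decide_div_mod_eq, bit]
  rcases Nat.mod_two_eq_zero_or_one (m / 2 ^ j) with h | h <;> simp [h]

theorem bit_mod {k j : ℕ} (hj : j < k) (m : ℕ) : bit (m % 2 ^ k) j = bit m j := by
  simp [bit_eq_testBit, Nat.testBit_mod_two_pow, hj]

theorem bit_congr {k j m m' : ℕ} (h : m % 2 ^ k = m' % 2 ^ k) (hj : j < k) :
    bit m j = bit m' j := by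
  rw [← bit_mod hj, h, bit_mod hj]

theorem sub_congr {k a a' b b' : ℕ} (h : a % 2 ^ k = a' % 2 ^ k) (h' : b % 2 ^ k = b' % 2 ^ k) :
    Sub k a b ↔ Sub k a' b' :=
  forall₂_congr fun j hj => by rw [bit_congr h hj, bit_congr h' hj]

theorem code_congr {n k m m' : ℕ} (h : m % 2 ^ k = m' % 2 ^ k) : code n k m = code n k m' :=
  Finset.sum_congr rfl fun j hj => by rw [bit_congr h (Finset.mem_range.1 hj)]

theorem exists_bit {k m : ℕ} : m % 2 ^ k ≠ 0 ↔ ∃ j < k, bit m j = 1 := by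
  constructor
  · intro h
    obtain ⟨j, hj⟩ := Nat.exists_testBit_of_ne_zero h
    rw [Nat.testBit_mod_two_pow] at hj
    simp only [Bool.and_eq_true, decide_eq_true_eq] at hj
    exact ⟨j, hj.1, by simp [bit_eq_testBit, hj.2]⟩
  · rintro ⟨j, hj, h⟩ h0
    rw [← bit_mod hj, h0] at h
    simp [bit] at h

theorem mod_eq_of_full {k m : ℕ} (h : ∀ j < k, bit m j = 1) : m % 2 ^ k = 2 ^ k - 1 := by
  refine Nat.eq_of_testBit_eq fun j => ?_
  rw [Nat.testBit_mod_two_pow, Nat.testBit_two_pow_sub_one]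
  by_cases hj : j < k
  · have := h j hj
    rw [bit_eq_testBit] at this
    simpa [hj] using this
  · simp [hj]

theorem bit_full {k j : ℕ} (hj : j < k) : bit (2 ^ k - 1) j = 1 := by
  rw [bit_eq_testBit, Nat.testBit_two_pow_sub_one]
  simp [hj]

section rest

variable {n k s t : ℕ}

/-- The detached amount fits into the size part of `s`, so the truncated subtraction is a true one
and the mask in the lowest `k` bits is untouched. -/
theorem rest_eq (h : Splits n k s t) :
    rest n k s t = 2 ^ k * (s / 2 ^ k - (code n k t + t / 2 ^ k)) + s % 2 ^ k := by
  have h1 := Nat.div_add_mod s (2 ^ k)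
  have h2 := Nat.mul_le_mul_left (2 ^ k) h.2.1
  rw [rest, Nat.mul_sub]
  omega

theorem rest_mod (h : Splits n k s t) : rest n k s t % 2 ^ k = s % 2 ^ k := by
  rw [rest_eq h, Nat.mul_add_mod, Nat.mod_mod]

theorem rest_div (h : Splits n k s t) :
    rest n k s t / 2 ^ k = s / 2 ^ k - (code n k t + t / 2 ^ k) := by
  rw [rest_eq h, Nat.mul_add_div (by positivity), Nat.div_eq_of_lt (a := s % 2 ^ k)
    (Nat.mod_lt _ (by positivity)), add_zero]

theorem rest_le : rest n k s t ≤ s := Nat.sub_le _ _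

end rest

/-! ### Feasible states: soundness and completeness of the recurrence -/

/-- The state `s` is possible for the vertex `u`, where the last `c` vertices of
the tree are already attached to their parents. -/
def Feasible (n k : ℕ) (par : ℕ → ℕ) : ℕ → ℕ → ℕ → Prop
  | 0, _, s => s / 2 ^ k = 0
  | c + 1, u, s => if u = par (n - c) then ∃ t < numStates n k, Splits n k s t ∧
      Feasible n k par c u (rest n k s t) ∧ Feasible n k par c (n - c) t
    else Feasible n k par c u s

/-- The masks `m 1, …, m n` describe a family of subtrees with the code `x`. -/
structure Labels (n k : ℕ) (par : ℕ → ℕ) (x : ℕ) (m : ℕ → ℕ) : Prop where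
  root : ∀ j < k, bit (m 1) j = 1
  ne : ∀ u ∈ Finset.Icc 2 n, m u % 2 ^ k ≠ 0
  sub : ∀ u ∈ Finset.Icc 2 n, Sub k (m u) (m (par u))
  sum : ∑ u ∈ Finset.Icc 2 n, code n k (m u) = x

/-- The states `g u` of the vertices `u ≤ n - c` are the result of a backward run of the
recurrence. -/
structure Traced (n k : ℕ) (par : ℕ → ℕ) (x c : ℕ) (g : ℕ → ℕ) : Prop where
  feasible : ∀ u ∈ Finset.Icc 1 (n - c), Feasible n k par c u (g u)
  lt : ∀ u ∈ Finset.Icc 1 (n - c), g u < numStates n k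
  root : ∀ j < k, bit (g 1) j = 1
  ne : ∀ u ∈ Finset.Icc 2 (n - c), g u % 2 ^ k ≠ 0
  sub : ∀ u ∈ Finset.Icc 2 (n - c), Sub k (g u) (g (par u))
  sum : ∑ u ∈ Finset.Icc 1 (n - c), g u / 2 ^ k + ∑ u ∈ Finset.Icc 2 (n - c), code n k (g u) = x

/-- At stage 0 feasibility says that all size parts vanish, so only the codes of the masks remain in
the sum. A state may serve as its own mask, because only the lowest `k` bits of a mask are ever
inspected. -/
theorem Traced.labels {n k x : ℕ} {par g : ℕ → ℕ} (h : Traced n k par x 0 g) :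
    Labels n k par x g where
  root := h.root
  ne := h.ne
  sub := h.sub
  sum := by
    have h0 : ∑ u ∈ Finset.Icc 1 (n - 0), g u / 2 ^ k = 0 :=
      Finset.sum_eq_zero fun u hu => h.feasible u hu
    rw [← h.sum, h0, zero_add]
    rfl

theorem Traced.init {n k x : ℕ} {par g : ℕ → ℕ} (hn : 1 ≤ n) (hx : x < n ^ k)
    (hg : g 1 = 2 ^ k * x + (2 ^ k - 1)) (h : Feasible n k par (n - 1) 1 (g 1)) :
    Traced n k par x (n - 1) g := by
  have e : n - (n - 1) = 1 := by omega
  have hq : 0 < 2 ^ k := by positivity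
  have hmod : g 1 % 2 ^ k = (2 ^ k - 1) % 2 ^ k := by rw [hg, Nat.mul_add_mod]
  have hone : ∀ u ∈ Finset.Icc 1 (n - (n - 1)), u = 1 := fun u hu => by
    rw [e, Finset.mem_Icc] at hu; omega
  have hempty : Finset.Icc 2 (n - (n - 1)) = ∅ := by rw [e]; rfl
  refine ⟨fun u hu => hone u hu ▸ h, fun u hu => ?_, fun j hj => ?_, ?_, ?_, ?_⟩
  · rw [hone u hu, hg, numStates]
    have := Nat.mul_le_mul_left (2 ^ k) (Nat.succ_le_of_lt hx)
    rw [Nat.mul_succ] at this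
    omega
  · rw [bit_congr hmod hj, bit_full hj]
  · simp [hempty]
  · simp [hempty]
  · rw [hempty, e, Finset.Icc_self, Finset.sum_singleton, Finset.sum_empty, hg,
      Nat.mul_add_div hq, Nat.div_eq_of_lt (a := 2 ^ k - 1) (by omega)]
    omega

/-- One step of the backward run: vertex `n - c` is detached from its parent. -/
theorem Traced.step {n k x c t : ℕ} {par g g' : ℕ → ℕ} (hc : c + 2 ≤ n)
    (hpar : ∀ i ∈ Finset.Icc 2 n, par i ∈ Finset.Icc 1 (i - 1))
    (h : Traced n k par x (c + 1) g) (ht : t < numStates n k)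
    (hs : Splits n k (g (par (n - c))) t)
    (hp : Feasible n k par c (par (n - c)) (rest n k (g (par (n - c))) t))
    (hi : Feasible n k par c (n - c) t)
    (hg : ∀ u, g' u = if u = n - c then t else
      if u = par (n - c) then rest n k (g (par (n - c))) t else g u) :
    Traced n k par x c g' := by
  obtain ⟨i, hi'⟩ : ∃ i, n - c = i + 1 := ⟨n - c - 1, by omega⟩
  have hi'' : n - (c + 1) = i := by omega
  have hpi := Finset.mem_Icc.1 (hpar (i + 1) (Finset.mem_Icc.2 (by omega)))
  obtain ⟨p, hp'⟩ : ∃ p, par (i + 1) = p := ⟨_, rfl⟩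
  obtain ⟨h1, h2, h3, h4, h5, h6⟩ := h
  simp only [hi', hi'', hp'] at hs hp hi hg h1 h2 h4 h5 h6 hpi
  rw [Nat.add_sub_cancel] at hpi
  have gi : g' (i + 1) = t := by rw [hg, if_pos rfl]
  have gp : g' p = rest n k (g p) t := by rw [hg, if_neg (by omega), if_pos rfl]
  have go : ∀ u, u ≤ i → u ≠ p → g' u = g u := fun u h1 h2 => by
    rw [hg, if_neg (by omega), if_neg h2]
  have gmod : ∀ u ≤ i, g' u % 2 ^ k = g u % 2 ^ k := fun u hu => by
    by_cases h : u = p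
    · rw [h, gp, rest_mod hs]
    · rw [go u hu h]
  have hcases : ∀ {a u}, u ∈ Finset.Icc a (n - c) → u = i + 1 ∨ (u ∈ Finset.Icc a i ∧ u ≤ i) :=
    fun {a u} hu => by
      rw [Finset.mem_Icc] at hu ⊢
      omega
  refine ⟨fun u hu => ?_, fun u hu => ?_, fun j hj => ?_, fun u hu => ?_, fun u hu => ?_, ?_⟩
  · rcases hcases hu with rfl | ⟨hu, hui⟩
    · rwa [gi]
    · by_cases hup : u = p
      · rwa [hup, gp]
      · have := h1 u hu
        rw [Feasible, hi', hp', if_neg hup] at this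
        rwa [go u hui hup]
  · rcases hcases hu with rfl | ⟨hu, hui⟩
    · rwa [gi]
    · by_cases hup : u = p
      · rw [hup, gp]
        exact rest_le.trans_lt (h2 p (hup ▸ hu))
      · rw [go u hui hup]
        exact h2 u hu
  · rw [bit_congr (gmod 1 (by omega)) hj, h3 j hj]
  · rcases hcases hu with rfl | ⟨hu, hui⟩
    · rw [gi]
      exact hs.2.2
    · rw [gmod u hui]
      exact h4 u hu
  · rcases hcases hu with rfl | ⟨hu, hui⟩
    · rw [gi, hp', sub_congr rfl (gmod p hpi.2)]
      exact hs.1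
    · have h7 := Finset.mem_Icc.1 (hpar u (Finset.mem_Icc.2 (by
        rw [Finset.mem_Icc] at hu; omega)))
      rw [sub_congr (gmod u hui) (gmod (par u) (by omega))]
      exact h5 u hu
  -- The total is preserved: the parent loses the code of `t` plus the size part of `t`, and the new
  -- vertex `i + 1` contributes exactly these two terms. Masks, hence the other codes, do not
  -- change.
  · have hmem : p ∈ Finset.Icc 1 i := Finset.mem_Icc.2 hpi
    have e1 : ∑ u ∈ Finset.Icc 2 i, code n k (g' u) = ∑ u ∈ Finset.Icc 2 i, code n k (g u) :=
      Finset.sum_congr rfl fun u hu => code_congr (gmod u (Finset.mem_Icc.1 hu).2)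
    have e2 : ∑ u ∈ (Finset.Icc 1 i).erase p, g' u / 2 ^ k =
        ∑ u ∈ (Finset.Icc 1 i).erase p, g u / 2 ^ k :=
      Finset.sum_congr rfl fun u hu => by
        rw [Finset.mem_erase, Finset.mem_Icc] at hu
        rw [go u hu.2.2 hu.1]
    rw [hi', Finset.sum_Icc_succ_top (by omega), Finset.sum_Icc_succ_top (by omega), e1, gi]
    rw [← Finset.add_sum_erase _ _ hmem] at h6 ⊢
    rw [e2, gp, rest_div hs]
    have := hs.2.1
    omega

/-- The code of the sizes of the parts below vertex `u`, where the last `c` vertices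
are already attached to their parents. -/
def below (n k : ℕ) (par m : ℕ → ℕ) : ℕ → ℕ → ℕ
  | 0, _ => 0
  | c + 1, u => if u = par (n - c) then
      below n k par m c u + (code n k (m (n - c)) + below n k par m c (n - c))
    else below n k par m c u

/-- The forward counterpart of the sum in `Traced`: attaching vertex `n - c` moves its code and what
lies below it into the size part of its parent. -/
theorem Labels.sum_below {n k x : ℕ} {par m : ℕ → ℕ} (h : Labels n k par x m)
    (hpar : ∀ i ∈ Finset.Icc 2 n, par i ∈ Finset.Icc 1 (i - 1)) (c : ℕ) (hc : c + 1 ≤ n) :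
    ∑ u ∈ Finset.Icc 1 (n - c), below n k par m c u +
      ∑ u ∈ Finset.Icc 2 (n - c), code n k (m u) = x := by
  induction c with
  | zero => simpa [below] using h.sum
  | succ c ih =>
    rw [← ih (by omega)]
    obtain ⟨i, hi'⟩ : ∃ i, n - c = i + 1 := ⟨n - c - 1, by omega⟩
    have hi'' : n - (c + 1) = i := by omega
    have hpi := Finset.mem_Icc.1 (hpar (i + 1) (Finset.mem_Icc.2 (by omega)))
    rw [Nat.add_sub_cancel] at hpi
    have hmem : par (i + 1) ∈ Finset.Icc 1 i := Finset.mem_Icc.2 hpi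
    have e2 : ∑ u ∈ (Finset.Icc 1 i).erase (par (i + 1)), below n k par m (c + 1) u =
        ∑ u ∈ (Finset.Icc 1 i).erase (par (i + 1)), below n k par m c u :=
      Finset.sum_congr rfl fun u hu => by
        rw [below, hi', if_neg (Finset.ne_of_mem_erase hu)]
    rw [hi', hi'', Finset.sum_Icc_succ_top (by omega), Finset.sum_Icc_succ_top (by omega),
      ← Finset.add_sum_erase _ _ hmem, ← Finset.add_sum_erase _ (below n k par m c) hmem, e2,
      below, hi', if_pos rfl]
    omega

/-- Completeness: in each attachment the state of the child read off from the masks is a witness.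
Containment of masks gives the first condition of `Splits`, and covering gives the last one. -/
theorem Labels.feasible {n k x : ℕ} {par m : ℕ → ℕ} (h : Labels n k par x m) (hx : x < n ^ k)
    (hpar : ∀ i ∈ Finset.Icc 2 n, par i ∈ Finset.Icc 1 (i - 1)) (c : ℕ) (hc : c + 1 ≤ n) (u : ℕ)
    (hu : u ∈ Finset.Icc 1 (n - c)) :
    Feasible n k par c u (2 ^ k * below n k par m c u + m u % 2 ^ k) := by
  have hq : 0 < 2 ^ k := by positivity
  have hdiv : ∀ a b, (2 ^ k * a + b % 2 ^ k) / 2 ^ k = a := fun a b => by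
    rw [Nat.mul_add_div hq, Nat.div_eq_of_lt (Nat.mod_lt _ hq), add_zero]
  have hmod : ∀ a b, (2 ^ k * a + b % 2 ^ k) % 2 ^ k = b % 2 ^ k := fun a b => by
    rw [Nat.mul_add_mod, Nat.mod_mod]
  induction c generalizing u with
  | zero => rw [Feasible, hdiv, below]
  | succ c ih =>
    rw [Finset.mem_Icc] at hu
    have hic : n - c ∈ Finset.Icc 2 n := Finset.mem_Icc.2 (by omega)
    rw [Feasible, below]
    split_ifs with hp
    -- One term of the invariant sum is at most the sum, so the size part of the child is below `n ^
    -- k` and its state is among the candidates of the search.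
    · have hz : below n k par m c (n - c) ≤ x := by
        rw [← h.sum_below hpar c (by omega)]
        exact le_add_right (Finset.single_le_sum (f := below n k par m c) (fun _ _ => Nat.zero_le _)
          (Finset.mem_Icc.2 (by omega)))
      have hsplit : Splits n k (2 ^ k * (below n k par m c u + (code n k (m (n - c)) +
          below n k par m c (n - c))) + m u % 2 ^ k)
          (2 ^ k * below n k par m c (n - c) + m (n - c) % 2 ^ k) := by
        refine ⟨?_, ?_, ?_⟩
        · rw [sub_congr (hmod _ _) (hmod _ _), hp]
          exact h.sub _ hic
        · rw [hdiv, hdiv, code_congr (hmod _ _)]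
          omega
        · rw [hmod]
          exact h.ne _ hic
      refine ⟨2 ^ k * below n k par m c (n - c) + m (n - c) % 2 ^ k, ?_, hsplit, ?_, ?_⟩
      · have h1 := Nat.mul_le_mul_left (2 ^ k) (Nat.succ_le_of_lt (hz.trans_lt hx))
        have h2 := Nat.mod_lt (m (n - c)) hq
        rw [Nat.mul_succ] at h1
        unfold numStates
        omega
      · rw [rest_eq hsplit, hdiv, hdiv, hmod, code_congr (hmod _ _),
          Nat.add_sub_cancel]
        exact ih (by omega) u (Finset.mem_Icc.2 (by omega))
      · exact ih (by omega) _ (Finset.mem_Icc.2 (by omega))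
    · exact ih (by omega) u (Finset.mem_Icc.2 (by omega))

/-- The recurrence decides whether there is a family of subtrees with a given code. -/
theorem Labels.feasible_root {n k x : ℕ} {par m : ℕ → ℕ} (h : Labels n k par x m) (hn : 1 ≤ n)
    (hx : x < n ^ k) (hpar : ∀ i ∈ Finset.Icc 2 n, par i ∈ Finset.Icc 1 (i - 1)) :
    Feasible n k par (n - 1) 1 (2 ^ k * x + (2 ^ k - 1)) := by
  have h1 := h.sum_below hpar (n - 1) (by omega)
  have h2 := h.feasible hx hpar (n - 1) (by omega) 1 (Finset.mem_Icc.2 (by omega))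
  rw [show n - (n - 1) = 1 by omega] at h1
  rw [mod_eq_of_full h.root] at h2
  rwa [← h1, Finset.Icc_self, Finset.sum_singleton, show Finset.Icc 2 1 = ∅ from rfl,
    Finset.sum_empty, add_zero]

/-! ### The table -/

/-- Row `c` of the table `A` is correct. -/
def TableRow (n k : ℕ) (par A : ℕ → ℕ) (c : ℕ) : Prop :=
  ∀ u ≤ n, ∀ s < numStates n k,
    (A (cell n (numStates n k) c u s) ≠ 0 ↔ Feasible n k par c u s)

theorem cell_eq (n S c u s : ℕ) : cell n S c u s = c * ((n + 1) * S) + (u * S + s) := by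
  unfold cell
  ring

theorem block_lt {n S u s : ℕ} (hu : u ≤ n) (hs : s < S) : u * S + s < (n + 1) * S := by
  have := Nat.mul_le_mul_right S hu
  rw [add_mul]
  omega

theorem block_inj {S u s u' s' : ℕ} (hs : s < S) (hs' : s' < S) (h : u * S + s = u' * S + s') :
    u = u' ∧ s = s' := by
  have h1 : (u * S + s) / S = u := by
    rw [mul_comm, Nat.mul_add_div (by omega), Nat.div_eq_of_lt hs, add_zero]
  have h2 : (u' * S + s') / S = u' := by
    rw [mul_comm, Nat.mul_add_div (by omega), Nat.div_eq_of_lt hs', add_zero]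
  have h3 : u = u' := by rw [← h1, h, h2]
  subst h3
  exact ⟨rfl, by omega⟩

theorem cell_lt {n S c u s : ℕ} (hu : u ≤ n) (hs : s < S) :
    cell n S c u s < (c + 1) * ((n + 1) * S) := by
  have := block_lt hu hs
  rw [cell_eq, add_mul c, one_mul]
  omega

/-- The state that remains is at most `s` and the state of the child is in range, so both questions
can be answered by the correct row `c` of the table. -/
theorem feasible_succ_iff {n k c s : ℕ} {par A : ℕ → ℕ} (hA : TableRow n k par A c)
    (hp : par (n - c) ≤ n) (hs : s < numStates n k) :
    Feasible n k par (c + 1) (par (n - c)) s ↔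
      ∃ t < numStates n k, Attaches n k A c (par (n - c)) (n - c) s t := by
  rw [Feasible, if_pos rfl]
  refine exists_congr fun t => and_congr_right fun ht => and_congr_right fun _ => ?_
  rw [hA _ hp _ (rest_le.trans_lt hs), hA _ (Nat.sub_le n c) _ ht]

/-- Fill row `0` of the table. -/
def fillFirst (k : ℕ) : Prog :=
  forTo 10 ((.var 0 + .lit 1) * .var 1)
    (write 5 (.var 10) (.lit 1 - (.var 10 - .var 1 * (.var 10 / .var 1)) / .lit (2 ^ k)))

theorem runs_fillFirst {Γ : Layout} {n k : ℕ} (hΓ : Fits Γ n k) (s : Store) (hn : s.var 0 = n)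
    (hS : s.var 1 = numStates n k) (par : ℕ → ℕ) :
    Runs Γ (fillFirst k) s ((n + 1) * numStates n k * (tick + (tick + tick)) + (tick + tick))
      fun s' => (∀ x < 10, s'.var x = s.var x) ∧ (∀ a, a ≠ 5 → s'.arr a = s.arr a) ∧
        TableRow n k par (s'.arr 5) 0 := by
  have hB := Γ.hB
  have hq := hΓ.two_pow_le
  -- The state is the remainder of the index modulo the number of states, and the entry is 1 exactly
  -- when its size part is 0.
  refine Runs.forTo ((n + 1) * numStates n k) (fun i s' => (∀ x < 10, s'.var x = s.var x) ∧
    (∀ a, a ≠ 5 → s'.arr a = s.arr a) ∧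
    ∀ x < i, s'.arr 5 x = 1 - x % numStates n k / 2 ^ k) (by simp) hΓ.states ?_ ?_ ?_ ?_
  · refine ⟨fun x hx => ?_, fun _ _ => rfl, by simp⟩
    simp; omega
  · rintro i s' ⟨h1, h2, h3⟩
    exact ⟨by simp; omega, by simp [h1, hn, hS]⟩
  · rintro i hi s' ⟨h1, h2, h3⟩ hv
    refine Runs.write (by simp) (by simp) (by simp; omega) (by norm_num) (by simp)
      (fun _ => (Nat.sub_le _ _).trans (show 1 ≤ Γ.B by omega)) ?_
    refine ⟨by simpa using hv, fun x hx => ?_, fun a ha => ?_, fun x hx => ?_⟩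
    · rw [← h1 x hx]
      simp; omega
    · rw [← h2 a ha]
      funext j
      simp [ha]
    · rcases Nat.lt_succ_iff_lt_or_eq.1 hx with hx | rfl
      · rw [← h3 x hx]
        simp; omega
      · simp [hv, h1, hS, Nat.mod_eq_sub_mul_div]
  · rintro s' ⟨h1, h2, h3⟩ -
    refine ⟨h1, h2, fun u hu t ht => ?_⟩
    rw [cell_eq, zero_mul, zero_add, h3 _ (block_lt hu ht), mul_comm, Nat.mul_add_mod,
      Nat.mod_eq_of_lt ht, Feasible]
    generalize t / 2 ^ k = y
    omega

/-- Copy row `12` of the table to the next row. -/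
def copyRow : Prog :=
  forTo 13 ((.var 0 + .lit 1) * .var 1)
    (write 5 ((.var 12 + .lit 1) * ((.var 0 + .lit 1) * .var 1) + .var 13)
      (.rd 5 (.var 12 * ((.var 0 + .lit 1) * .var 1) + .var 13)))

/-- Each stage is a contiguous block, and the target block lies directly above the source. Hence
copying damages neither the source nor an earlier stage. -/
theorem runs_copyRow {Γ : Layout} {n k : ℕ} (hΓ : Fits Γ n k) (s : Store) (hn : s.var 0 = n)
    (hS : s.var 1 = numStates n k) :
    Runs Γ copyRow s ((n + 1) * numStates n k * (tick + (tick + tick)) + (tick + tick))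
      fun s' => (∀ x < 13, s'.var x = s.var x) ∧ (∀ a, a ≠ 5 → s'.arr a = s.arr a) ∧
        (∀ j < (s.var 12 + 1) * ((n + 1) * numStates n k), s'.arr 5 j = s.arr 5 j) ∧
        ∀ x < (n + 1) * numStates n k,
          s'.arr 5 ((s.var 12 + 1) * ((n + 1) * numStates n k) + x) =
            s.arr 5 (s.var 12 * ((n + 1) * numStates n k) + x) := by
  have hB := Γ.hB
  refine Runs.forTo ((n + 1) * numStates n k) (fun i s' => (∀ x < 13, s'.var x = s.var x) ∧
    (∀ a, a ≠ 5 → s'.arr a = s.arr a) ∧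
    (∀ j < (s.var 12 + 1) * ((n + 1) * numStates n k), s'.arr 5 j = s.arr 5 j) ∧
    ∀ x < i, s'.arr 5 ((s.var 12 + 1) * ((n + 1) * numStates n k) + x) =
            s.arr 5 (s.var 12 * ((n + 1) * numStates n k) + x)) (by simp) hΓ.states ?_ ?_ ?_ ?_
  · refine ⟨fun x hx => ?_, fun _ _ => rfl, fun _ _ => rfl, by simp⟩
    simp; omega
  · rintro i s' ⟨h1, h2, h3, h4⟩
    exact ⟨by simp; omega, by simp [h1, hn, hS]⟩
  · rintro i hi s' ⟨h1, h2, h3, h4⟩ hv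
    have hval : s'.arr 5 (s.var 12 * ((n + 1) * numStates n k) + i) =
        s.arr 5 (s.var 12 * ((n + 1) * numStates n k) + i) :=
      h3 _ (by rw [add_mul (s.var 12), one_mul]; omega)
    refine Runs.write (by simp) (by simp; omega) (by simp; omega) (by norm_num) (by simp)
      (fun hs => hs.2 _ _) ?_
    refine ⟨by simpa using hv, fun x hx => ?_, fun a ha => ?_, fun j hj => ?_, fun x hx => ?_⟩
    · rw [← h1 x hx]
      simp; omega
    · rw [← h2 a ha]
      funext j
      simp [ha]
    · rw [← h3 j hj]
      simp [hv, h1, hS, hn]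
      omega
    · rcases Nat.lt_succ_iff_lt_or_eq.1 hx with hx | rfl
      · rw [← h4 x hx]
        simp [hv, h1, hS, hn]
        omega
      · simp [hv, h1, hS, hn, hval]
  · rintro s' h -
    exact h

/-- Recompute the part of row `12 + 1` that belongs to the vertex `21`, the parent of vertex
`22`. -/
def mergeRow (k : ℕ) : Prog :=
  forTo 14 (.var 1) (assign 23 (.var 14) ;; search k ;;
    write 5 (((.var 20 + .lit 1) * (.var 0 + .lit 1) + .var 21) * .var 1 + .var 14) (.var 24))

/-- The search consults only stage `c`, whereas the loop writes only into stage `c + 1`; the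
correctness of stage `c` therefore persists through all rounds. -/
theorem runs_mergeRow {Γ : Layout} {n k c : ℕ} (hΓ : Fits Γ n k) (par : ℕ → ℕ) (s : Store)
    (hn : s.var 0 = n) (hS : s.var 1 = numStates n k) (hc : s.var 20 = c)
    (hp : s.var 21 = par (n - c)) (hi : s.var 22 = n - c) (hpn : par (n - c) ≤ n)
    (hA : ∀ c' ≤ c, TableRow n k par (s.arr 5) c')
    (hA' : ∀ u ≤ n, ∀ t < numStates n k, s.arr 5 (cell n (numStates n k) (c + 1) u t) =
      s.arr 5 (cell n (numStates n k) c u t)) :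
    Runs Γ (mergeRow k) s
      (numStates n k * (tick + (searchTime n k + tick) + (tick + tick)) + (tick + tick))
      fun s' => (∀ x < 14, s'.var x = s.var x) ∧ (∀ a, a ≠ 5 → s'.arr a = s.arr a) ∧
        ∀ c' ≤ c + 1, TableRow n k par (s'.arr 5) c' := by
  have hB := Γ.hB
  obtain ⟨p, hp'⟩ : ∃ p, par (n - c) = p := ⟨_, rfl⟩
  refine Runs.forTo (numStates n k) (fun i s' => (∀ x < 23, x ≠ 14 → s'.var x = s.var x) ∧
    (∀ a, a ≠ 5 → s'.arr a = s.arr a) ∧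
    (∀ j, (∀ t < i, j ≠ cell n (numStates n k) (c + 1) p t) → s'.arr 5 j = s.arr 5 j) ∧
    ∀ t < i, (s'.arr 5 (cell n (numStates n k) (c + 1) p t) ≠ 0 ↔ Feasible n k par (c + 1) p t))
    (by simp) hΓ.numStates_le ?_ ?_ ?_ ?_
  · refine ⟨fun x hx _ => ?_, fun _ _ => rfl, fun _ _ => rfl, by simp⟩
    simp; omega
  · rintro i s' ⟨h1, h2, h3, h4⟩
    exact ⟨by simp, by simp [h1, hS]⟩
  · rintro i hi' s' ⟨h1, h2, h3, h4⟩ hv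
    have hlow : ∀ c' ≤ c, ∀ u ≤ n, ∀ t < numStates n k,
        s'.arr 5 (cell n (numStates n k) c' u t) = s.arr 5 (cell n (numStates n k) c' u t) := by
      intro c' hc' u hu t ht
      refine h3 _ fun t' _ => ?_
      have h5 := cell_lt (c := c') hu ht
      have h6 := Nat.mul_le_mul_right ((n + 1) * numStates n k) (show c' + 1 ≤ c + 1 by omega)
      rw [cell_eq n _ (c + 1)]
      omega
    have hrow : TableRow n k par (s'.arr 5) c := fun u hu t ht => by
      rw [hlow c le_rfl u hu t ht]
      exact hA c le_rfl u hu t ht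
    refine Runs.seq (Runs.assign (by simp) (by simp) (fun hs => hs.1 _) ?_)
    refine Runs.then (runs_search hΓ _ (by simp [h1, hn]) (by simp [h1, hS])) ?_
    rintro s₁ ⟨g1, g2, g3⟩
    simp [hv, h1, hc, hp, hi] at g3
    have v : ∀ x < 23, x ≠ 14 → s₁.var x = s.var x := fun x hx hx' => by
      rw [g1 x (by omega), ← h1 x hx hx']
      simp; omega
    have v14 : s₁.var 14 = i := by rw [g1 14 (by norm_num)]; simpa using hv
    have hidx : Expr.eval s₁ (((.var 20 + .lit 1) * (.var 0 + .lit 1) + .var 21) * .var 1 +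
        .var 14) = cell n (numStates n k) (c + 1) p i := by
      simp [v, v14, hc, hn, hp, hp', hS, cell]
    have hcorrect : s₁.var 24 ≠ 0 ↔ Feasible n k par (c + 1) p i := by
      rw [← hp', feasible_succ_iff hrow hpn hi']
      rcases g3 with ⟨g3, g4⟩ | ⟨g3, g4, g5, -⟩
      · simp only [g3, ne_eq, not_true, false_iff, not_exists, not_and]
        exact g4
      · simp only [g3, ne_eq, one_ne_zero, not_false_eq_true, true_iff]
        exact ⟨_, g5, g4⟩
    refine Runs.write (by simp) (by simp; omega) (by simp) (by norm_num) (by simp)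
      (fun hs => hs.1 _) ?_
    rw [hidx]
    have hinj : ∀ t < numStates n k, cell n (numStates n k) (c + 1) p t =
        cell n (numStates n k) (c + 1) p i → t = i := fun t _ h => by
      unfold cell at h
      omega
    refine ⟨by simpa using v14, fun x hx hx' => ?_, fun a ha => ?_, fun j hj => ?_, fun t ht => ?_⟩
    · rw [← v x hx hx']
      simp; omega
    · rw [← h2 a ha]
      funext j
      simp [ha, g2]
    · rw [← h3 j fun t ht => hj t (by omega)]
      have := hj i (by omega)
      simp [g2, this]
    · rcases Nat.lt_succ_iff_lt_or_eq.1 ht with ht | rfl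
      · rw [← h4 t ht]
        have : cell n (numStates n k) (c + 1) p t ≠ cell n (numStates n k) (c + 1) p i :=
          fun h => by have := hinj t (by omega) h; omega
        simp [this, g2]
      · simpa using hcorrect
  · rintro s' ⟨h1, h2, h3, h4⟩ -
    refine ⟨fun x hx => h1 x (by omega) (by omega), h2, fun c' hc' u hu t ht => ?_⟩
    rcases Nat.lt_succ_iff_lt_or_eq.1 (Nat.lt_succ_of_le hc') with hc' | rfl
    · rw [h3, hA c' (by omega) u hu t ht]
      intro t' _
      have h5 := cell_lt (c := c') hu ht
      have h6 := Nat.mul_le_mul_right ((n + 1) * numStates n k) (show c' + 1 ≤ c + 1 by omega)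
      rw [cell_eq n _ (c + 1)]
      omega
    -- An attachment changes the recurrence only at the parent. For every other vertex the copied
    -- entry is already correct.
    · by_cases hup : u = p
      · rw [hup]
        exact h4 t ht
      · rw [h3, hA' u hu t ht, hA c (by omega) u hu t ht, Feasible, hp', if_neg hup]
        intro t' ht' h
        rw [cell_eq, cell_eq] at h
        exact hup (block_inj ht ht' (by omega)).1

/-- Fill the table. -/
def fillTable (k : ℕ) : Prog :=
  fillFirst k ;; forTo 12 (.var 0 - .lit 1) (copyRow ;; assign 20 (.var 12) ;;
    assign 22 (.var 0 - .var 12) ;; assign 21 (.rd 4 (.var 22)) ;; mergeRow k)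

/-- The time bound for `fillTable`. -/
def fillTime (n k : ℕ) : ℕ :=
  (n + 1) * numStates n k * (tick + (tick + tick)) + (tick + tick) +
  ((n - 1) * ((n + 1) * numStates n k * (tick + (tick + tick)) + (tick + tick) +
    (tick + (tick + (tick + (numStates n k *
      (tick + (searchTime n k + tick) + (tick + tick)) + (tick + tick))))) + (tick + tick)) +
    (tick + tick))

theorem runs_fillTable {Γ : Layout} {n k : ℕ} (hΓ : Fits Γ n k) (s : Store)
    (hn : s.var 0 = n) (hS : s.var 1 = numStates n k)
    (hpar : ∀ i ∈ Finset.Icc 2 n, s.arr 4 i ∈ Finset.Icc 1 (i - 1)) :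
    Runs Γ (fillTable k) s (fillTime n k) fun s' => (∀ x < 10, s'.var x = s.var x) ∧
      (∀ a, a ≠ 5 → s'.arr a = s.arr a) ∧
        ∀ c < n, TableRow n k (s.arr 4) (s'.arr 5) c := by
  have hB := Γ.hB
  have hnB := hΓ.n_le
  refine Runs.then (runs_fillFirst hΓ s hn hS (s.arr 4)) ?_
  rintro s₀ ⟨f1, f2, f3⟩
  refine Runs.forTo (n - 1) (fun c s' => (∀ x < 10, s'.var x = s.var x) ∧
    (∀ a, a ≠ 5 → s'.arr a = s.arr a) ∧ ∀ c' ≤ c, TableRow n k (s.arr 4) (s'.arr 5) c') (by simp)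
    (by omega) ?_ ?_ ?_ ?_
  · refine ⟨fun x hx => ?_, f2, fun c' hc' => ?_⟩
    · rw [← f1 x hx]
      simp; omega
    · obtain rfl : c' = 0 := by omega
      exact f3
  · rintro i s' ⟨h1, h2, h3⟩
    exact ⟨by simp; omega, by simp [h1, hn]⟩
  · rintro c hc s' ⟨h1, h2, h3⟩ hv
    have hpc := Finset.mem_Icc.1 (hpar (n - c) (Finset.mem_Icc.2 (by omega)))
    refine Runs.then (runs_copyRow hΓ s' (by simp [h1, hn]) (by simp [h1, hS])) ?_
    rintro s₁ ⟨g1, g2, g3, g4⟩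
    rw [hv] at g3 g4
    have g1' : ∀ x < 10, s₁.var x = s.var x := fun x hx => by rw [g1 x (by omega), h1 x hx]
    have g12 : s₁.var 12 = c := by rw [g1 12 (by norm_num), hv]
    have e4 : s₁.arr 4 = s.arr 4 := by rw [g2 4 (by norm_num), h2 4 (by norm_num)]
    have hlow : ∀ c' ≤ c, ∀ u ≤ n, ∀ t < numStates n k, s₁.arr 5 (cell n (numStates n k) c' u t) =
        s'.arr 5 (cell n (numStates n k) c' u t) := by
      intro c' hc' u hu t ht
      have h5 := cell_lt (c := c') hu ht
      have h6 := Nat.mul_le_mul_right ((n + 1) * numStates n k) (show c' + 1 ≤ c + 1 by omega)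
      exact g3 _ (by omega)
    refine Runs.seq (Runs.assign (by simp) (by simp) (fun hs => hs.1 _) ?_)
    refine Runs.seq (Runs.assign (by simp) (by simp)
      (fun hs => (Nat.sub_le _ _).trans (hs.1 _)) ?_)
    refine Runs.seq (Runs.assign (by simp) (by simp) (fun hs => hs.2 _ _) ?_)
    refine Runs.mono (runs_mergeRow (c := c) hΓ (s.arr 4) _ (by simp [g1', hn])
      (by simp [g1', hS]) (by simp [g12]) (by simp [g1', g12, hn, e4]) (by simp [g1', g12, hn])
      (by omega) ?_ ?_) le_rfl ?_
    · intro c' hc' u hu t ht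
      rw [← h3 c' hc' u hu t ht, ← hlow c' hc' u hu t ht]
      rfl
    · intro u hu t ht
      have := g4 _ (block_lt hu ht)
      rw [← cell_eq, ← cell_eq, ← hlow c le_rfl u hu t ht] at this
      exact this
    · rintro s₂ ⟨k1, k2, k3⟩
      refine ⟨by rw [k1 12 (by norm_num)]; simpa using g12, fun x hx => ?_, fun a ha => ?_, k3⟩
      · rw [← g1' x hx]
        have := k1 x (by omega)
        simp [this]; split_ifs <;> omega
      · rw [Store.set_arr, k2 a ha, ← h2 a ha, ← g2 a ha]
        rfl
  · rintro s' ⟨h1, h2, h3⟩ -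
    exact ⟨h1, h2, fun c hc => h3 c (by omega)⟩

/-! ### The order of the vertices -/

/-- The vertices that are already found have the positions `1, …, m`; the others have position
`0`. For `i ≥ 2` the vertex at position `i` has a neighbour at position `par i < i`. -/
structure Ordering (n : ℕ) (adj : ℕ → ℕ → Prop) (r : ℕ) (pos par : ℕ → ℕ) (m : ℕ) : Prop where
  root : pos r = 1
  one_le : 1 ≤ m
  le : ∀ v < n, pos v ≤ m
  inj : ∀ v < n, ∀ w < n, pos v = pos w → pos v ≠ 0 → v = w
  surj : ∀ i, 1 ≤ i → i ≤ m → ∃ v < n, pos v = i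
  parent : ∀ v < n, 2 ≤ pos v → ∃ u < n, adj u v ∧ pos u = par (pos v) ∧ 1 ≤ pos u ∧ pos u < pos v

theorem Ordering.le_card {n r m : ℕ} {adj : ℕ → ℕ → Prop} {pos par : ℕ → ℕ}
    (h : Ordering n adj r pos par m) : m ≤ n := by
  have h1 : Finset.Icc 1 m ⊆ (Finset.range n).image pos := fun i hi => by
    obtain ⟨v, hv, rfl⟩ := h.surj i (Finset.mem_Icc.1 hi).1 (Finset.mem_Icc.1 hi).2
    exact Finset.mem_image_of_mem _ (Finset.mem_range.2 hv)
  simpa using (Finset.card_le_card h1).trans Finset.card_image_le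

theorem Ordering.eq_card {n r m : ℕ} {adj : ℕ → ℕ → Prop} {pos par : ℕ → ℕ}
    (h : Ordering n adj r pos par m) (h0 : ∀ v < n, pos v ≠ 0) : m = n := by
  refine le_antisymm h.le_card ?_
  have h1 : (Finset.range n).image pos ⊆ Finset.Icc 1 m := fun i hi => by
    obtain ⟨v, hv, rfl⟩ := Finset.mem_image.1 hi
    have hv := Finset.mem_range.1 hv
    have h2 := h.le v hv
    have h3 := h0 v hv
    rw [Finset.mem_Icc]
    omega
  have h2 : ((Finset.range n).image pos).card = n := by
    rw [Finset.card_image_of_injOn, Finset.card_range]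
    intro v hv w hw hvw
    have hv : v < n := by simpa using hv
    exact h.inj v hv w (by simpa using hw) hvw (h0 v hv)
  simpa [h2] using Finset.card_le_card h1

/-- The new entry of `par` stands at `m + 1`, which was nobody's position, so all earlier parents
keep their meaning. -/
theorem Ordering.attach {n r m u v : ℕ} {adj : ℕ → ℕ → Prop} {pos par : ℕ → ℕ}
    (h : Ordering n adj r pos par m) (hu : u < n) (hv : v < n) (huv : adj u v) (hpu : pos u ≠ 0)
    (hpv : pos v = 0) : Ordering n adj r (fun w => if w = v then m + 1 else pos w)
      (fun i => if i = m + 1 then pos u else par i) (m + 1) := by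
  have huv' : u ≠ v := by rintro rfl; exact hpu hpv
  refine ⟨?_, by omega, fun w hw => ?_, fun w hw x hx hwx h0 => ?_, fun i h1 h2 => ?_,
    fun w hw h2 => ?_⟩
  · have := h.root
    rw [if_neg (by rintro rfl; omega), this]
  · have := h.le w hw
    split_ifs <;> omega
  · have h1 := h.le w hw
    have h2 := h.le x hx
    split_ifs at hwx h0 with h3 h4 h4
    · rw [h3, h4]
    · omega
    · omega
    · exact h.inj w hw x hx hwx h0
  · rcases Nat.le_succ_iff.1 h2 with h2 | rfl
    · obtain ⟨w, hw, hwi⟩ := h.surj i h1 h2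
      refine ⟨w, hw, ?_⟩
      rw [if_neg (by rintro rfl; omega), hwi]
    · exact ⟨v, hv, if_pos rfl⟩
  · have hle := h.le w hw
    by_cases hwv : w = v
    · subst hwv
      have := h.le u hu
      refine ⟨u, hu, huv, ?_⟩
      simp only [if_true, huv', if_false, true_and]
      omega
    · simp only [hwv, if_false] at h2 ⊢
      obtain ⟨x, hx, h3, h4, h5, h6⟩ := h.parent w hw h2
      have hxv : x ≠ v := by rintro rfl; omega
      refine ⟨x, hx, h3, ?_⟩
      simp only [hxv, if_false, show pos w ≠ m + 1 by omega]
      exact ⟨h4, h5, h6⟩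

/-- Attach the vertex in variable `b` to the vertex in variable `a`. -/
def attach (a b : ℕ) : Prog :=
  assign 15 (.var 15 + .lit 1) ;; write 3 (.var b) (.var 15) ;;
    write 4 (.var 15) (.rd 3 (.var a))

/-- Consider the edge with number `11`. -/
def scanEdge : Prog :=
  assign 12 (.rd 1 (.var 11)) ;; assign 13 (.rd 2 (.var 11)) ;;
    cond (.rd 3 (.var 12)) (cond (.rd 3 (.var 13)) .skip (attach 12 13))
      (cond (.rd 3 (.var 13)) (attach 13 12) .skip)

/-- Compute positions and parents. -/
def orderTree : Prog :=
  write 3 (.var 4) (.lit 1) ;; assign 15 (.lit 1) ;;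
    forTo 10 (.var 0) (forTo 11 (.var 0 - .lit 1) scanEdge)

/-- The adjacency relation that is given by two lists of end vertices. -/
def AdjOf (m : ℕ) (a b : ℕ → ℕ) (u v : ℕ) : Prop :=
  ∃ e < m, (a e = u ∧ b e = v) ∨ (a e = v ∧ b e = u)

theorem runs_attach {Γ : Layout} {n k r a b u v : ℕ} {adj : ℕ → ℕ → Prop} (hΓ : Fits Γ n k)
    (s : Store) (h : Ordering n adj r (s.arr 3) (s.arr 4) (s.var 15)) (ha : s.var a = u)
    (hb : s.var b = v) (ha' : a ≠ 15) (hb' : b ≠ 15) (hu : u < n) (hv : v < n) (huv : adj u v)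
    (hpu : s.arr 3 u ≠ 0) (hpv : s.arr 3 v = 0) :
    Runs Γ (attach a b) s (tick + (tick + tick)) fun s' =>
      (∀ x ≠ 15, s'.var x = s.var x) ∧ (∀ c, c ≠ 3 → c ≠ 4 → s'.arr c = s.arr c) ∧
        Ordering n adj r (s'.arr 3) (s'.arr 4) (s'.var 15) ∧ (∀ w, s.arr 3 w ≠ 0 → s'.arr 3 w ≠ 0) ∧
        s'.arr 3 v ≠ 0 := by
  have hB := Γ.hB
  have hn := hΓ.n_le
  have h' := h.attach hu hv huv hpu hpv
  have hm := h'.le_card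
  refine Runs.seq (Runs.assign (by simp) (by simp; omega) (fun _ => by simp; omega) ?_)
  refine Runs.seq (Runs.write (by simp) (by simp) (by simp) (by norm_num) (by simp)
    (fun hs => hs.1 _) ?_)
  refine Runs.write (by simp) (by simp) (by simp) (by norm_num) (by simp) (fun hs => hs.2 _ _) ?_
  have huv' : u ≠ v := by rintro rfl; exact hpu hpv
  refine ⟨fun x hx => by simp [hx], fun c h3 h4 => ?_, ?_, fun w hw => ?_, ?_⟩
  · funext j
    simp [h3, h4]
  · convert h' using 1
    · funext w
      simp [ha, hb, ha', hb']
    · funext w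
      simp [ha, hb, ha', hb', huv']
    · simp
  · have : w ≠ v := by rintro rfl; exact hw hpv
    simpa [hb, hb', this] using hw
  · simp [hb, hb']

/-- The last clause is the point: after the scan the ends of the edge are either both found or both
not found. -/
theorem runs_scanEdge {Γ : Layout} {n k r e : ℕ} (hΓ : Fits Γ n k) (s : Store) (a b : ℕ → ℕ)
    (hab : ∀ e < n - 1, a e < n ∧ b e < n) (ha : s.arr 1 = a) (hb : s.arr 2 = b)
    (h : Ordering n (AdjOf (n - 1) a b) r (s.arr 3) (s.arr 4) (s.var 15)) (hv : s.var 11 = e)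
    (he : e < n - 1) :
    Runs Γ scanEdge s (20 * tick) fun s' =>
      (∀ x < 12, s'.var x = s.var x) ∧ (∀ c, c ≠ 3 → c ≠ 4 → s'.arr c = s.arr c) ∧
        Ordering n (AdjOf (n - 1) a b) r (s'.arr 3) (s'.arr 4) (s'.var 15) ∧
        (∀ w, s.arr 3 w ≠ 0 → s'.arr 3 w ≠ 0) ∧
        (s'.arr 3 (a e) ≠ 0 ↔ s'.arr 3 (b e) ≠ 0) := by
  have hB := Γ.hB
  have hn := hΓ.n_le
  obtain ⟨hae, hbe⟩ := hab e he
  refine Runs.mono (T := tick + (tick + (tick + ((tick + (tick + (tick + (tick + tick)))) +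
    (tick + ((tick + (tick + tick)) + tick)))))) ?_ (by unfold tick; norm_num) fun _ h => h
  refine Runs.seq (Runs.assign (by simp) (by simp) (fun hs => hs.2 _ _) ?_)
  refine Runs.seq (Runs.assign (by simp) (by simp) (fun hs => hs.2 _ _) ?_)
  refine Runs.cond (by simp) (by simp) (fun h1 => ?_) (fun h1 => ?_) <;>
    refine Runs.cond (by simp) (by simp) (fun h2 => ?_) (fun h2 => ?_) <;>
    simp [hv, ha, hb] at h1 h2
  · refine Runs.skip ⟨fun x hx => by simp; split_ifs <;> omega, fun _ _ _ => rfl, by simpa using h,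
      fun w hw => hw, by simp [h1, h2]⟩
  · refine Runs.mono (runs_attach (adj := AdjOf (n - 1) a b) (u := a e) (v := b e) hΓ _
      (by simpa using h) (by simp [hv, ha]) (by simp [hv, hb]) (by norm_num) (by norm_num) hae hbe
      ⟨e, he, Or.inl ⟨rfl, rfl⟩⟩ (by simpa using h1) (by simpa using h2)) le_rfl ?_
    rintro s' ⟨g1, g2, g3, g4, g5⟩
    refine ⟨fun x hx => ?_, g2, g3, g4, by simp [g4 _ h1, g5]⟩
    rw [g1 x (by omega)]
    simp; split_ifs <;> omega
  · refine Runs.mono (runs_attach (adj := AdjOf (n - 1) a b) (u := b e) (v := a e) hΓ _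
      (by simpa using h) (by simp [hv, hb]) (by simp [hv, ha]) (by norm_num) (by norm_num) hbe hae
      ⟨e, he, Or.inr ⟨rfl, rfl⟩⟩ (by simpa using h2) (by simpa using h1)) le_rfl ?_
    rintro s' ⟨g1, g2, g3, g4, g5⟩
    refine ⟨fun x hx => ?_, g2, g3, g4, by simp [g4 _ h2, g5]⟩
    rw [g1 x (by omega)]
    simp; split_ifs <;> omega
  · refine Runs.skip ⟨fun x hx => by simp; split_ifs <;> omega, fun _ _ _ => rfl, by simpa using h,
      fun w hw => hw, by simp [h1, h2]⟩

/-- The time bound for `orderTree`. -/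
def orderTime (n : ℕ) : ℕ :=
  tick + (tick + (n * ((n - 1) * (20 * tick + (tick + tick)) + (tick + tick) + (tick + tick)) +
    (tick + tick)))

/-- Induction on the distance from the root, in the style of Bellman and Ford: after `i` rounds all
vertices of depth at most `i` are found. The order of the edges is irrelevant, and `n` rounds
suffice. -/
theorem runs_orderTree {Γ : Layout} {n k r : ℕ} (hΓ : Fits Γ n k) (s : Store) (a b : ℕ → ℕ)
    (hab : ∀ e < n - 1, a e < n ∧ b e < n) (ha : s.arr 1 = a) (hb : s.arr 2 = b)
    (hn : s.var 0 = n) (hr : s.var 4 = r) (hrn : r < n) (h3 : ∀ v < n, s.arr 3 v = 0)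
    (depth : ℕ → ℕ) (hd0 : ∀ v < n, depth v = 0 → v = r) (hdn : ∀ v < n, depth v ≤ n)
    (hd : ∀ v < n, ∀ d, depth v = d + 1 → ∃ u < n, depth u = d ∧ AdjOf (n - 1) a b u v) :
    Runs Γ orderTree s (orderTime n) fun s' =>
      (∀ x < 10, s'.var x = s.var x) ∧ (∀ c, c ≠ 3 → c ≠ 4 → s'.arr c = s.arr c) ∧
        Ordering n (AdjOf (n - 1) a b) r (s'.arr 3) (s'.arr 4) n ∧ ∀ v < n, s'.arr 3 v ≠ 0 := by
  have hB := Γ.hB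
  have hnB := hΓ.n_le
  refine Runs.seq (Runs.write (by simp) (by simp) (by simp; omega) (by norm_num) (by simp)
    (fun _ => by simp; omega) ?_)
  refine Runs.seq (Runs.assign (by simp) (by simp; omega) (fun _ => by simp; omega) ?_)
  refine Runs.forTo n (fun i s' => (∀ x < 10, s'.var x = s.var x) ∧
    (∀ c, c ≠ 3 → c ≠ 4 → s'.arr c = s.arr c) ∧
    Ordering n (AdjOf (n - 1) a b) r (s'.arr 3) (s'.arr 4) (s'.var 15) ∧
    ∀ v < n, depth v ≤ i → s'.arr 3 v ≠ 0) (by simp) (by omega) ?_ ?_ ?_ ?_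
  · refine ⟨fun x hx => by simp; split_ifs <;> omega, fun c hc _ => ?_, ?_, fun v hv hdv => ?_⟩
    · funext j
      simp [hc]
    · refine ⟨by simp [hr], by simp, fun v hv => ?_, fun v hv w hw => ?_, fun i h1 h2 => ?_,
        fun v hv => ?_⟩
      · simp [hr]
        split_ifs <;> simp [h3 v hv]
      · simp [hr]
        by_cases hvr : v = r <;> by_cases hwr : w = r <;> simp [hvr, hwr, h3 v hv, h3 w hw]
      · simp at h2
        exact ⟨r, hrn, by simp [hr]; omega⟩
      · simp [hr]
        split_ifs <;> simp [h3 v hv]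
    · simp [hr, hd0 v hv (by omega)]
  · rintro i s' ⟨h1, -⟩
    exact ⟨by simp, by simp [h1, hn]⟩
  · rintro i hi s' ⟨g1, g2, g3, g4⟩ hv
    refine Runs.forTo (n - 1) (fun e s' => (∀ x < 11, x ≠ 10 → s'.var x = s.var x) ∧
      s'.var 10 = i ∧ (∀ c, c ≠ 3 → c ≠ 4 → s'.arr c = s.arr c) ∧
      Ordering n (AdjOf (n - 1) a b) r (s'.arr 3) (s'.arr 4) (s'.var 15) ∧
      (∀ v < n, depth v ≤ i → s'.arr 3 v ≠ 0) ∧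
      ∀ e' < e, (depth (a e') ≤ i → s'.arr 3 (b e') ≠ 0) ∧
        (depth (b e') ≤ i → s'.arr 3 (a e') ≠ 0)) (by simp) (by omega) ?_ ?_ ?_ ?_
    · refine ⟨fun x hx hx' => ?_, by simpa using hv, g2, by simpa using g3, g4, by simp⟩
      rw [← g1 x (by omega)]
      simp; omega
    · rintro e s' ⟨h1, -⟩
      exact ⟨by simp; omega, by simp [h1, hn]⟩
    · rintro e he s' ⟨k1, k2, k3, k4, k5, k6⟩ hv'
      refine Runs.mono (runs_scanEdge hΓ s' a b hab (by rw [k3 1 (by norm_num) (by norm_num), ha])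
        (by rw [k3 2 (by norm_num) (by norm_num), hb]) k4 hv' he) le_rfl ?_
      rintro s₁ ⟨l1, l2, l3, l4, l5⟩
      obtain ⟨hae, hbe⟩ := hab e he
      refine ⟨by rw [l1 11 (by norm_num), hv'], fun x hx hx' => ?_, ?_, fun c h3 h4 => ?_,
        by simpa using l3, fun v hv hdv => l4 v (k5 v hv hdv), fun e' he' => ?_⟩
      · rw [← k1 x hx hx', ← l1 x (by omega)]
        simp; omega
      · rw [← k2, ← l1 10 (by norm_num)]
        simp
      · rw [← k3 c h3 h4, ← l2 c h3 h4]
        rfl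
      · rcases Nat.lt_succ_iff_lt_or_eq.1 he' with he' | rfl
        · exact ⟨fun h => l4 _ ((k6 e' he').1 h), fun h => l4 _ ((k6 e' he').2 h)⟩
        · exact ⟨fun h => l5.1 (l4 _ (k5 _ hae h)), fun h => l5.2 (l4 _ (k5 _ hbe h))⟩
    · rintro s₁ ⟨k1, k2, k3, k4, k5, k6⟩ -
      refine ⟨k2, fun x hx => ?_, k3, by simpa using k4, fun v hv hdv => ?_⟩
      · rw [← k1 x (by omega) (by omega)]
        simp; omega
      -- A vertex of depth `i + 1` has a neighbour of depth `i`, which was found before this round;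
      -- the scan of the edge between them found the vertex.
      · rcases Nat.le_succ_iff.1 hdv with h | h
        · exact k5 v hv h
        · obtain ⟨u, hu, hdu, e, he, ⟨rfl, rfl⟩ | ⟨rfl, rfl⟩⟩ := hd v hv i h
          · exact (k6 e he).1 hdu.le
          · exact (k6 e he).2 hdu.le
  · rintro s' ⟨g1, g2, g3, g4⟩ -
    have h0 : ∀ v < n, s'.arr 3 v ≠ 0 := fun v hv => g4 v hv (hdn v hv)
    have := g3.eq_card h0
    exact ⟨g1, g2, this ▸ g3, h0⟩

/-! ### Recovering a solution -/

/-- Run the recurrence backwards. -/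
def traceBack (k : ℕ) : Prog :=
  write 6 (.lit 1) (.var 3) ;; forTo 16 (.var 0 - .lit 1) (
    assign 22 (.var 16 + .lit 2) ;; assign 20 (.var 0 - .var 22) ;; assign 21 (.rd 4 (.var 22)) ;;
    assign 23 (.rd 6 (.var 21)) ;; search k ;; write 6 (.var 21) (.var 26) ;;
    write 6 (.var 22) (.var 25))

/-- The time bound for `traceBack`. -/
def traceTime (n k : ℕ) : ℕ :=
  tick + ((n - 1) * (tick + (tick + (tick + (tick + (searchTime n k + (tick + tick))))) +
    (tick + tick)) + (tick + tick))

theorem runs_traceBack {Γ : Layout} {n k x : ℕ} (hΓ : Fits Γ n k) (s : Store)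
    (hn : s.var 0 = n) (hS : s.var 1 = numStates n k)
    (hpar : ∀ i ∈ Finset.Icc 2 n, s.arr 4 i ∈ Finset.Icc 1 (i - 1))
    (htab : ∀ c < n, TableRow n k (s.arr 4) (s.arr 5) c) (hx : x < n ^ k)
    (h3 : s.var 3 = 2 ^ k * x + (2 ^ k - 1)) (hroot : Feasible n k (s.arr 4) (n - 1) 1 (s.var 3)) :
    Runs Γ (traceBack k) s (traceTime n k) fun s' => (∀ x < 16, s'.var x = s.var x) ∧
      (∀ a, a ≠ 6 → s'.arr a = s.arr a) ∧ Labels n k (s.arr 4) x (s'.arr 6) := by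
  have hB := Γ.hB
  have hnB := hΓ.n_le
  have hn1 := hΓ.n_pos
  refine Runs.seq (Runs.write (by simp) (by simp; omega) (by simp) (by norm_num) (by simp)
    (fun hs => hs.1 _) ?_)
  refine Runs.forTo (n - 1) (fun j s' => (∀ x < 16, s'.var x = s.var x) ∧
    (∀ a, a ≠ 6 → s'.arr a = s.arr a) ∧ Traced n k (s.arr 4) x (n - 1 - j) (s'.arr 6)) (by simp)
    (by omega) ?_ ?_ ?_ ?_
  · refine ⟨fun x hx => by simp; omega, fun a ha => ?_, ?_⟩
    · funext j
      simp [ha]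
    · exact Traced.init hn1 hx (by simpa using h3) (by simpa using hroot)
  · rintro j s' ⟨h1, -⟩
    exact ⟨by simp; omega, by simp [h1, hn]⟩
  · rintro j hj s' ⟨g1, g2, g3⟩ hv
    -- Round `j` detaches the vertex at position `j + 2`, which is the one attached in passing from
    -- stage `c` to stage `c + 1` with `n - c = j + 2`.
    obtain ⟨c, hc⟩ : ∃ c, n = c + (j + 2) := ⟨n - (j + 2), by omega⟩
    have hi : n - c = j + 2 := by omega
    rw [show n - 1 - j = c + 1 by omega] at g3
    have hp := Finset.mem_Icc.1 (hpar (j + 2) (Finset.mem_Icc.2 (by omega)))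
    refine Runs.seq (Runs.assign (by simp) (by simp; omega) (fun _ => by simp [hv]; omega) ?_)
    refine Runs.seq (Runs.assign (by simp) (by simp)
      (fun hs => (Nat.sub_le _ _).trans (hs.1 _)) ?_)
    refine Runs.seq (Runs.assign (by simp) (by simp) (fun hs => hs.2 _ _) ?_)
    refine Runs.seq (Runs.assign (by simp) (by simp) (fun hs => hs.2 _ _) ?_)
    refine Runs.then (runs_search hΓ _ (by simp [g1, hn]) (by simp [g1, hS])) ?_
    rintro s₁ ⟨l1, l2, l3⟩
    simp [hv, g1, hn, g2, show n - (j + 2) = c by omega] at l3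
    rw [← hi] at l3
    have hrow := htab c (by omega)
    have hmem : s.arr 4 (n - c) ∈ Finset.Icc 1 (n - (c + 1)) := by
      rw [hi, Finset.mem_Icc]
      omega
    have hlt := g3.lt _ hmem
    have hpn : s.arr 4 (n - c) ≤ n := by rw [hi]; omega
    have hf := (feasible_succ_iff hrow hpn hlt).1 (g3.feasible _ hmem)
    -- The search cannot fail: the current state of the parent is feasible at stage `c + 1`, so a
    -- suitable state of the child exists.
    rcases l3 with ⟨-, l3⟩ | ⟨-, ⟨l3, l4, l5⟩, l6, l7⟩
    · obtain ⟨t, ht, ht'⟩ := hf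
      exact absurd ht' (l3 t ht)
    · rw [hrow _ hpn _ (rest_le.trans_lt hlt)] at l4
      rw [hrow _ (Nat.sub_le _ _) _ l6] at l5
      have v21 : s₁.var 21 = s.arr 4 (n - c) := by
        rw [l1 21 (by norm_num)]
        simp [hv, g2, hi]
      have v22 : s₁.var 22 = n - c := by
        rw [l1 22 (by norm_num)]
        simp [hv, hi]
      refine Runs.seq (Runs.write (by simp) (by simp) (by simp) (by norm_num) (by simp)
        (fun hs => hs.1 _) ?_)
      refine Runs.write (by simp) (by simp) (by simp) (by norm_num) (by simp) (fun hs => hs.1 _) ?_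
      refine ⟨?_, fun x hx => ?_, fun a ha => ?_, ?_⟩
      · have := l1 16 (by norm_num)
        simpa [hv] using this
      · rw [← g1 x hx]
        have := l1 x (by omega)
        simp [this]
        split_ifs <;> omega
      · rw [← g2 a ha]
        funext j
        simp [ha, l2]
      · rw [show n - 1 - (j + 1) = c by omega]
        refine Traced.step (by omega) hpar g3 l6 l3 l4 l5 fun u => ?_
        simp [v21, v22, l2, l7]
  · rintro s' ⟨h1, h2, h3⟩ -
    rw [Nat.sub_self] at h3
    exact ⟨h1, h2, h3.labels⟩

/-- Write the answer. -/
def output (k : ℕ) : Prog :=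
  forTo 17 (.var 0 - .lit 1) (
    assign 18 (.rd 6 (.rd 3 (.rd 1 (.var 17)))) ;; assign 19 (.rd 6 (.rd 3 (.rd 2 (.var 17)))) ;;
    assign 35 (.lit 1) ;;
    forTo 33 (.lit k) (
      write 0 (.lit 1 + .lit k * .var 17 + .var 33) (bitExpr 18 35 * bitExpr 19 35) ;;
      assign 35 (.var 35 * .lit 2))) ;;
  write 0 (.lit 0) (.lit 1)

/-- The time bound for `output`. -/
def outputTime (n k : ℕ) : ℕ :=
  (n - 1) * (tick + (tick + (tick + (k * (tick + tick + (tick + tick)) + (tick + tick)))) +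
    (tick + tick)) + (tick + tick) + tick

/-- The answer overwrites the input, but the ends of the edges are read from arrays `1` and `2`. A
product of two bits says that both ends lie in the part. -/
theorem runs_output {Γ : Layout} {n k : ℕ} (hΓ : Fits Γ n k) (s : Store) (hn : s.var 0 = n)
    (g : ℕ → ℕ → ℕ)
    (hg : ∀ e j, g e j = bit (s.arr 6 (s.arr 3 (s.arr 1 e))) j *
      bit (s.arr 6 (s.arr 3 (s.arr 2 e))) j) :
    Runs Γ (output k) s (outputTime n k) fun s' => s'.arr 0 0 = 1 ∧
      ∀ e < n - 1, ∀ j < k, s'.arr 0 (1 + k * e + j) = g e j := by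
  have hB := Γ.hB
  have hnB := hΓ.n_le
  have hD := hΓ.D
  have hk := hΓ.k_le
  have hidx : ∀ e < n - 1, ∀ j < k, 1 + k * e + j < Γ.D := fun e he j hj => by
    have h1 := Nat.mul_le_mul_left k (show e + 1 ≤ n by omega)
    rw [Nat.mul_succ] at h1
    have h2 : (k + 3) * (n + 1) = k * n + k + 3 * n + 3 := by ring
    omega
  -- Each edge owns a block of `k` consecutive cells, so a later block does not touch an earlier
  -- one.
  have hsep : ∀ e' e j' j, e' < e → j' < k → j < k → 1 + k * e' + j' ≠ 1 + k * e + j :=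
    fun e' e j' j he hj' hj => by
      have h1 := Nat.mul_le_mul_left k (show e' + 1 ≤ e by omega)
      rw [Nat.mul_succ] at h1
      omega
  refine Runs.seq ?_
  refine Runs.forTo (n - 1) (fun e s' => (∀ x < 17, s'.var x = s.var x) ∧
    (∀ a, a ≠ 0 → s'.arr a = s.arr a) ∧
    ∀ e' < e, ∀ j < k, s'.arr 0 (1 + k * e' + j) = g e' j) (by simp) (by omega) ?_ ?_ ?_ ?_
  · refine ⟨fun x hx => by simp; omega, fun _ _ => rfl, by simp⟩
  · rintro j s' ⟨h1, -⟩
    exact ⟨by simp; omega, by simp [h1, hn]⟩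
  · rintro e he s' ⟨h1, h2, h3⟩ hv
    refine Runs.seq (Runs.assign (by simp) (by simp) (fun hs => hs.2 _ _) ?_)
    refine Runs.seq (Runs.assign (by simp) (by simp) (fun hs => hs.2 _ _) ?_)
    refine Runs.seq (Runs.assign (by simp) (by simp; omega) (fun _ => by simp; omega) ?_)
    refine Runs.forTo k (fun i s' => (∀ x < 17, s'.var x = s.var x) ∧
      (∀ a, a ≠ 0 → s'.arr a = s.arr a) ∧ s'.var 17 = e ∧
      s'.var 18 = s.arr 6 (s.arr 3 (s.arr 1 e)) ∧ s'.var 19 = s.arr 6 (s.arr 3 (s.arr 2 e)) ∧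
      s'.var 35 = 2 ^ i ∧ (∀ e' < e, ∀ j < k, s'.arr 0 (1 + k * e' + j) = g e' j) ∧
      ∀ j < i, s'.arr 0 (1 + k * e + j) = g e j) (by simp) (by omega) ?_ ?_ ?_ ?_
    · refine ⟨fun x hx => ?_, h2, by simpa using hv, by simp [hv, h2], by simp [hv, h2], by simp,
        h3, by simp⟩
      rw [← h1 x hx]
      simp; split_ifs <;> omega
    · rintro j s' ⟨h1, -⟩
      exact ⟨by simp; omega, by simp⟩
    · rintro j hj s' ⟨k1, k2, k3, k4, k5, k6, k7, k8⟩ hv'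
      have hd := (Nat.pow_le_pow_right (n := 2) (by norm_num) hj).trans hΓ.two_pow_le
      have hval : Expr.eval s' (bitExpr 18 35 * bitExpr 19 35) = g e j := by
        simp [bitExpr, k4, k5, k6, bit_eq_sub, hg]
      have hix : Expr.eval s' (.lit 1 + .lit k * .var 17 + .var 33) = 1 + k * e + j := by
        simp [k3, hv']
      refine Runs.seq (Runs.write (by simp [bitExpr]) (by simp; omega) (by simp [bitExpr]; omega)
        (by norm_num) (fun _ => by rw [hix]; exact hidx e he j hj) (fun _ => ?_) ?_)
      · rw [hval, hg]
        exact (Nat.mul_le_mul (bit_le_one _ _) (bit_le_one _ _)).trans (by omega)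
      rw [hval, hix]
      refine Runs.assign (by simp) (by simp; omega) (fun _ => ?_) ?_
      · simpa [k6, pow_succ] using hd
      refine ⟨by simpa using hv', fun x hx => ?_, fun a ha => ?_, by simpa using k3,
        by simpa using k4, by simpa using k5, by simp [k6, pow_succ], fun e' he' j' hj' => ?_,
        fun j' hj' => ?_⟩
      · rw [← k1 x hx]
        simp; split_ifs <;> omega
      · rw [← k2 a ha]
        funext i
        simp [ha]
      · simp only [Store.set_arr, Store.put_arr]
        rw [if_neg (fun h => hsep e' e j' j he' hj' hj h.2), k7 e' he' j' hj']
      · simp only [Store.set_arr, Store.put_arr]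
        rcases Nat.lt_succ_iff_lt_or_eq.1 hj' with hj' | rfl
        · rw [if_neg (by omega), k8 j' hj']
        · simp
    · rintro s' ⟨k1, k2, k3, k4, k5, k6, k7, k8⟩ -
      refine ⟨k3, fun x hx => ?_, k2, fun e' he' j hj => ?_⟩
      · rw [← k1 x hx]
        simp; omega
      · rcases Nat.lt_succ_iff_lt_or_eq.1 he' with he' | rfl
        exacts [k7 e' he' j hj, k8 j hj]
  · rintro s' ⟨h1, h2, h3⟩ -
    refine Runs.write (by simp) (by simp) (by simp; omega) (by norm_num) (fun _ => ?_)
      (fun _ => by simp; omega) ?_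
    · rw [Expr.eval_lit]
      have : 0 < (k + 3) * (n + 1) := by positivity
      omega
    · refine ⟨by simp, fun e he j hj => ?_⟩
      rw [← h3 e he j hj]
      simp

/-! ### Reading the input -/

/-- The minimum of `t` and `n - 1`. -/
def clip (n t : ℕ) : ℕ := t - (t + 1 - n)

theorem clip_lt {n : ℕ} (hn : 1 ≤ n) (t : ℕ) : clip n t < n := by
  unfold clip
  omega

theorem sum_mul_pow_lt {n : ℕ} (hn : 1 ≤ n) (a : ℕ → ℕ) (ha : ∀ i, a i < n) (k : ℕ) :
    ∑ i ∈ Finset.range k, a i * n ^ i < n ^ k := by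
  induction k with
  | zero => simp
  | succ k ih =>
    rw [Finset.sum_range_succ, pow_succ]
    have h1 : a k * n ^ k ≤ (n - 1) * n ^ k := Nat.mul_le_mul_right _ (by have := ha k; omega)
    have h2 : (n - 1) * n ^ k + n ^ k = n ^ k * n := by
      obtain ⟨m, rfl⟩ : ∃ m, n = m + 1 := ⟨n - 1, by omega⟩
      rw [Nat.add_sub_cancel]
      ring
    omega

/-- The code of the clipped sizes. -/
def target (n : ℕ) (t : ℕ → ℕ) (k : ℕ) : ℕ := ∑ j ∈ Finset.range k, clip n (t j) * n ^ j

theorem target_lt {n : ℕ} (hn : 1 ≤ n) (t : ℕ → ℕ) (k : ℕ) : target n t k < n ^ k :=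
  sum_mul_pow_lt hn _ (fun _ => clip_lt hn _) k

/-- Read the numbers. -/
def readNumbers (k : ℕ) : Prog :=
  assign 0 (.rd 0 (.lit 0)) ;; assign 4 (.rd 0 (.lit 1)) ;; assign 2 (.lit 0) ;;
  assign 5 (.lit 0) ;; assign 6 (.lit 1) ;;
  forTo 10 (.lit k) (
    assign 11 (.rd 0 (.lit 2 + .var 10)) ;; assign 12 (.var 11 + .lit 1 - .var 0) ;;
    assign 2 (.var 2 + .var 12) ;; assign 5 (.var 5 + (.var 11 - .var 12) * .var 6) ;;
    assign 6 (.var 6 * .var 0)) ;;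
  assign 1 (.lit (2 ^ k) * .var 6) ;; assign 3 (.lit (2 ^ k) * .var 5 + .lit (2 ^ k - 1))

/-- The time bound for `readNumbers`. -/
def numbersTime (k : ℕ) : ℕ :=
  tick + (tick + (tick + (tick + (tick + ((k * (tick + (tick + (tick + (tick + tick))) +
    (tick + tick)) + (tick + tick)) + (tick + tick))))))

/-- Variable `2` is nonzero exactly when some size is at least `n`. Variable `3` is the state
required at the root: full mask and target code. -/
theorem runs_readNumbers {Γ : Layout} {n k : ℕ} (hΓ : Fits Γ n k) (s : Store) (t : ℕ → ℕ)
    (hn : s.arr 0 0 = n) (ht : ∀ j < k, s.arr 0 (2 + j) = t j)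
    (htB : ∑ j ∈ Finset.range k, t j + 1 ≤ Γ.B) :
    Runs Γ (readNumbers k) s (numbersTime k) fun s' => s'.arr = s.arr ∧ s'.var 0 = n ∧
      s'.var 1 = numStates n k ∧ s'.var 2 = ∑ j ∈ Finset.range k, (t j + 1 - n) ∧
      s'.var 3 = 2 ^ k * target n t k + (2 ^ k - 1) ∧ s'.var 4 = s.arr 0 1 := by
  have hB := Γ.hB
  have hk := hΓ.k_le
  have hn1 := hΓ.n_pos
  have hD := hΓ.D
  have hq := hΓ.two_pow_le
  have hkD : 2 + k < Γ.D := by nlinarith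
  refine Runs.seq (Runs.assign (by simp) (by simp; omega) (fun hs => hs.2 _ _) ?_)
  refine Runs.seq (Runs.assign (by simp) (by simp; omega) (fun hs => hs.2 _ _) ?_)
  refine Runs.seq (Runs.assign (by simp) (by simp) (fun _ => by simp) ?_)
  refine Runs.seq (Runs.assign (by simp) (by simp) (fun _ => by simp) ?_)
  refine Runs.seq (Runs.assign (by simp) (by simp; omega) (fun _ => by simp; omega) ?_)
  refine Runs.seq ?_
  refine Runs.forTo k (fun i s' => s'.arr = s.arr ∧ s'.var 0 = n ∧ s'.var 4 = s.arr 0 1 ∧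
    s'.var 2 = ∑ j ∈ Finset.range i, (t j + 1 - n) ∧ s'.var 5 = target n t i ∧
    s'.var 6 = n ^ i) (by simp) (by omega) ?_ ?_ ?_ ?_
  · simp [hn, target]
  · rintro j s' -
    simp; omega
  · rintro i hi s' ⟨h1, h2, h3, h4, h5, h6⟩ hv
    have hp := (Nat.pow_le_pow_right hn1 hi).trans hΓ.pow_le
    have e4 : ∑ j ∈ Finset.range (i + 1), (t j + 1 - n) =
      ∑ j ∈ Finset.range i, (t j + 1 - n) + (t i + 1 - n) := Finset.sum_range_succ _ _
    have e5 : target n t (i + 1) = target n t i + clip n (t i) * n ^ i :=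
      Finset.sum_range_succ _ _
    have hti : t i ≤ ∑ j ∈ Finset.range k, t j :=
      Finset.single_le_sum (f := t) (fun _ _ => Nat.zero_le _) (Finset.mem_range.2 hi)
    have b4 : ∑ j ∈ Finset.range (i + 1), (t j + 1 - n) ≤ Γ.B := by
      refine le_trans ?_ (Nat.le_of_succ_le htB)
      refine (Finset.sum_le_sum fun j _ => show t j + 1 - n ≤ t j by omega).trans ?_
      exact Finset.sum_le_sum_of_subset (Finset.range_subset_range.2 hi)
    have b5 : target n t (i + 1) ≤ Γ.B := (target_lt hn1 t (i + 1)).le.trans hp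
    refine Runs.seq (Runs.assign (by simp) (by simp; omega) (fun hs => hs.2 _ _) ?_)
    refine Runs.seq (Runs.assign (by simp) (by simp; omega) (fun _ => ?_) ?_)
    · simp [hv, h1, h2, ht i hi]
      omega
    refine Runs.seq (Runs.assign (by simp) (by simp) (fun _ => ?_) ?_)
    · simpa [hv, h1, h2, h4, ht i hi, ← e4] using b4
    refine Runs.seq (Runs.assign (by simp) (by simp) (fun _ => ?_) ?_)
    · simpa [hv, h1, h2, h5, h6, ht i hi, e5, clip] using b5
    refine Runs.assign (by simp) (by simp) (fun _ => ?_) ?_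
    · simpa [h2, h6, pow_succ] using hp
    simp [hv, h1, h2, h3, h4, h5, h6, ht i hi, e4, e5, clip, pow_succ]
  · rintro s' ⟨h1, h2, h3, h4, h5, h6⟩ -
    have hS := hΓ.numStates_le
    have ht' : 2 ^ k * target n t k + (2 ^ k - 1) ≤ Γ.B := by
      have h7 := Nat.mul_le_mul_left (2 ^ k) (Nat.succ_le_of_lt (target_lt hn1 t k))
      rw [Nat.mul_succ] at h7
      have hpos : 0 < 2 ^ k := by positivity
      unfold numStates at hS
      omega
    refine Runs.seq (Runs.assign (by simp) (by simp; omega) (fun _ => ?_) ?_)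
    · simpa [h6, numStates] using hS
    refine Runs.assign (by simp) (by simp; omega) (fun _ => ?_) ?_
    · simpa [h5] using ht'
    simp [h1, h2, h3, h4, h5, h6, numStates]

/-- Copy the edges. -/
def readEdges (k : ℕ) : Prog :=
  forTo 10 (.var 0 - .lit 1) (write 1 (.var 10) (.rd 0 (.lit (2 + k) + .lit 2 * .var 10)) ;;
    write 2 (.var 10) (.rd 0 (.lit (2 + k) + .lit 2 * .var 10 + .lit 1)))

/-- The time bound for `readEdges`. -/
def edgesTime (n : ℕ) : ℕ := (n - 1) * (tick + tick + (tick + tick)) + (tick + tick)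

theorem runs_readEdges {Γ : Layout} {n k : ℕ} (hΓ : Fits Γ n k) (s : Store) (hn : s.var 0 = n) :
    Runs Γ (readEdges k) s (edgesTime n) fun s' => (∀ x < 10, s'.var x = s.var x) ∧
      (∀ a, a ≠ 1 → a ≠ 2 → s'.arr a = s.arr a) ∧
      ∀ e < n - 1, s'.arr 1 e = s.arr 0 (2 + k + 2 * e) ∧
        s'.arr 2 e = s.arr 0 (2 + k + 2 * e + 1) := by
  have hB := Γ.hB
  have hk := hΓ.k_le
  have hnB := hΓ.n_le
  have hD : 2 + k + 2 * n ≤ Γ.D := le_trans (by nlinarith) hΓ.D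
  refine Runs.forTo (n - 1) (fun i s' => (∀ x < 10, s'.var x = s.var x) ∧
    (∀ a, a ≠ 1 → a ≠ 2 → s'.arr a = s.arr a) ∧
    ∀ e < i, s'.arr 1 e = s.arr 0 (2 + k + 2 * e) ∧
        s'.arr 2 e = s.arr 0 (2 + k + 2 * e + 1)) (by simp) (by omega) ?_ ?_ ?_ ?_
  · refine ⟨fun x hx => by simp; omega, fun _ _ _ => rfl, by simp⟩
  · rintro j s' ⟨h1, -⟩
    exact ⟨by simp; omega, by simp [h1, hn]⟩
  · rintro i hi s' ⟨h1, h2, h3⟩ hv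
    refine Runs.seq (Runs.write (by simp) (by simp) (by simp [hv]; omega) (by norm_num) (by simp)
      (fun hs => hs.2 _ _) ?_)
    refine Runs.write (by simp) (by simp) (by simp [hv]; omega) (by norm_num) (by simp)
      (fun hs => hs.2 _ _) ?_
    refine ⟨by simpa using hv, fun x hx => ?_, fun a ha ha' => ?_, fun e he => ?_⟩
    · rw [← h1 x hx]
      simp; omega
    · rw [← h2 a ha ha']
      funext j
      simp [ha, ha']
    · rcases Nat.lt_succ_iff_lt_or_eq.1 he with he | rfl
      · have : e ≠ i := by omega
        simpa [hv, this] using h3 e he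
      · simp [hv, h2]
  · rintro s' h -
    exact h

/-! ### Subtrees of a rooted tree -/

section Rooted

variable {V : Type*} {G : SimpleGraph V} {r : V} {pos : V → ℕ} {p : V → V}

/-- `p` is a parent function for the graph `G` with root `r`. -/
def IsParent (G : SimpleGraph V) (r : V) (pos : V → ℕ) (p : V → V) : Prop :=
  ∀ v ≠ r, G.Adj (p v) v ∧ pos (p v) < pos v

/-- If two such edges coincided crosswise, each of the two vertices would be the parent of the
other, and `pos` would decrease around a cycle. -/
theorem IsParent.injOn (h : IsParent G r pos p) : Set.InjOn (fun v => s(p v, v)) {r}ᶜ := by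
  intro v hv w hw hvw
  rcases Sym2.eq_iff.1 hvw with ⟨-, h2⟩ | ⟨h1, h2⟩
  · exact h2
  · have h3 := (h v hv).2
    have h4 := (h w hw).2
    rw [h1] at h3
    rw [← h2] at h4
    omega

/-- The parent edges are distinct and there is one for each non-root vertex, which is already the
number of edges of a tree. -/
theorem IsParent.edgeSet_eq [Fintype V] (h : IsParent G r pos p) (hG : G.IsTree) :
    G.edgeSet = (fun v => s(p v, v)) '' {r}ᶜ := by
  refine (Set.eq_of_subset_of_ncard_le ?_ ?_ (Set.toFinite _)).symm
  · rintro _ ⟨v, hv, rfl⟩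
    exact (h v hv).1
  · have h1 := (SimpleGraph.isTree_iff_connected_and_card.1 hG).2
    rw [h.injOn.ncard_image, Set.ncard_compl, Set.ncard_singleton]
    rw [← Nat.card_coe_set_eq]
    omega

theorem IsParent.reachable (h : IsParent G r pos p) (G' : SimpleGraph V) (v : V)
    (hv : ∀ u, pos u ≤ pos v → u ≠ r → G'.Adj (p u) u) : G'.Reachable v r := by
  induction hn : pos v using Nat.strong_induction_on generalizing v with
  | _ n ih =>
    by_cases hvr : v = r
    · rw [hvr]
    · have h1 := (h v hvr).2
      exact (hv v le_rfl hvr).symm.reachable.trans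
        (ih _ (hn ▸ h1) (p v) (fun u hu => hv u (hu.trans h1.le)) rfl)

/-- Every edge of a tree is a bridge. If `H` missed the edge from `v` to its parent, both ends would
still reach the root after its deletion: `v` inside `H`, and `p v` along its ancestors. -/
theorem IsParent.adj_of_connected (h : IsParent G r pos p) (hG : G.IsTree) (H : G.Subgraph)
    (hH : H.Connected) (hr : r ∈ H.verts) {v : V} (hv : v ∈ H.verts) (hvr : v ≠ r) :
    H.Adj (p v) v := by
  by_contra hadj
  have hbr := SimpleGraph.isAcyclic_iff_forall_adj_isBridge.1 hG.isAcyclic (h v hvr).1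
  rw [SimpleGraph.isBridge_iff] at hbr
  refine hbr ?_
  set G' := G.deleteEdges {s(p v, v)} with hG'
  have h1 : G'.Reachable (p v) r := by
    -- The ancestor path uses only parent edges of vertices `u` with `pos u ≤ pos (p v) < pos v`; by
    -- injectivity none of them is the deleted edge.
    refine h.reachable G' (p v) fun u hu hur => ?_
    rw [hG', SimpleGraph.deleteEdges_adj]
    refine ⟨(h u hur).1, fun he => ?_⟩
    have := h.injOn hur hvr he
    subst this
    have := (h u hur).2
    omega
  have h2 : G'.Reachable v r := by
    let f : H.coe →g G' := ⟨fun x => x.1, fun {a b} hab => by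
      rw [hG', SimpleGraph.deleteEdges_adj]
      refine ⟨H.adj_sub hab, fun he => hadj ?_⟩
      have : s(a.1, b.1) ∈ H.edgeSet := hab
      rw [Set.mem_singleton_iff.1 he] at this
      exact this⟩
    exact (hH.coe.preconnected ⟨v, hv⟩ ⟨r, hr⟩).map f
  exact h1.trans h2.symm

/-- The vertex sets of the connected subgraphs that contain the root. -/
def IsClosed (r : V) (p : V → V) (U : Set V) : Prop := r ∈ U ∧ ∀ v ∈ U, v ≠ r → p v ∈ U

theorem IsParent.isClosed_verts (h : IsParent G r pos p) (hG : G.IsTree) (H : G.Subgraph)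
    (hH : H.Connected) (hr : r ∈ H.verts) : IsClosed r p H.verts :=
  ⟨hr, fun _ hv hvr => H.edge_vert (h.adj_of_connected hG H hH hr hv hvr)⟩

theorem IsParent.edgeSet_subgraph [Fintype V] (h : IsParent G r pos p) (hG : G.IsTree)
    (H : G.Subgraph) (hH : H.Connected) (hr : r ∈ H.verts) :
    H.edgeSet = (fun v => s(p v, v)) '' (H.verts \ {r}) := by
  ext e
  constructor
  · intro he
    have he' := H.edgeSet_subset he
    rw [h.edgeSet_eq hG] at he'
    obtain ⟨v, hv, rfl⟩ := he'
    exact ⟨v, ⟨H.edge_vert (SimpleGraph.Subgraph.Adj.symm he), hv⟩, rfl⟩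
  · rintro ⟨v, ⟨hv, hvr⟩, rfl⟩
    exact h.adj_of_connected hG H hH hr hv hvr

theorem IsParent.ncard_edgeSet [Fintype V] (h : IsParent G r pos p) (hG : G.IsTree) (H : G.Subgraph)
    (hH : H.Connected) (hr : r ∈ H.verts) : H.edgeSet.ncard = (H.verts \ {r}).ncard := by
  rw [h.edgeSet_subgraph hG H hH hr,
    (h.injOn.mono fun v hv => hv.2 : Set.InjOn _ (H.verts \ {r})).ncard_image]

/-- Climbing to the parent stays inside `U` and decreases `pos`, so every vertex of `U` reaches the
root within `U`. -/
theorem IsParent.connected_induce (h : IsParent G r pos p) {U : Set V} (hU : IsClosed r p U) :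
    ((⊤ : G.Subgraph).induce U).Connected := by
  rw [SimpleGraph.Subgraph.connected_iff']
  have key : ∀ v (hv : v ∈ U), ((⊤ : G.Subgraph).induce U).coe.Reachable ⟨v, hv⟩ ⟨r, hU.1⟩ := by
    intro v hv
    induction hn : pos v using Nat.strong_induction_on generalizing v with
    | _ n ih =>
      by_cases hvr : v = r
      · subst hvr; rfl
      · obtain ⟨h1, h2⟩ := h v hvr
        have hpv := hU.2 v hv hvr
        refine SimpleGraph.Reachable.trans (SimpleGraph.Adj.reachable ?_)
          (ih _ (hn ▸ h2) (p v) hpv rfl)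
        exact ⟨hv, hpv, h1.symm⟩
  have : Nonempty ((⊤ : G.Subgraph).induce U).verts := ⟨⟨r, hU.1⟩⟩
  exact ⟨fun v w => (key v.1 v.2).trans (key w.1 w.2).symm⟩

/-- Growth by one vertex at a time. A missing vertex of least position has its parent already in the
set, so adding it keeps the set closed. -/
theorem IsParent.exists_isClosed_ncard [Fintype V] (h : IsParent G r pos p) {U : Set V}
    (hU : IsClosed r p U) {t : ℕ} (h1 : (U \ {r}).ncard ≤ t) (h2 : t + 1 ≤ Fintype.card V) :
    ∃ U', U ⊆ U' ∧ IsClosed r p U' ∧ (U' \ {r}).ncard = t := by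
  obtain ⟨d, rfl⟩ := Nat.exists_eq_add_of_le h1
  clear h1
  induction d with
  | zero => exact ⟨U, subset_rfl, hU, rfl⟩
  | succ d ih =>
    obtain ⟨W, hUW, hW, hWc⟩ := ih (by omega)
    have hne : ∃ v, v ∉ W := by
      by_contra! hall
      have : W = Set.univ := Set.eq_univ_of_forall hall
      have h3 := Set.ncard_sdiff_singleton_add_one hW.1
      rw [hWc, this, Set.ncard_univ, Nat.card_eq_fintype_card] at h3
      omega
    obtain ⟨v, hv, hmin⟩ : ∃ v, v ∉ W ∧ ∀ u, u ∉ W → pos v ≤ pos u := by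
      obtain ⟨v, hv, hm⟩ := Set.exists_min_image Wᶜ pos (Set.toFinite _) hne
      exact ⟨v, hv, fun u hu => hm u hu⟩
    have hvr : v ≠ r := fun hvr => hv (hvr ▸ hW.1)
    refine ⟨insert v W, hUW.trans (Set.subset_insert _ _), ⟨Set.mem_insert_of_mem _ hW.1, ?_⟩, ?_⟩
    · rintro u (rfl | hu) hur
      · refine Set.mem_insert_of_mem _ (by_contra fun hp => ?_)
        have := hmin _ hp
        have := (h u hvr).2
        omega
      · exact Set.mem_insert_of_mem _ (hW.2 u hu hur)
    · rw [Set.insert_sdiff_of_notMem _ (by simpa using hvr), Set.ncard_insert_of_notMem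
        (fun hv' => hv hv'.1), hWc]
      omega

end Rooted

/-! ### Subtrees and masks -/

/-- The vertices have the positions `1, …, n`, the root being the first one, `p` is the parent
function, and `par` is the parent function for the positions. -/
structure Numbering {n : ℕ} (G : SimpleGraph (Fin n)) (r : Fin n) (pos : Fin n → ℕ)
    (p : Fin n → Fin n) (par : ℕ → ℕ) : Prop where
  parent : IsParent G r pos p
  inj : Function.Injective pos
  mem : ∀ v, pos v ∈ Finset.Icc 1 n
  root : pos r = 1
  par : ∀ v ≠ r, par (pos v) = pos (p v)

theorem exists_mask (k : ℕ) (P : ℕ → Prop) : ∃ m, ∀ j < k, (bit m j = 1 ↔ P j) := by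
  classical
  refine ⟨Nat.ofBits fun j : Fin k => decide (P j), fun j hj => ?_⟩
  rw [bit_eq_testBit, Nat.testBit_ofBits_lt _ _ hj]
  simp

theorem eq_of_sum_eq {n k : ℕ} {a b : ℕ → ℕ} (hn : 1 ≤ n) (ha : ∀ i, a i < n) (hb : ∀ i, b i < n)
    (h : ∑ i ∈ Finset.range k, a i * n ^ i = ∑ i ∈ Finset.range k, b i * n ^ i) :
    ∀ i < k, a i = b i := by
  induction k with
  | zero => simp
  | succ k ih =>
    rw [Finset.sum_range_succ, Finset.sum_range_succ, add_comm, add_comm _ (b k * n ^ k)] at h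
    obtain ⟨h1, h2⟩ := block_inj (sum_mul_pow_lt hn a ha k) (sum_mul_pow_lt hn b hb k) h
    intro i hi
    rcases Nat.lt_succ_iff_lt_or_eq.1 hi with hi | rfl
    exacts [ih h2 i hi, h1]

namespace Numbering

variable {n : ℕ} {G : SimpleGraph (Fin n)} {r : Fin n} {pos : Fin n → ℕ} {p : Fin n → Fin n}
  {par : ℕ → ℕ}

theorem pos_ne_one (h : Numbering G r pos p par) {v : Fin n} (hv : v ≠ r) : pos v ≠ 1 :=
  fun h1 => hv (h.inj (h1.trans h.root.symm))

theorem image_pos (h : Numbering G r pos p par) :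
    (Finset.univ.erase r).image pos = Finset.Icc 2 n := by
  refine Finset.eq_of_subset_of_card_le (fun i hi => ?_) ?_
  · obtain ⟨v, hv, rfl⟩ := Finset.mem_image.1 hi
    have h1 := h.pos_ne_one (Finset.ne_of_mem_erase hv)
    have h2 := h.mem v
    rw [Finset.mem_Icc] at h2 ⊢
    omega
  · rw [Finset.card_image_of_injective _ h.inj, Finset.card_erase_of_mem (Finset.mem_univ _),
      Nat.card_Icc, Finset.card_univ, Fintype.card_fin]
    omega

theorem exists_pos (h : Numbering G r pos p par) {i : ℕ} (hi : i ∈ Finset.Icc 2 n) :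
    ∃ v ≠ r, pos v = i := by
  rw [← h.image_pos] at hi
  obtain ⟨v, hv, rfl⟩ := Finset.mem_image.1 hi
  exact ⟨v, Finset.ne_of_mem_erase hv, rfl⟩

theorem pos_mem (h : Numbering G r pos p par) {v : Fin n} (hv : v ≠ r) :
    pos v ∈ Finset.Icc 2 n := by
  rw [← h.image_pos]
  exact Finset.mem_image_of_mem _ (Finset.mem_erase.2 ⟨hv, Finset.mem_univ _⟩)

theorem par_mem (h : Numbering G r pos p par) : ∀ i ∈ Finset.Icc 2 n,
    par i ∈ Finset.Icc 1 (i - 1) := by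
  intro i hi
  obtain ⟨v, hv, rfl⟩ := h.exists_pos hi
  rw [h.par v hv]
  have h1 := Finset.mem_Icc.1 (h.mem (p v))
  have h2 := (h.parent v hv).2
  rw [Finset.mem_Icc]
  omega

/-- Double counting of pairs of a non-root vertex and a part containing it: exchange the two sums
and use that the positions of the non-root vertices are `2, …, n`. -/
theorem sum_code (h : Numbering G r pos p par) {k : ℕ} {m : ℕ → ℕ} {U : ℕ → Set (Fin n)}
    (hU : ∀ j < k, ∀ v, v ∈ U j ↔ bit (m (pos v)) j = 1) :
    ∑ u ∈ Finset.Icc 2 n, code n k (m u) =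
      ∑ j ∈ Finset.range k, (U j \ {r}).ncard * n ^ j := by
  classical
  unfold code
  rw [Finset.sum_comm]
  refine Finset.sum_congr rfl fun j hj => ?_
  rw [← Finset.sum_mul, ← h.image_pos, Finset.sum_image fun _ _ _ _ he => h.inj he]
  congr 1
  have : U j \ {r} = ↑((Finset.univ.erase r).filter fun v => bit (m (pos v)) j = 1) := by
    ext v
    simp [hU j (Finset.mem_range.1 hj) v, and_comm]
  rw [this, Set.ncard_coe_finset, Finset.card_filter]
  refine Finset.sum_congr rfl fun v _ => ?_
  have := bit_le_one (m (pos v)) j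
  split_ifs <;> omega

theorem exists_labels (h : Numbering G r pos p par) (k : ℕ) (U : ℕ → Set (Fin n))
    (hU : ∀ j < k, IsClosed r p (U j)) (hcov : ∀ v ≠ r, ∃ j < k, v ∈ U j) :
    ∃ m, Labels n k par (∑ j ∈ Finset.range k, (U j \ {r}).ncard * n ^ j) m := by
  choose m hm using fun i => exists_mask k fun j => ∃ v, pos v = i ∧ v ∈ U j
  have hm' : ∀ j < k, ∀ v, v ∈ U j ↔ bit (m (pos v)) j = 1 := fun j hj v => by
    rw [hm _ j hj]
    refine ⟨fun hv => ⟨v, rfl, hv⟩, ?_⟩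
    rintro ⟨w, hw, hwU⟩
    rwa [← h.inj hw]
  refine ⟨m, fun j hj => ?_, fun u hu => ?_, fun u hu j hj => ?_, h.sum_code hm'⟩
  · have := (hm' j hj r).1 (hU j hj).1
    rwa [h.root] at this
  · obtain ⟨v, hv, rfl⟩ := h.exists_pos hu
    obtain ⟨j, hj, hvj⟩ := hcov v hv
    exact exists_bit.2 ⟨j, hj, (hm' j hj v).1 hvj⟩
  · obtain ⟨v, hv, rfl⟩ := h.exists_pos hu
    have h1 := hm' j hj v
    have h2 := hm' j hj (p v)
    have h3 := (hU j hj).2 v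
    have h4 := bit_le_one (m (pos v)) j
    rw [h.par v hv]
    by_cases hb : bit (m (pos v)) j = 1
    · rw [hb, h2.1 (h3 (h1.2 hb) hv)]
    · omega

/-- The sets of vertices that are described by the masks. -/
def part (pos : Fin n → ℕ) (m : ℕ → ℕ) (j : ℕ) : Set (Fin n) := {v | bit (m (pos v)) j = 1}

theorem isClosed_part (h : Numbering G r pos p par) {k x : ℕ} {m : ℕ → ℕ}
    (hm : Labels n k par x m) {j : ℕ} (hj : j < k) : IsClosed r p (part pos m j) := by
  refine ⟨?_, fun v hv hvr => ?_⟩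
  · simp only [part, Set.mem_ofPred_eq, h.root]
    exact hm.root j hj
  · have h1 := hm.sub _ (h.pos_mem hvr) j hj
    have h2 := bit_le_one (m (pos (p v))) j
    simp only [part, Set.mem_ofPred_eq] at hv ⊢
    rw [hv, h.par v hvr] at h1
    omega

theorem exists_mem_part (h : Numbering G r pos p par) {k x : ℕ} {m : ℕ → ℕ}
    (hm : Labels n k par x m) {v : Fin n} (hv : v ≠ r) : ∃ j < k, v ∈ part pos m j :=
  exists_bit.1 (hm.ne _ (h.pos_mem hv))

/-- Both the actual sizes and the prescribed digits are less than `n`, so the base-`n` expansion of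
the common code is unique. Here the single number is decoded into `k` sizes. -/
theorem ncard_part (h : Numbering G r pos p par) {k : ℕ} {m a : ℕ → ℕ} (ha : ∀ i, a i < n)
    (hm : Labels n k par (∑ j ∈ Finset.range k, a j * n ^ j) m) :
    ∀ j < k, (part pos m j \ {r}).ncard = a j := by
  have hlt : ∀ U : Set (Fin n), (U \ {r}).ncard < n := fun U => by
    have h1 : (U \ {r}).ncard ≤ (Set.univ \ {r} : Set (Fin n)).ncard :=
      Set.ncard_le_ncard (Set.sdiff_subset_sdiff_left (Set.subset_univ U)) (Set.toFinite _)
    have h2 := Set.ncard_sdiff_singleton_add_one (Set.mem_univ r)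
    rw [Set.ncard_univ, Nat.card_eq_fintype_card, Fintype.card_fin] at h2
    omega
  refine eq_of_sum_eq (Nat.one_le_iff_ne_zero.2 (by have := r.2; omega)) (fun i => hlt _) ha ?_
  rw [← hm.sum]
  exact (h.sum_code fun _ _ _ => Iff.rfl).symm

end Numbering

/-- The properties of the relation `R` that the algorithm needs. If `f ≠ 0`, then the
prescribed sizes must be at most `n - 1`. -/
structure Admissible (R : ℕ → ℕ → Prop) (f : ℕ) : Prop where
  le : ∀ a b, R a b → a ≤ b
  small : f ≠ 0 → ∀ a b, R a b → a = b
  clip : ∀ n t, (f ≠ 0 → t + 1 ≤ n) → R (clip n t) t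

/-- The prescribed size with a given index, as a function on the natural numbers. -/
def Inst.sizeAt {k : ℕ} (I : Inst k) (j : ℕ) : ℕ := if h : j < k then I.size ⟨j, h⟩ else 0

theorem Inst.sizeAt_val {k : ℕ} (I : Inst k) (j : Fin k) : I.sizeAt j = I.size j := by
  rw [sizeAt, dif_pos j.2]

section Inst

variable {k : ℕ} {I : Inst k} {R : ℕ → ℕ → Prop} {f : ℕ} {pos : Fin I.n → ℕ}
  {p : Fin I.n → Fin I.n} {par : ℕ → ℕ}

theorem Inst.one_le (I : Inst k) : 1 ≤ I.n := by
  have := I.root.2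
  omega

theorem Inst.ncard_edgeSet_lt (I : Inst k) (H : I.tree.Subgraph) : H.edgeSet.ncard < I.n := by
  have h1 := (SimpleGraph.isTree_iff_connected_and_card.1 I.isTree).2
  have h2 := Set.ncard_le_ncard H.edgeSet_subset (Set.toFinite _)
  rw [Nat.card_coe_set_eq, Nat.card_eq_fintype_card, Fintype.card_fin] at h1
  omega

/-- If sizes must be exact, none of them can reach `n`, since a subgraph of the tree has at most `n
- 1` edges. This justifies the early rejection. -/
theorem sum_eq_zero_of_isCutting (hR : Admissible R f) {H : Fin k → I.tree.Subgraph}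
    (hH : I.IsCutting R H) : f * ∑ j ∈ Finset.range k, (I.sizeAt j + 1 - I.n) = 0 := by
  rcases Nat.eq_zero_or_pos f with hf | hf
  · rw [hf, zero_mul]
  · rw [Finset.sum_eq_zero, mul_zero]
    intro j hj
    have hj := Finset.mem_range.1 hj
    rw [show j = (⟨j, hj⟩ : Fin k).1 from rfl, I.sizeAt_val]
    have h3 := hR.small hf.ne' _ _ (hH.1 ⟨j, hj⟩).2.2
    have h4 := I.ncard_edgeSet_lt (H ⟨j, hj⟩)
    omega

/-- Part `j` has at most `min t_j (n - 1)` edges, and its vertex set can be enlarged to exactly that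
size. Enlarging does not destroy the covering. -/
theorem labels_of_isCutting (hR : Admissible R f) (h : Numbering I.tree I.root pos p par)
    {H : Fin k → I.tree.Subgraph} (hH : I.IsCutting R H) :
    ∃ m, Labels I.n k par (target I.n I.sizeAt k) m := by
  obtain ⟨h1, h2⟩ := hH
  have hle : ∀ j, (H j).edgeSet.ncard ≤ clip I.n (I.size j) := fun j => by
    have h3 := hR.le _ _ (h1 j).2.2
    have h4 := I.ncard_edgeSet_lt (H j)
    unfold clip
    omega
  have hclosed : ∀ j, ∃ U', (H j).verts ⊆ U' ∧ IsClosed I.root p U' ∧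
      (U' \ {I.root}).ncard = clip I.n (I.size j) := fun j => by
    refine h.parent.exists_isClosed_ncard (h.parent.isClosed_verts I.isTree _ (h1 j).1 (h1 j).2.1)
      ?_ ?_
    · rw [← h.parent.ncard_edgeSet I.isTree _ (h1 j).1 (h1 j).2.1]
      exact hle j
    · rw [Fintype.card_fin]
      exact clip_lt I.one_le _
  choose U hU1 hU2 hU3 using hclosed
  let U' : ℕ → Set (Fin I.n) := fun j => if hj : j < k then U ⟨j, hj⟩ else ∅
  have hU' : ∀ j (hj : j < k), U' j = U ⟨j, hj⟩ := fun j hj => dif_pos hj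
  obtain ⟨m, hm⟩ := h.exists_labels k U' (fun j hj => by rw [hU' j hj]; exact hU2 _)
    fun v hv => by
      have he : s(p v, v) ∈ I.tree.edgeSet := (h.parent v hv).1
      rw [← h2, Set.mem_iUnion] at he
      obtain ⟨j, hj⟩ := he
      refine ⟨j, j.2, ?_⟩
      rw [hU' j j.2]
      exact hU1 j ((H j).edge_vert (SimpleGraph.Subgraph.Adj.symm hj))
  refine ⟨m, ?_⟩
  convert hm using 1
  refine Finset.sum_congr rfl fun j hj => ?_
  have hj := Finset.mem_range.1 hj
  rw [hU' j hj, hU3, ← I.sizeAt_val]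

/-- The parts have exactly the clipped sizes. In the exact version `hf` ensures that clipping
changed nothing; in the bounded version clipping only decreases. -/
theorem isCutting_of_labels (hR : Admissible R f) (h : Numbering I.tree I.root pos p par)
    {m : ℕ → ℕ} (hf : f * ∑ j ∈ Finset.range k, (I.sizeAt j + 1 - I.n) = 0)
    (hm : Labels I.n k par (target I.n I.sizeAt k) m) :
    I.IsCutting R fun j => (⊤ : I.tree.Subgraph).induce (Numbering.part pos m j) := by
  have hc : ∀ j : Fin k, ((⊤ : I.tree.Subgraph).induce (Numbering.part pos m j)).Connected :=
    fun j => h.parent.connected_induce (h.isClosed_part hm j.2)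
  refine ⟨fun j => ⟨hc j, (h.isClosed_part hm j.2).1, ?_⟩, ?_⟩
  · rw [h.parent.ncard_edgeSet I.isTree _ (hc j) (h.isClosed_part hm j.2).1,
      SimpleGraph.Subgraph.induce_verts, h.ncard_part (fun _ => clip_lt I.one_le _) hm j j.2,
      I.sizeAt_val]
    refine hR.clip _ _ fun hf0 => ?_
    have h1 := (mul_eq_zero.1 hf).resolve_left hf0
    rw [Finset.sum_eq_zero_iff] at h1
    have h2 := h1 j (Finset.mem_range.2 j.2)
    rw [I.sizeAt_val] at h2
    omega
  · refine Set.Subset.antisymm (Set.iUnion_subset fun j => SimpleGraph.Subgraph.edgeSet_subset _) ?_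
    rw [h.parent.edgeSet_eq I.isTree]
    rintro _ ⟨v, hv, rfl⟩
    obtain ⟨j, hj, hvj⟩ := h.exists_mem_part hm hv
    rw [Set.mem_iUnion]
    refine ⟨⟨j, hj⟩, ?_⟩
    exact ⟨(h.isClosed_part hm hj).2 v hvj hv, hvj, (h.parent v hv).1⟩

end Inst

/-! ### The input list -/

theorem getD_flatMap_pair {α : Type*} (f g : α → ℕ) (l : List α) (i : ℕ) (hi : i < l.length) :
    (l.flatMap fun e => [f e, g e]).getD (2 * i) 0 = f l[i] ∧
      (l.flatMap fun e => [f e, g e]).getD (2 * i + 1) 0 = g l[i] := by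
  induction l generalizing i with
  | nil => simp at hi
  | cons a l ih =>
    cases i with
    | zero => simp
    | succ i =>
      have := ih i (by simpa using hi)
      simpa [Nat.mul_succ] using this

namespace Inst

variable {k : ℕ} (I : Inst k)

/-- The contents of the memory at the start. -/
def input (i : ℕ) : ℕ := I.encode.getD i 0

theorem input_zero : I.input 0 = I.n := rfl

theorem input_one : I.input 1 = I.root := rfl

theorem input_size {j : ℕ} (hj : j < k) : I.input (2 + j) = I.sizeAt j := by
  rw [add_comm, sizeAt, dif_pos hj, input, encode, List.getD_cons_succ, List.getD_cons_succ,
    List.getD_append _ _ _ _ (by simpa using hj), List.getD_eq_getElem _ _ (by simpa using hj)]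
  simp

theorem input_edges {e : ℕ} (he : e < I.edges.length) :
    I.input (2 + k + 2 * e) = I.edges[e].1 ∧ I.input (2 + k + 2 * e + 1) = I.edges[e].2 := by
  have key : ∀ i, I.input (2 + k + i) =
      (I.edges.flatMap fun e => [(e.1 : ℕ), (e.2 : ℕ)]).getD i 0 := fun i => by
    rw [show 2 + k + i = k + i + 1 + 1 by ring, input, encode, List.getD_cons_succ,
      List.getD_cons_succ, List.getD_append_right _ _ _ _ (by simp)]
    simp
  rw [add_assoc (2 + k), key, key]
  exact getD_flatMap_pair (fun e : Fin I.n × Fin I.n => (e.1 : ℕ)) (fun e => (e.2 : ℕ)) I.edges e he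

theorem length_edges : I.edges.length = I.n - 1 := by
  classical
  have h1 := (SimpleGraph.isTree_iff_connected_and_card.1 I.isTree).2
  have h2 : I.tree.edgeSet = ↑(I.edges.map fun e => s(e.1, e.2)).toFinset := by
    ext e
    rw [List.coe_toFinset, Set.mem_ofPred_eq, I.mem_edges]
  rw [Nat.card_coe_set_eq, h2, Set.ncard_coe_finset, List.toFinset_card_of_nodup I.nodup,
    List.length_map, Nat.card_eq_fintype_card, Fintype.card_fin] at h1
  omega

theorem length_encode : I.encode.length = 2 + k + 2 * (I.n - 1) := by
  simp [encode, I.length_edges]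
  omega

theorem sum_sizeAt : ∑ j ∈ Finset.range k, I.sizeAt j = ∑ j, I.size j := by
  rw [Finset.sum_range]
  exact Finset.sum_congr rfl fun j _ => I.sizeAt_val j

theorem input_le (i : ℕ) : I.input i ≤ I.n + ∑ j, I.size j := by
  have hroot := I.root.2
  have hmem : I.input i = 0 ∨ I.input i ∈ I.encode := by
    unfold input
    by_cases hi : i < I.encode.length
    · rw [List.getD_eq_getElem _ _ hi]
      exact Or.inr (List.getElem_mem hi)
    · exact Or.inl (List.getD_eq_default _ _ (by omega))
  rcases hmem with h | h
  · omega
  · simp only [encode, List.mem_cons, List.mem_append, List.mem_ofFn, List.mem_flatMap,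
      List.not_mem_nil, or_false] at h
    rcases h with h | h | ⟨j, h⟩ | ⟨e, -, h | h⟩
    · omega
    · omega
    · have := Finset.single_le_sum (f := I.size) (fun _ _ => Nat.zero_le _) (Finset.mem_univ j)
      omega
    · have := e.1.2
      omega
    · have := e.2.2
      omega

/-- The adjacency relation of the tree on natural numbers, as given by the input. -/
def Adj : ℕ → ℕ → Prop :=
  AdjOf (I.n - 1) (fun e => I.input (2 + k + 2 * e)) fun e => I.input (2 + k + 2 * e + 1)

theorem input_edges_lt {e : ℕ} (he : e < I.n - 1) :
    I.input (2 + k + 2 * e) < I.n ∧ I.input (2 + k + 2 * e + 1) < I.n := by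
  rw [← I.length_edges] at he
  obtain ⟨h1, h2⟩ := I.input_edges he
  rw [h1, h2]
  exact ⟨Fin.is_lt _, Fin.is_lt _⟩

theorem adj_iff (u v : Fin I.n) : I.Adj u v ↔ I.tree.Adj u v := by
  rw [← SimpleGraph.mem_edgeSet, ← I.mem_edges, List.mem_map, Adj, AdjOf, ← I.length_edges]
  constructor
  · rintro ⟨e, he, h⟩
    refine ⟨I.edges[e], List.getElem_mem he, ?_⟩
    rw [(I.input_edges he).1, (I.input_edges he).2] at h
    rw [Sym2.eq_iff]
    simpa only [Fin.val_inj] using h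
  · rintro ⟨x, hx, h⟩
    obtain ⟨e, he, rfl⟩ := List.getElem_of_mem hx
    refine ⟨e, he, ?_⟩
    rw [(I.input_edges he).1, (I.input_edges he).2]
    rw [Sym2.eq_iff] at h
    simpa only [Fin.val_inj] using h

/-- The distance from the root. -/
noncomputable def depth (v : ℕ) : ℕ := if h : v < I.n then I.tree.dist ⟨v, h⟩ I.root else 0

theorem depth_val (v : Fin I.n) : I.depth v = I.tree.dist v I.root := dif_pos v.2

theorem eq_root_of_depth {v : ℕ} (hv : v < I.n) (h : I.depth v = 0) : v = I.root := by
  have h1 := I.depth_val ⟨v, hv⟩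
  rw [show ((⟨v, hv⟩ : Fin I.n) : ℕ) = v from rfl, h] at h1
  exact congrArg Fin.val (I.isTree.connected.dist_eq_zero_iff.1 h1.symm)

theorem depth_le {v : ℕ} (hv : v < I.n) : I.depth v ≤ I.n := by
  have h1 := I.depth_val ⟨v, hv⟩
  obtain ⟨q, hq, hql⟩ := I.isTree.connected.exists_path_of_dist ⟨v, hv⟩ I.root
  have := hq.length_lt
  rw [Fintype.card_fin] at this
  change I.depth v = _ at h1
  omega

/-- Take the second vertex of a shortest walk to the root; the triangle inequality excludes a
smaller depth. -/
theorem exists_depth {v d : ℕ} (hv : v < I.n) (h : I.depth v = d + 1) :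
    ∃ u < I.n, I.depth u = d ∧ I.Adj u v := by
  have h1 := I.depth_val ⟨v, hv⟩
  change I.depth v = _ at h1
  obtain ⟨q, hq⟩ := I.isTree.connected.exists_walk_length_eq_dist ⟨v, hv⟩ I.root
  have hne : (⟨v, hv⟩ : Fin I.n) ≠ I.root := by
    intro he
    rw [he, SimpleGraph.dist_self] at h1
    omega
  obtain ⟨u, hadj, q, rfl⟩ := SimpleGraph.Walk.exists_eq_cons_of_ne hne q
  refine ⟨u, u.2, ?_, (I.adj_iff u ⟨v, hv⟩).2 hadj.symm⟩
  rw [SimpleGraph.Walk.length_cons] at hq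
  have h2 := SimpleGraph.dist_le q
  have h3 := I.isTree.connected.dist_triangle (u := ⟨v, hv⟩) (v := u) (w := I.root)
  rw [SimpleGraph.dist_eq_one_iff_adj.2 hadj] at h3
  rw [I.depth_val]
  omega

theorem exists_numbering {pos par : ℕ → ℕ} (h : Ordering I.n I.Adj I.root pos par I.n)
    (h0 : ∀ v < I.n, pos v ≠ 0) :
    ∃ p, Numbering I.tree I.root (fun v => pos v) p par := by
  have h2 : ∀ v : Fin I.n, v ≠ I.root → 2 ≤ pos v := fun v hv => by
    have h1 := h0 v v.2
    have h3 : pos v ≠ 1 := fun h3 =>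
      hv (Fin.ext (h.inj v v.2 I.root I.root.2 (h3.trans h.root.symm) h1))
    omega
  have key : ∀ v : Fin I.n, ∃ u : Fin I.n, v ≠ I.root →
      I.tree.Adj u v ∧ pos u = par (pos v) ∧ pos u < pos v := fun v => by
    by_cases hv : v = I.root
    · exact ⟨v, fun h => absurd hv h⟩
    · obtain ⟨u, hu, h3, h4, h5, h6⟩ := h.parent v v.2 (h2 v hv)
      exact ⟨⟨u, hu⟩, fun _ => ⟨(I.adj_iff ⟨u, hu⟩ v).1 h3, h4, h6⟩⟩
  choose p hp using key
  refine ⟨p, fun v hv => ⟨(hp v hv).1, (hp v hv).2.2⟩, fun v w hvw => ?_, fun v => ?_, h.root,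
    fun v hv => (hp v hv).2.1.symm⟩
  · exact Fin.ext (h.inj v v.2 w w.2 hvw (h0 v v.2))
  · have h1 := h0 v v.2
    have h3 := h.le v v.2
    rw [Finset.mem_Icc]
    omega

end Inst

/-! ### The whole program -/

/-- The main part of the program. If `f ≠ 0`, then sizes that are at least `n` are not allowed. -/
def mainProg (k f : ℕ) : Prog :=
  readNumbers k ;;
  cond (.lit f * .var 2) (write 0 (.lit 0) (.lit 0)) (
    readEdges k ;; orderTree ;; fillTable k ;;
    cond (.rd 5 (((.var 0 - .lit 1) * (.var 0 + .lit 1) + .lit 1) * .var 1 + .var 3))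
      (traceBack k ;; output k) (write 0 (.lit 0) (.lit 0)))

/-- The time bound for `mainProg`. -/
def mainTime (n k : ℕ) : ℕ :=
  numbersTime k + (tick + (tick + (edgesTime n + (orderTime n + (fillTime n k +
    (tick + (traceTime n k + outputTime n k + tick)))))))

/-- The part of the memory that matters contains a correct answer. -/
def Inst.Answered {k : ℕ} (R : ℕ → ℕ → Prop) (I : Inst k) (M : ℕ → ℕ) : Prop :=
  (M 0 = 0 ∧ ¬ ∃ H, I.IsCutting R H) ∨
    (M 0 = 1 ∧ ∃ (m : ℕ → ℕ) (H : Fin k → I.tree.Subgraph), I.IsCutting R H ∧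
      (∀ j, H j = (⊤ : I.tree.Subgraph).induce {v | bit (m v) j = 1}) ∧
      ∀ e < I.n - 1, ∀ j < k, M (1 + k * e + j) =
        bit (m (I.input (2 + k + 2 * e))) j * bit (m (I.input (2 + k + 2 * e + 1))) j)

theorem runs_mainProg {Γ : Layout} {k f : ℕ} {R : ℕ → ℕ → Prop} (hR : Admissible R f) (hf : f ≤ 1)
    (I : Inst k) (hΓ : Fits Γ I.n k) (hsum : ∑ j, I.size j + 1 ≤ Γ.B) (s : Store)
    (h0 : s.arr 0 = I.input) (h3 : ∀ v, s.arr 3 v = 0) :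
    Runs Γ (mainProg k f) s (mainTime I.n k) fun s' => I.Answered R (s'.arr 0) := by
  have hB := Γ.hB
  have hn1 := hΓ.n_pos
  have hDpos : 0 < Γ.D := by
    have := hΓ.D
    have : 0 < (k + 3) * (I.n + 1) := by positivity
    omega
  refine Runs.then (runs_readNumbers hΓ s I.sizeAt (by rw [h0, I.input_zero])
    (fun j hj => by rw [h0, I.input_size hj]) (by rw [I.sum_sizeAt]; exact hsum)) ?_
  rintro s₁ ⟨a1, a2, a3, a4, a5, a6⟩
  refine Runs.cond (by simp) (by simp; omega) (fun hbad => ?_) (fun hgood => ?_)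
  · refine Runs.write (by simp) (by simp) (by simp) (by norm_num) (fun _ => hDpos) (by simp) ?_
    refine Or.inl ⟨by simp, ?_⟩
    rintro ⟨H, hH⟩
    simp only [Expr.eval_mul, Expr.eval_lit, Expr.eval_var, a4] at hbad
    exact hbad (sum_eq_zero_of_isCutting hR hH)
  · simp only [Expr.eval_mul, Expr.eval_lit, Expr.eval_var, a4] at hgood
    refine Runs.then (runs_readEdges hΓ s₁ a2) ?_
    rintro s₂ ⟨b1, b2, b3⟩
    rw [a1, h0] at b3
    have hedge : ∀ e < I.n - 1, s₂.arr 1 e < I.n ∧ s₂.arr 2 e < I.n := fun e he => by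
      rw [(b3 e he).1, (b3 e he).2]
      exact I.input_edges_lt he
    have hadj : AdjOf (I.n - 1) (s₂.arr 1) (s₂.arr 2) = I.Adj := by
      funext u v
      refine propext (exists_congr fun e => and_congr_right fun he => ?_)
      rw [(b3 e he).1, (b3 e he).2]
    refine Runs.then (runs_orderTree (r := I.root) hΓ s₂ (s₂.arr 1) (s₂.arr 2) hedge rfl rfl
      (by rw [b1 0 (by norm_num), a2]) (by rw [b1 4 (by norm_num), a6, h0, I.input_one]) I.root.2
      (fun v _ => by rw [b2 3 (by norm_num) (by norm_num), a1, h3]) I.depth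
      (fun v hv h => I.eq_root_of_depth hv h) (fun v hv => I.depth_le hv)
      (fun v hv d h => by rw [hadj]; exact I.exists_depth hv h)) ?_
    rintro s₃ ⟨c1, c2, c3, c4⟩
    rw [hadj] at c3
    obtain ⟨p, hnum⟩ := I.exists_numbering c3 c4
    have v3 : ∀ x < 10, s₃.var x = s₁.var x := fun x hx => by rw [c1 x hx, b1 x hx]
    refine Runs.then (runs_fillTable hΓ s₃ (by rw [v3 0 (by norm_num), a2])
      (by rw [v3 1 (by norm_num), a3]) hnum.par_mem) ?_
    rintro s₄ ⟨d1, d2, d3⟩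
    have v4 : ∀ x < 10, s₄.var x = s₁.var x := fun x hx => by rw [d1 x hx, v3 x hx]
    have hx := target_lt hn1 I.sizeAt k
    have hstate : 2 ^ k * target I.n I.sizeAt k + (2 ^ k - 1) < numStates I.n k := by
      have h7 := Nat.mul_le_mul_left (2 ^ k) (Nat.succ_le_of_lt hx)
      have hpos : 0 < 2 ^ k := by positivity
      rw [Nat.mul_succ] at h7
      unfold numStates
      omega
    -- At stage `n - 1` all vertices are attached and vertex 1 is the root, so one entry of the
    -- table decides the instance.
    have hfeas := d3 (I.n - 1) (by omega) 1 hn1 _ hstate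
    have htest : Expr.eval s₄ (.rd 5 (((.var 0 - .lit 1) * (.var 0 + .lit 1) + .lit 1) * .var 1 +
        .var 3)) = s₄.arr 5 (cell I.n (numStates I.n k) (I.n - 1) 1
          (2 ^ k * target I.n I.sizeAt k + (2 ^ k - 1))) := by
      simp [v4, a2, a3, a5, cell]
    refine Runs.cond (by simp) (by simp; omega) (fun hyes => ?_) (fun hno => ?_)
    · rw [htest, hfeas] at hyes
      have e4 : s₄.arr 4 = s₃.arr 4 := d2 4 (by norm_num)
      refine Runs.then (runs_traceBack hΓ s₄ (by rw [v4 0 (by norm_num), a2])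
        (by rw [v4 1 (by norm_num), a3]) (by rw [e4]; exact hnum.par_mem) (by rw [e4]; exact d3)
        hx (by rw [v4 3 (by norm_num), a5]) (by rw [e4, v4 3 (by norm_num), a5]; exact hyes)) ?_
      rintro s₅ ⟨f1, f2, f3⟩
      rw [e4] at f3
      refine Runs.mono (runs_output hΓ s₅ (by rw [f1 0 (by norm_num), v4 0 (by norm_num), a2]) _
        fun _ _ => rfl) le_rfl ?_
      rintro s₆ ⟨g1, g2⟩
      have e1 : ∀ a, a ≠ 3 → a ≠ 4 → a ≠ 5 → a ≠ 6 → s₅.arr a = s₂.arr a := fun a h3 h4 h5 h6 => by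
        rw [f2 a h6, d2 a h5, c2 a h3 h4]
      have e3 : s₅.arr 3 = s₃.arr 3 := by rw [f2 3 (by norm_num), d2 3 (by norm_num)]
      refine Or.inr ⟨g1, fun v => s₅.arr 6 (s₃.arr 3 v), _, isCutting_of_labels hR hnum hgood f3,
        fun j => rfl, fun e he j hj => ?_⟩
      rw [g2 e he j hj, e3, e1 1 (by norm_num) (by norm_num) (by norm_num) (by norm_num),
        e1 2 (by norm_num) (by norm_num) (by norm_num) (by norm_num), (b3 e he).1, (b3 e he).2]
    · refine Runs.write (by simp) (by simp) (by simp) (by norm_num) (fun _ => hDpos) (by simp) ?_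
      refine Or.inl ⟨by simp, ?_⟩
      rintro ⟨H, hH⟩
      obtain ⟨m, hm⟩ := labels_of_isCutting hR hnum hH
      exact hfeas.2 (hm.feasible_root hn1 hx hnum.par_mem) (htest.symm.trans hno)

/-! ### Polynomial time bounds -/

/-- `T n` is at most a constant multiple of `n ^ d`, for `n ≥ 1`. -/
def PolyBound (d : ℕ) (T : ℕ → ℕ) : Prop := ∃ C, ∀ n, 1 ≤ n → T n ≤ C * n ^ d

namespace PolyBound

variable {d d' : ℕ} {S T : ℕ → ℕ}

theorem mono (h : PolyBound d T) (hd : d ≤ d') : PolyBound d' T := by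
  obtain ⟨C, hC⟩ := h
  exact ⟨C, fun n hn => (hC n hn).trans
    (Nat.mul_le_mul_left C (Nat.pow_le_pow_right hn hd))⟩

theorem const (c d : ℕ) : PolyBound d fun _ => c :=
  mono (d := 0) ⟨c, fun n _ => by simp⟩ (Nat.zero_le d)

theorem add (hS : PolyBound d S) (hT : PolyBound d T) : PolyBound d fun n => S n + T n := by
  obtain ⟨C, hC⟩ := hS
  obtain ⟨C', hC'⟩ := hT
  exact ⟨C + C', fun n hn => by rw [add_mul]; exact Nat.add_le_add (hC n hn) (hC' n hn)⟩

theorem mul (hS : PolyBound d S) (hT : PolyBound d' T) : PolyBound (d + d') fun n => S n * T n := by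
  obtain ⟨C, hC⟩ := hS
  obtain ⟨C', hC'⟩ := hT
  refine ⟨C * C', fun n hn => (Nat.mul_le_mul (hC n hn) (hC' n hn)).trans (le_of_eq ?_)⟩
  rw [pow_add]
  ring

theorem id : PolyBound 1 fun n => n := ⟨1, fun n _ => by simp⟩

theorem pred : PolyBound 1 fun n => n - 1 := ⟨1, fun n _ => by simp⟩

theorem succ : PolyBound 1 fun n => n + 1 := id.add (const 1 1)

end PolyBound

open PolyBound in
theorem polyBound_numStates (k : ℕ) : PolyBound k fun n => numStates n k :=
  ⟨2 ^ k, fun _ _ => le_rfl⟩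

open PolyBound in
theorem polyBound_searchTime (k : ℕ) : PolyBound k fun n => searchTime n k :=
  (((polyBound_numStates k).mul (const (k * 1200 + 3000) 0))).add (const _ _)

open PolyBound in
theorem polyBound_orderTime {k : ℕ} (hk : 1 ≤ k) : PolyBound (2 * k + 1) fun n => orderTime n := by
  unfold orderTime
  refine (const _ _).add ((const _ _).add (((id.mul (d' := 1) (((pred.mul (d' := 0)
    (const _ _)).add (const _ _)).add (const _ _))).mono ?_).add (const _ _)))
  omega

-- The merges cost `n * n ^ (2 * k)`. Copying the rows costs `n * n ^ (k + 1)` in total, which stays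
-- within the bound because `k ≥ 1`.
open PolyBound in
theorem polyBound_fillTime {k : ℕ} (hk : 1 ≤ k) : PolyBound (2 * k + 1) fun n => fillTime n k := by
  have h1 : PolyBound (k + 1) fun n =>
      (n + 1) * numStates n k * (tick + (tick + tick)) + (tick + tick) :=
    (((succ.mul (polyBound_numStates k)).mul (const _ 0)).mono (by omega)).add (const _ _)
  have h2 : PolyBound (2 * k) fun n => numStates n k *
      (tick + (searchTime n k + tick) + (tick + tick)) + (tick + tick) :=
    (((polyBound_numStates k).mul (((const _ _).add ((polyBound_searchTime k).add (const _ _))).add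
      (const _ _))).mono (by omega)).add (const _ _)
  unfold fillTime
  refine (h1.mono (by omega)).add (((pred.mul (d' := 2 * k) ((h1.mono (by omega)).add
    ((const _ _).add ((const _ _).add ((const _ _).add h2))) |>.add (const _ _))).mono ?_).add
    (const _ _))
  omega

open PolyBound in
theorem polyBound_mainTime {k : ℕ} (hk : 1 ≤ k) : PolyBound (2 * k + 1) fun n => mainTime n k := by
  have h1 : PolyBound (2 * k + 1) fun n => edgesTime n :=
    ((pred.mul (const _ 0)).mono (by omega)).add (const _ _)
  have h2 : PolyBound (2 * k + 1) fun n => traceTime n k := by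
    unfold traceTime
    refine (const _ _).add (((pred.mul (d' := k) (((const _ _).add ((const _ _).add
      ((const _ _).add ((const _ _).add ((polyBound_searchTime k).add (const _ _))))))
      |>.add (const _ _))).mono ?_).add (const _ _))
    omega
  have h3 : PolyBound (2 * k + 1) fun n => outputTime n k :=
    (((pred.mul (const _ 0)).mono (by omega)).add (const _ _)).add (const _ _)
  unfold mainTime
  exact (const _ _).add ((const _ _).add ((const _ _).add (h1.add ((polyBound_orderTime hk).add
    ((polyBound_fillTime hk).add ((const _ _).add ((h2.add h3).add (const _ _))))))))

/-! ### The start of the program -/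

/-- Compute the number of raw memory cells. -/
def prelude (k : ℕ) : Prog :=
  .load 3 1 ;; .const 1 1 ;; .op .add 3 3 1 ;; .const 1 (k + 3) ;; .op .mul 0 1 3

/-- The store at the start. -/
def Inst.store {k : ℕ} (I : Inst k) : Store where
  var _ := 0
  arr a i := if a = 0 then I.input i else 0

/-- The first `D` cells contain the whole input, so all cells of the arrays `1, …, 7` are initially
zero. The registers `1` and `3` used here are temporaries, on which `Rep` imposes nothing. -/
theorem Inst.exec_prelude {k : ℕ} (I : Inst k) (Γ : Layout) (hD : Γ.D = (k + 3) * (I.n + 1)) :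
    ∃ σ, Exec Γ.w (prelude k) (State.init I.encode) (1 + (1 + (1 + (1 + 1)))) σ ∧
      Rep Γ.D I.store σ := by
  have hlt : ∀ x ≤ Γ.D, x < 2 ^ Γ.w := fun x hx =>
    Γ.lt_word (a := 1) (by rw [pow_one]; exact hx.trans Γ.hD) (by norm_num)
  have hk : k + 3 ≤ Γ.D := by
    rw [hD]
    exact Nat.le_mul_of_pos_right _ (Nat.succ_pos _)
  have hn : I.n + 1 ≤ Γ.D := by
    rw [hD]
    exact Nat.le_mul_of_pos_left _ (Nat.succ_pos _)
  refine ⟨_, .seq _ _ _ _ _ _ _ (.load _ _ _) (.seq _ _ _ _ _ _ _ (.const _ _ _ (hlt 1 (by omega)))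
    (.seq _ _ _ _ _ _ _ (.op _ _ _ _ _ (hlt _ ?_))
    (.seq _ _ _ _ _ _ _ (.const _ _ _ (hlt _ hk)) (.op _ _ _ _ _ (hlt _ ?_))))), ?_⟩
  · simpa [Op.eval, State.setReg, State.init, Inst.encode] using hn
  · simp [Op.eval, State.setReg, State.init, Inst.encode, hD]
  · refine ⟨?_, fun x => ?_, fun i _ => rfl, fun a i h1 _ => ?_⟩
    · simp [Op.eval, State.setReg, State.init, Inst.encode, hD]
    · simp only [State.setReg, Op.eval]
      rw [Function.update_of_ne (by omega), Function.update_of_ne (by omega),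
        Function.update_of_ne (by omega), Function.update_of_ne (by omega),
        Function.update_of_ne (by omega)]
      rfl
    · have h2 : I.encode.length ≤ Γ.D + 8 * i + a := by
        have : 2 + k + 2 * (I.n - 1) ≤ (k + 3) * (I.n + 1) := by
          have h3 : (k + 3) * (I.n + 1) = k * I.n + k + 3 * I.n + 3 := by ring
          omega
        rw [I.length_encode, hD]
        omega
      have h3 : I.store.arr a i = 0 := if_neg (by omega)
      rw [h3]
      exact List.getD_eq_default _ _ h2

/-- The parts are induced subgraphs, so an edge of the tree belongs to a part exactly when both ends
do, that is, when the product of the bits is 1. -/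
theorem Inst.Answered.isAnswer {k : ℕ} {R : ℕ → ℕ → Prop} {I : Inst k} {M M' : ℕ → ℕ}
    (h : I.Answered R M) (hM : ∀ i < (k + 3) * (I.n + 1), M' i = M i) : I.IsAnswer R M' := by
  have h0 : M' 0 = M 0 := hM 0 (by positivity)
  rcases h with ⟨h1, h2⟩ | ⟨h1, m, H, h2, h3, h4⟩
  · exact Or.inl ⟨h0.trans h1, h2⟩
  · refine Or.inr ⟨h0.trans h1, H, h2, fun i j => ?_⟩
    have hi : (i : ℕ) < I.n - 1 := by
      rw [← I.length_edges]
      exact i.2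
    have hlt : 1 + k * i + j < (k + 3) * (I.n + 1) := by
      have g1 := Nat.mul_le_mul_left k (show (i : ℕ) + 1 ≤ I.n by omega)
      rw [Nat.mul_succ] at g1
      have g2 : (k + 3) * (I.n + 1) = k * I.n + k + 3 * I.n + 3 := by ring
      have := j.2
      omega
    obtain ⟨e1, e2⟩ := I.input_edges i.2
    rw [hM _ hlt, h4 i hi j j.2, e1, e2, h3]
    have hadj : I.tree.Adj (I.edges.get i).1 (I.edges.get i).2 := by
      rw [← SimpleGraph.mem_edgeSet, ← I.mem_edges, List.mem_map]
      exact ⟨_, List.get_mem _ _, rfl⟩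
    have b1 := bit_le_one (m ((I.edges.get i).1 : ℕ)) j
    have b2 := bit_le_one (m ((I.edges.get i).2 : ℕ)) j
    constructor
    · rintro ⟨g1, g2, -⟩
      have g1 : bit (m ((I.edges.get i).1 : ℕ)) j = 1 := g1
      have g2 : bit (m ((I.edges.get i).2 : ℕ)) j = 1 := g2
      exact (congrArg₂ (· * ·) g1 g2).trans (by norm_num)
    · intro hnot
      by_contra hne
      have g := mul_ne_zero_iff.1 hne
      have g1 : bit (m ((I.edges.get i).1 : ℕ)) j ≠ 0 := g.1
      have g2 : bit (m ((I.edges.get i).2 : ℕ)) j ≠ 0 := g.2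
      refine hnot ⟨?_, ?_, hadj⟩
      · exact (show bit (m ((I.edges.get i).1 : ℕ)) j = 1 by omega)
      · exact (show bit (m ((I.edges.get i).2 : ℕ)) j = 1 by omega)

/-- With `X = 2 ^ Nat.size N > N`, every relevant quantity is at most `B = X ^ (2 * k + 4)`, and `B
^ 40` is a power of two with exponent `40 * (2 * k + 4) * Nat.size N`. The additional 1 in `hC`
makes the inequality strict. -/
theorem Inst.exists_layout {k : ℕ} (I : Inst k) {C : ℕ} (hC : 40 * (2 * k + 4) + 1 ≤ C) :
    ∃ Γ : Layout, Γ.w = C * Nat.size (I.n + ∑ j, I.size j) ∧ Γ.D = (k + 3) * (I.n + 1) ∧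
      Fits Γ I.n k ∧ ∑ j, I.size j + 1 ≤ Γ.B ∧ I.n + ∑ j, I.size j ≤ Γ.B := by
  set N := I.n + ∑ j, I.size j with hN
  have hn := I.one_le
  have hsize : 1 ≤ Nat.size N := Nat.size_pos.2 (by omega)
  obtain ⟨X, hX⟩ : ∃ X, X = 2 ^ Nat.size N := ⟨_, rfl⟩
  have hNX : N < X := hX ▸ Nat.lt_size_self N
  have hX2 : 2 ≤ X := by omega
  have hpow : ∀ {a b}, a ≤ b → X ^ a ≤ X ^ b := fun h => Nat.pow_le_pow_right (by omega) h
  have hnX : I.n + 1 ≤ X ^ 1 := by rw [pow_one]; omega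
  have h2X : ∀ a, 2 ^ a ≤ X ^ a := fun a => Nat.pow_le_pow_left hX2 a
  have hnk : I.n ^ k ≤ X ^ k := Nat.pow_le_pow_left (by omega) k
  have hk3 : k + 3 ≤ X ^ (k + 2) := by
    have h1 : k + 2 < 2 ^ (k + 2) := Nat.lt_two_pow_self
    have h2 := h2X (k + 2)
    omega
  have hD : (k + 3) * (I.n + 1) ≤ X ^ (k + 2 + 1) := by
    rw [pow_add]
    exact Nat.mul_le_mul hk3 hnX
  have hB : 8 ≤ X ^ (2 * k + 4) := (h2X 3).trans (hpow (by omega))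
  have hX1 : X ≤ X ^ (2 * k + 4) := Nat.le_self_pow (by omega) X
  refine ⟨⟨C * Nat.size N, (k + 3) * (I.n + 1), X ^ (2 * k + 4), hD.trans (hpow (by omega)), hB,
    ?_⟩, rfl, rfl, ⟨hn, ?_, ?_, ?_, le_rfl⟩, ?_, ?_⟩
  · rw [hX, ← pow_mul, ← pow_mul]
    refine Nat.pow_lt_pow_right (by norm_num) ?_
    have := Nat.mul_le_mul_right (Nat.size N) hC
    have e : Nat.size N * ((2 * k + 4) * 40) + Nat.size N =
      (40 * (2 * k + 4) + 1) * Nat.size N := by ring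
    omega
  · calc (I.n + 1) * numStates I.n k ≤ X ^ 1 * (X ^ k * X ^ k) :=
          Nat.mul_le_mul hnX (Nat.mul_le_mul (h2X k) hnk)
      _ = X ^ (1 + (k + k)) := by rw [pow_add, pow_add]
      _ ≤ X ^ (2 * k + 4) := hpow (by omega)
  · calc k * I.n ^ k ≤ X ^ (k + 2) * X ^ k := Nat.mul_le_mul (by omega) hnk
      _ = X ^ (k + 2 + k) := by rw [← pow_add]
      _ ≤ X ^ (2 * k + 4) := hpow (by omega)
  · rw [add_comm]
    exact hk3.trans (hpow (by omega))
  · change _ ≤ X ^ (2 * k + 4)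
    omega
  · change _ ≤ X ^ (2 * k + 4)
    omega

theorem Inst.store_bounded {k : ℕ} (I : Inst k) {B : ℕ} (h : I.n + ∑ j, I.size j ≤ B) :
    I.store.Bounded B := by
  refine ⟨fun _ => Nat.zero_le _, fun a i => ?_⟩
  simp only [store]
  split_ifs
  exacts [(I.input_le i).trans h, Nat.zero_le _]

theorem exists_solves {k f : ℕ} {R : ℕ → ℕ → Prop} (hk : 1 ≤ k) (hR : Admissible R f)
    (hf : f ≤ 1) : ∃ p C, Solves k R p C := by
  obtain ⟨C, hC⟩ := (PolyBound.const 5 (2 * k + 1)).add (polyBound_mainTime hk)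
  refine ⟨prelude k ;; mainProg k f, C + (40 * (2 * k + 4) + 1), fun I => ?_⟩
  obtain ⟨Γ, hw, hD, hΓ, hs, hB⟩ := I.exists_layout (C := C + (40 * (2 * k + 4) + 1)) (by omega)
  obtain ⟨σ, hx, hσ⟩ := I.exec_prelude Γ hD
  obtain ⟨t, σ', s', ht, hx', hσ', -, hans⟩ := runs_mainProg hR hf I hΓ hs I.store
    rfl (fun v => rfl) (I.store_bounded hB) σ hσ
  rw [← hw]
  refine ⟨_, σ', .seq _ _ _ _ _ _ _ hx hx', ?_, hans.isAnswer fun i hi => hσ'.raw i (hD ▸ hi)⟩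
  have h1 : 5 + mainTime I.n k ≤ C * I.n ^ (2 * k + 1) := hC I.n I.one_le
  rw [add_mul]
  omega

/-! ### No parts -/

/-- The program for `k = 0`. -/
def zeroProg : Prog := .load 3 1 ;; .const 5 2 ;; .op .sub 3 5 3 ;; .store 1 3

/-- An empty union covers the edges only if there are none, that is, if `n = 1`. The truncated
difference `2 - n` is then 1 and otherwise 0, since `n ≥ 1`. -/
theorem solves_zero (R : ℕ → ℕ → Prop) : Solves 0 R zeroProg 4 := by
  intro I
  have hn := I.one_le
  have hsize : 1 ≤ Nat.size (I.n + ∑ j, I.size j) := Nat.size_pos.2 (by omega)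
  have hw : 2 < 2 ^ (4 * Nat.size (I.n + ∑ j, I.size j)) :=
    (show 2 < 2 ^ 4 by norm_num).trans_le (Nat.pow_le_pow_right (by norm_num) (by omega))
  refine ⟨1 + (1 + (1 + 1)), _, .seq _ _ _ _ _ _ _ (.load _ _ _) (.seq _ _ _ _ _ _ _
    (.const _ _ _ hw) (.seq _ _ _ _ _ _ _ (.op _ _ _ _ _ ?_) (.store _ _ _))),
    by simpa using hn, ?_⟩
  · refine lt_of_le_of_lt ?_ hw
    simp [Op.eval, State.setReg]
  · have hcard := (SimpleGraph.isTree_iff_connected_and_card.1 I.isTree).2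
    rw [Nat.card_coe_set_eq, Nat.card_eq_fintype_card, Fintype.card_fin] at hcard
    have hiff : (∃ H, I.IsCutting R H) ↔ I.tree.edgeSet = ∅ := by
      constructor
      · rintro ⟨H, -, hH⟩
        rw [← hH, Set.iUnion_of_empty]
      · intro h
        exact ⟨fun j => j.elim0, fun j => j.elim0, by rw [Set.iUnion_of_empty, h]⟩
    have key : ∀ M : ℕ → ℕ, M 0 = 2 - I.n → I.IsAnswer R M := by
      intro M hM
      by_cases h : I.n = 1
      · refine Or.inr ⟨by omega, ?_⟩
        obtain ⟨H, hH⟩ := hiff.2 ((Set.ncard_eq_zero (Set.toFinite _)).1 (by omega))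
        exact ⟨H, hH, fun _ j => j.elim0⟩
      · refine Or.inl ⟨by omega, fun hH => ?_⟩
        rw [hiff.1 hH, Set.ncard_empty] at hcard
        omega
    refine key _ ?_
    simp [Op.eval, State.setReg, State.setMem, State.init, Inst.encode]

end TreeCutting

theorem mainTheorem3 (k : ℕ) :
    (∃ (p : TreeCutting.Prog) (C : ℕ), TreeCutting.Solves k (fun a b => a = b) p C) ∧
      (∃ (p : TreeCutting.Prog) (C : ℕ), TreeCutting.Solves k (fun a b => a ≤ b) p C) := by
  rcases Nat.eq_zero_or_pos k with rfl | hk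
  · exact ⟨⟨_, _, TreeCutting.solves_zero _⟩, ⟨_, _, TreeCutting.solves_zero _⟩⟩
  -- The flag `f = 1` rejects sizes that are at least `n`, as equality requires; for the relation
  -- `≤` the flag `0` switches the rejection off, and such sizes are clipped.
  · refine ⟨TreeCutting.exists_solves (f := 1) hk ⟨fun a b h => h.le, fun _ a b h => h, ?_⟩ le_rfl,
      TreeCutting.exists_solves (f := 0) hk ⟨fun a b h => h, fun h => absurd rfl h, ?_⟩ zero_le_one⟩
    · intro n t h
      have := h one_ne_zero
      unfold TreeCutting.clip
      omega
    · intro n t _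
      exact Nat.sub_le _ _
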